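/- **Setting.** Let $S$ be a finite set of places of $\mathbb{Q}$ of odd cardinality containing $\infty$ and a prime $p$, let $N^+\ge 1$ be a square-free integer not divisible by any finite place in $S$, and let $N$ be the product of $N^+$ and all finite places in $S$; assume $2\nmid N$. Let $B$ be the quaternion algebra over $\mathbb{Q}$ ramified exactly at $S\setminus\{p\}$, let $R\subset B$ be an Eichler $\mathbb{Z}[1/p]$-order of level $N^+$, and let $\Gamma$ be the group of elements of reduced norm $1$ in $R$; assume that $\Gamma/\{\pm1\}$ is torsion-free. Let $V\subset B$ be the space of elements of reduced trace zero, $Q$ the restriction of the reduced norm to $V$, and $\langle v,w\rangle=Q(v+w)-Q(v)-Q(w)$. Fix an isomorphism $B\otimes\mathbb{Q}_p\simeq \mathrm{M}_2(\mathbb{Q}_p)$. It identifies the conic of isotropic lines in $V_{\mathbb{C}_p}$ with $\mathbb{P}^1(\mathbb{C}_p)$ (a line of nilpotent matrices is sent to its kernel), and $\Gamma$ acts by Möbius transformations on $\mathscr H_p=\mathbb{P}^1(\mathbb{C}_p)\setminus\mathbb{P}^1(\mathbb{Q}_p)$; let $\pi:\mathscr H_p\to\Gamma\backslash\mathscr H_p$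 be the projection. For $0\neq v\in V$ let $\Delta(v)$ be the sum of the points of $\mathscr H_p$ orthogonal to $v$, and let $\mathcal D_S$ be the set of integers $D$ such that $Q(v)=D$ and $\Delta(v)\ne0$ for some $0\neq v\in V$. **Divisors of strong degree $0$.** For a vertex $L$ of the Bruhat–Tits tree of $\mathrm{GL}_2(\mathbb{Q}_p)$ let $\mathcal A_L\subset\mathscr H_p$ be the preimage of $L$ under the reduction map, and let $\mathcal W_L$ be the preimage of the union of $L$ and the open edges with endpoint $L$. Fix a parity on the vertices such that neighbours have different parity. A finite divisor on $\mathscr H_p$ is of strong degree $0$ in an even (resp. odd) sense if its intersections with $\mathcal W_L$ for all even (resp. odd) $L$ and with $\mathcal A_L$ for all odd (resp. even) $L$ have degree $0$. A divisor on $\Gamma\backslash\mathscr H_p$ is of strong degree $0$ if it is of the form $\pi_*\mathscr D_e=\pi_*\mathscr D_o$ with $\mathscr D_e$ and $\mathscr D_o$ of strong degree $0$ in an even and an odd sense, respectively. **Convenient functions.** A $\mathbb{Z}$-valued Schwartz–Bruhat function $\Phi$ on $V_{\mathbb{A}^{p,\infty}}$ is *special* if it is invariant under conjugation by $\hat R^\times$,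 where $\hat R=R\otimes\prod_{\ell\ne p}\mathbb{Z}_\ell$, if it is invariant under the Weil representation action of the group of matrices in $\mathrm{SL}_2(\prod_{\ell\neq p}\mathbb{Z}_\ell)$ with lower left entry divisible by $4N$ (lifted to the metaplectic cover in the way that corresponds to the theta multiplier of weight $3/2$), and if $\Phi(pv)=\Phi(v)$ for all $v\in V$. For $D\neq 0$ put $$\Delta_\Phi(D)=\sum_{v\in\Gamma\backslash V,\;Q(v)=D}\frac{\Phi(v)}{\#\mathrm{Stab}_{\Gamma/\{\pm1\}}(v)}\,\pi_*\Delta(v).$$ The function $\Phi$ is *convenient* if it is special, $\Phi(0)=0$, and $\Delta_\Phi(D)$ is of strong degree $0$ for every $D\in\mathcal D_S$. **Automorphy factors.** For divisors $\mathscr D_0,\mathscr D_1$ of degree $0$ with disjoint supports let $[\mathscr D_0;\mathscr D_1]=f(\mathscr D_1)$, where $f$ is a rational function with divisor $\mathscr D_0$. For a finite divisor $\mathscr D$ of degree $0$ on $\mathscr H_p$ and $\gamma\in\Gamma$ let $$j_{\mathscr D}(\gamma)=\prod_{\delta\in\Gamma}[(\gamma\eta)-(\eta);\delta\mathscr D]\in\mathbb{C}_p,$$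 where $\eta\in\mathscr H_p$ is any point outside the $\Gamma$-orbit of the support of $\mathscr D$. **Proposition.** Let $\Phi$ be convenient. For every $D\in\mathcal D_S$ let $\mathscr D_\Phi(D)_e$ and $\mathscr D_\Phi(D)_o$ be finite divisors on $\mathscr H_p$ of strong degree $0$ in an even and an odd sense, respectively, both with image $\Delta_\Phi(D)$ under $\pi_*$. Then for all $D\in\mathcal D_S$ and $\gamma\in\Gamma$ the products defining $j_{\mathscr D_\Phi(D)_e}(\gamma)$ and $j_{\mathscr D_\Phi(D)_o}(\gamma)$ converge and $$\mathrm{ord}_p\big(j_{\mathscr D_\Phi(D)_e}(\gamma)\cdot j_{\mathscr D_\Phi(D)_o}(\gamma)\big)=0 .$$ In particular, $$G_\Phi^+(q)=\sum_{D\in\mathcal D_S}\big(j_{\mathscr D_\Phi(D)_e}\cdot j_{\mathscr D_\Phi(D)_o}\big)\,q^D\in\mathrm{Hom}(\Gamma,\mathbb{Z}_p^\times)[[q]].$$ -/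

import Mathlib

open scoped Quaternion RestrictedProduct

noncomputable section

namespace PadicGKZ

/-! ### Quaternion algebras over `ℚ` and their trace zero quadratic spaces

Every quaternion algebra over `ℚ` is of the form `ℍ[ℚ,a,b]` with `a, b ≠ 0`
(`i ^ 2 = a`, `j ^ 2 = b`, `k = i * j = - j * i`), and its base change to a commutative
`ℚ`-algebra `K` is `ℍ[K,a,b]`. -/

section Quaternion

variable {K : Type*} [CommRing K] {a b : K}

/-- The reduced norm `x * star x` of a quaternion algebra. -/
def nrd (x : ℍ[K,a,b]) : K := (x * star x).re

theorem nrd_one : nrd (1 : ℍ[K,a,b]) = 1 := by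
  simp [nrd]

theorem nrd_mul (x y : ℍ[K,a,b]) : nrd (x * y) = nrd x * nrd y := by
  simp [nrd]
  ring

/-- The element `v₀ i + v₁ j + v₂ k`. As the reduced trace of `x` is `2 * x.re`, these are exactly
the elements of reduced trace zero (for `K` of characteristic zero). The space `V_K` of trace zero
elements is therefore identified with `Fin 3 → K` through the basis `i, j, k`. -/
def pureQuat (a b : K) (v : Fin 3 → K) : ℍ[K,a,b] := ⟨0, v 0, v 1, v 2⟩

/-- The quadratic form `Q` on `V_K`: the restriction of the reduced norm. -/
def qform (a b : K) (v : Fin 3 → K) : K := nrd (pureQuat a b v)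

/-- The symmetric bilinear form `⟨v, w⟩ = Q (v + w) - Q v - Q w`. -/
def bil (a b : K) (v w : Fin 3 → K) : K := qform a b (v + w) - qform a b v - qform a b w

end Quaternion

/-- The base change `ℍ[ℚ,a,b] → ℍ[K,a,b]` for a field `K` of characteristic zero. -/
def toField (K : Type*) [Field K] {a b : ℚ} (x : ℍ[ℚ,a,b]) : ℍ[K,(a : K),(b : K)] :=
  ⟨x.re, x.imI, x.imJ, x.imK⟩

/-- `ℍ[ℚ,a,b]` is split over the field `K`, i.e. becomes a matrix algebra over `K`. -/
def IsSplitOver (K : Type*) [Field K] (a b : ℚ) : Prop :=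
  Nonempty (ℍ[K,(a : K),(b : K)] ≃ₐ[K] Matrix (Fin 2) (Fin 2) K)

/-- `ℍ[ℚ,a,b]` is a quaternion algebra over `ℚ` which is ramified at the archimedean place and
whose ramified finite places are exactly the primes in `T`. -/
def RamifiedExactlyAtInfinityAnd (T : Finset ℕ) (a b : ℚ) : Prop :=
  a ≠ 0 ∧ b ≠ 0 ∧ ¬ IsSplitOver ℝ a b ∧
    ∀ (ℓ : ℕ) [Fact ℓ.Prime], ¬ IsSplitOver ℚ_[ℓ] a b ↔ ℓ ∈ T

/-! ### Eichler `ℤ[1/p]`-orders and their norm one groups -/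

/-- The ring `ℤ[1/p]` as a subring of `ℚ`. -/
def ZInv (p : ℕ) : Subring ℚ := Subring.closure {(p : ℚ)⁻¹}

section Orders

variable {p : ℕ} {a b : ℚ}

/-- `ℤ[1/p]`-orders: subalgebras that are finitely generated as modules and span the algebra. -/
def IsOrder (R : Subalgebra (ZInv p) ℍ[ℚ,a,b]) : Prop :=
  (Subalgebra.toSubmodule R).FG ∧ Submodule.span ℚ (R : Set ℍ[ℚ,a,b]) = ⊤

/-- Maximal `ℤ[1/p]`-orders. -/
def IsMaximalOrder (R : Subalgebra (ZInv p) ℍ[ℚ,a,b]) : Prop :=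
  IsOrder R ∧ ∀ R' : Subalgebra (ZInv p) ℍ[ℚ,a,b], IsOrder R' → R ≤ R' → R' = R

/-- Eichler `ℤ[1/p]`-orders of level `M`: intersections of two maximal orders that have index `M`
in these. -/
def IsEichlerOrder (R : Subalgebra (ZInv p) ℍ[ℚ,a,b]) (M : ℕ) : Prop :=
  ∃ O₁ O₂ : Subalgebra (ZInv p) ℍ[ℚ,a,b], IsMaximalOrder O₁ ∧ IsMaximalOrder O₂ ∧ R = O₁ ⊓ O₂ ∧
    (R.toSubring.toAddSubgroup).relIndex O₁.toSubring.toAddSubgroup = M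

/-- The group `Γ` of elements of reduced norm one in `R`. -/
def Gam (R : Subalgebra (ZInv p) ℍ[ℚ,a,b]) : Subgroup (ℍ[ℚ,a,b])ˣ where
  carrier := {u | (u : ℍ[ℚ,a,b]) ∈ R ∧ ((u⁻¹ : (ℍ[ℚ,a,b])ˣ) : ℍ[ℚ,a,b]) ∈ R ∧
    nrd (u : ℍ[ℚ,a,b]) = 1}
  one_mem' := ⟨by simp [one_mem], by simp [one_mem], by simp [nrd_one]⟩
  mul_mem' := by
    rintro u w ⟨hu, hu', hu1⟩ ⟨hw, hw', hw1⟩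
    refine ⟨?_, ?_, ?_⟩
    · rw [Units.val_mul]; exact mul_mem hu hw
    · rw [mul_inv_rev, Units.val_mul]; exact mul_mem hw' hu'
    · rw [Units.val_mul, nrd_mul, hu1, hw1, one_mul]
  inv_mem' := by
    rintro u ⟨hu, hu', hu1⟩
    refine ⟨hu', by simpa using hu, ?_⟩
    have h : nrd ((u⁻¹ : (ℍ[ℚ,a,b])ˣ) : ℍ[ℚ,a,b]) * nrd (u : ℍ[ℚ,a,b]) = 1 := by
      rw [← nrd_mul, Units.inv_mul, nrd_one]
    rwa [hu1, mul_one] at h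

/-- The group `Γ / {±1}` has no non-trivial element of finite order. -/
def TorsionFreeModSign (R : Subalgebra (ZInv p) ℍ[ℚ,a,b]) : Prop :=
  ∀ γ ∈ Gam R, ∀ n : ℕ, 0 < n → (γ ^ n = 1 ∨ γ ^ n = -1) → (γ = 1 ∨ γ = -1)

end Orders

/-! ### Finite adèles away from `p` -/

/-- The primes different from `p`. -/
abbrev PrimesNe (p : ℕ) : Type := {ℓ : ℕ // ℓ.Prime ∧ ℓ ≠ p}

instance (p : ℕ) (ℓ : PrimesNe p) : Fact (ℓ : ℕ).Prime := ⟨ℓ.2.1⟩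

/-- The ring `𝔸^{p,∞}` of finite adèles away from `p`. -/
abbrev Adele (p : ℕ) : Type := Πʳ ℓ : PrimesNe p, [ℚ_[(ℓ : ℕ)], PadicInt.subring (ℓ : ℕ)]

theorem ratAdele_aux (p : ℕ) (q : ℚ) :
    ∀ᶠ ℓ : PrimesNe p in Filter.cofinite, (q : ℚ_[(ℓ : ℕ)]) ∈ PadicInt.subring (ℓ : ℕ) := by
  have hfin : {ℓ : PrimesNe p | (ℓ : ℕ) ∣ q.den}.Finite := by
    refine Set.Finite.of_finite_image (f := Subtype.val) ?_ Subtype.val_injective.injOn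
    refine (Finset.finite_toSet (Nat.divisors q.den)).subset ?_
    rintro _ ⟨ℓ, hℓ, rfl⟩
    simpa [q.den_nz] using hℓ
  refine Filter.mem_of_superset hfin.compl_mem_cofinite ?_
  intro ℓ hℓ
  exact Padic.norm_rat_le_one hℓ

/-- The diagonal embedding of `ℚ`. -/
def ratAdele (p : ℕ) (q : ℚ) : Adele p := ⟨fun ℓ => (q : ℚ_[(ℓ : ℕ)]), ratAdele_aux p q⟩

/-- The maximal compact subring of `𝔸^{p,∞}`, i.e. the product of all `ℤ_ℓ` with `ℓ ≠ p`. -/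
def intAdele (p : ℕ) : Subring (Adele p) where
  carrier := {x | ∀ ℓ : PrimesNe p, x ℓ ∈ PadicInt.subring (ℓ : ℕ)}
  mul_mem' := fun hx hy ℓ => mul_mem (hx ℓ) (hy ℓ)
  one_mem' := fun _ => one_mem _
  add_mem' := fun hx hy ℓ => add_mem (hx ℓ) (hy ℓ)
  zero_mem' := fun _ => zero_mem _
  neg_mem' := fun hx ℓ => neg_mem (hx ℓ)

open Classical in
/-- The standard additive character of `𝔸^{p,∞}`. Every `x` is of the form `r + u`, where `u` is
integral and the denominator of `r : ℚ` is prime to `p`; such an `r` is unique up to adding an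
integer, and the value of the character at `x` is `exp (2πir)`. -/
def stdChar (p : ℕ) (x : Adele p) : ℂ :=
  if h : ∃ r : ℚ, ¬ p ∣ r.den ∧ x - ratAdele p r ∈ intAdele p then
    Complex.exp (2 * Real.pi * Complex.I * (h.choose : ℂ))
  else 1

section SchwartzBruhat

variable (p : ℕ) {a b : ℚ}

/-- The adelization `B_{𝔸^{p,∞}}`. -/
abbrev BAdele (p : ℕ) (a b : ℚ) : Type := ℍ[Adele p,ratAdele p a,ratAdele p b]

/-- The adelization `V_{𝔸^{p,∞}}` (in the coordinates given by `i, j, k`). -/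
abbrev VAdele (p : ℕ) : Type := Fin 3 → Adele p

/-- The diagonal embedding of `B`. -/
def toBAdele (x : ℍ[ℚ,a,b]) : BAdele p a b :=
  ⟨ratAdele p x.re, ratAdele p x.imI, ratAdele p x.imJ, ratAdele p x.imK⟩

/-- The diagonal embedding of `V`. -/
def toVAdele (v : Fin 3 → ℚ) : VAdele p := fun t => ratAdele p (v t)

/-- `ℤ`-valued Schwartz--Bruhat functions on `V_{𝔸^{p,∞}}`. -/
def IsSchwartzBruhat (Φ : VAdele p → ℤ) : Prop :=
  IsLocallyConstant Φ ∧ HasCompactSupport Φ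

variable {p}

/-- The image of `R ⊗ ℤ^` in `B_{𝔸^{p,∞}}`. -/
def RHat (R : Subalgebra (ZInv p) ℍ[ℚ,a,b]) : Submodule (intAdele p) (BAdele p a b) :=
  Submodule.span (intAdele p) (toBAdele p '' (R : Set ℍ[ℚ,a,b]))

/-- Invariance under the conjugation action of the unit group of `RHat R`. -/
def IsRHatInvariant (R : Subalgebra (ZInv p) ℍ[ℚ,a,b]) (Φ : VAdele p → ℤ) : Prop :=
  ∀ u : (BAdele p a b)ˣ, (u : BAdele p a b) ∈ RHat R →
    ((u⁻¹ : (BAdele p a b)ˣ) : BAdele p a b) ∈ RHat R →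
    ∀ v w : VAdele p,
      (u : BAdele p a b) * pureQuat (ratAdele p a) (ratAdele p b) v * (u⁻¹ : (BAdele p a b)ˣ) =
        pureQuat (ratAdele p a) (ratAdele p b) w →
      Φ w = Φ v

variable (p a b)

/-- The Weil representation: action of the upper triangular unipotent matrix `(1 c; 0 1)`. -/
def weilUnip (c : Adele p) (f : VAdele p → ℂ) : VAdele p → ℂ :=
  fun v => stdChar p (c * qform (ratAdele p a) (ratAdele p b) v) * f v

/-- The Weil representation: action of the diagonal matrix `(t 0; 0 t⁻¹)` with `t` an integral
unit. (As the quadratic space `V` has square discriminant there is no quadratic character, and the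
Weil index is trivialized by the chosen splitting of the metaplectic cover.) -/
def weilDiag (t : Adele p) (f : VAdele p → ℂ) : VAdele p → ℂ := fun v => f (t • v)

/-- The Weil representation: action of the Weyl element `(0 1; -1 0)`, up to a scalar, that is,
the Fourier transform with respect to a Haar measure `μ`. -/
def weilFourier [MeasurableSpace (VAdele p)] (μ : MeasureTheory.Measure (VAdele p))
    (f : VAdele p → ℂ) : VAdele p → ℂ :=
  fun w => ∫ v, f v * stdChar p (bil (ratAdele p a) (ratAdele p b) v w) ∂μ

/-- Invariance under the group `K₀(M)` (`4 ∣ M`) of matrices in `SL₂` over `intAdele p` whose lower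
left entry is divisible by `M`, acting through the Weil representation. This group is generated by
the matrices `(1 c; 0 1)` with `c` integral, the matrices `(t 0; 0 t⁻¹)` with `t` an integral unit,
and the matrices `(1 0; -c 1) = w⁻¹ (1 c; 0 1) w` with `c` divisible by `M`, where
`w = (0 1; -1 0)`. -/
def IsWeilInvariant (M : ℕ) (Φ : VAdele p → ℤ) : Prop :=
  letI : MeasurableSpace (VAdele p) := borel _
  (∀ c ∈ intAdele p, weilUnip p a b c (fun v => (Φ v : ℂ)) = fun v => (Φ v : ℂ)) ∧
  (∀ t : (Adele p)ˣ, (t : Adele p) ∈ intAdele p → ((t⁻¹ : (Adele p)ˣ) : Adele p) ∈ intAdele p →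
    weilDiag p (t : Adele p) (fun v => (Φ v : ℂ)) = fun v => (Φ v : ℂ)) ∧
  (∀ μ : MeasureTheory.Measure (VAdele p), μ.IsAddHaarMeasure → ∀ c ∈ intAdele p,
    weilUnip p a b ((M : Adele p) * c) (weilFourier p a b μ (fun v => (Φ v : ℂ))) =
      weilFourier p a b μ (fun v => (Φ v : ℂ)))

variable {p a b}

/-- Special Schwartz--Bruhat functions (relative to `R` and the level `N`). -/
structure IsSpecial (R : Subalgebra (ZInv p) ℍ[ℚ,a,b]) (N : ℕ) (Φ : VAdele p → ℤ) : Prop where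
  schwartzBruhat : IsSchwartzBruhat p Φ
  invariant : IsRHatInvariant R Φ
  weil : IsWeilInvariant p a b (4 * N) Φ
  scaling : ∀ v : Fin 3 → ℚ, Φ (toVAdele p ((p : ℚ) • v)) = Φ (toVAdele p v)

end SchwartzBruhat

/-! ### The `p`-adic upper half plane -/

section UpperHalfPlane

variable (p : ℕ) [Fact p.Prime]

/-- The `ℂ_p`-points of the Drinfeld `p`-adic upper half plane `ℙ¹(ℂ_p) - ℙ¹(ℚ_p)`. -/
def Hp : Type := {z : ℂ_[p] // z ∉ Set.range (algebraMap ℚ_[p] ℂ_[p])}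

variable {p}

/-- The Möbius action of `2 × 2` matrices over `ℚ_p`. -/
def moebius (g : Matrix (Fin 2) (Fin 2) ℚ_[p]) (z : ℂ_[p]) : ℂ_[p] :=
  (algebraMap ℚ_[p] ℂ_[p] (g 0 0) * z + algebraMap ℚ_[p] ℂ_[p] (g 0 1)) /
    (algebraMap ℚ_[p] ℂ_[p] (g 1 0) * z + algebraMap ℚ_[p] ℂ_[p] (g 1 1))

/-- A nilpotent matrix whose kernel is the line spanned by `(z, 1)`: it spans the isotropic line of
trace zero matrices that corresponds to the point `z` of the projective line. -/
def nilp (z : ℂ_[p]) : Matrix (Fin 2) (Fin 2) ℂ_[p] := !![z, -z ^ 2; 1, -z]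

/-- The preimage under the reduction map of the vertex of the Bruhat--Tits tree given by the
standard lattice `ℤ_p²`: the complement of the `p + 1` residue discs around the points of
`ℙ¹(𝔽_p)`. -/
def stdAffinoid (p : ℕ) [Fact p.Prime] : Set ℂ_[p] :=
  {z | ‖z‖ ≤ 1 ∧ ∀ c : ℤ_[p], 1 ≤ ‖z - algebraMap ℚ_[p] ℂ_[p] c‖}

/-- The preimage under the reduction map of the union of the vertex given by `ℤ_p²` and of the
`p + 1` open edges emanating from it: the points that are not congruent modulo `p` to a point of
`ℙ¹(𝔽_p)`. -/
def stdWideOpen (p : ℕ) [Fact p.Prime] : Set ℂ_[p] :=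
  {z | ‖z‖ < p ∧ ∀ c : ℤ_[p], (p : ℝ)⁻¹ < ‖z - algebraMap ℚ_[p] ℂ_[p] c‖}

/-- The affinoid `𝒜_L` attached to the vertex `L` given by the homothety class of the lattice
`g ℤ_p²` (every vertex is of this form). -/
def affinoidAt (g : GL (Fin 2) ℚ_[p]) : Set (Hp p) :=
  {z | moebius ((g⁻¹ : GL (Fin 2) ℚ_[p]) : Matrix (Fin 2) (Fin 2) ℚ_[p]) z.1 ∈ stdAffinoid p}

/-- The wide open `𝒲_L` attached to the vertex `L` given by the homothety class of the lattice
`g ℤ_p²`. -/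
def wideOpenAt (g : GL (Fin 2) ℚ_[p]) : Set (Hp p) :=
  {z | moebius ((g⁻¹ : GL (Fin 2) ℚ_[p]) : Matrix (Fin 2) (Fin 2) ℚ_[p]) z.1 ∈ stdWideOpen p}

/-- The vertex given by the homothety class of `g ℤ_p²` is even. -/
def IsEvenVertex (g : GL (Fin 2) ℚ_[p]) : Prop :=
  Even (Padic.valuation (Matrix.det (g : Matrix (Fin 2) (Fin 2) ℚ_[p])))

/-- Finite divisors on the `p`-adic upper half plane. -/
abbrev Divisor (p : ℕ) [Fact p.Prime] : Type := Hp p →₀ ℤ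

open Classical in
/-- The degree of the intersection of a divisor with a set. -/
def degOn (D : Divisor p) (A : Set (Hp p)) : ℤ := ∑ z ∈ D.support.filter (· ∈ A), D z

/-- Divisors of strong degree `0` in an even sense. -/
def StrongDegZeroEven (D : Divisor p) : Prop :=
  ∀ g : GL (Fin 2) ℚ_[p], (IsEvenVertex g → degOn D (wideOpenAt g) = 0) ∧
    (¬ IsEvenVertex g → degOn D (affinoidAt g) = 0)

/-- Divisors of strong degree `0` in an odd sense. -/
def StrongDegZeroOdd (D : Divisor p) : Prop :=
  ∀ g : GL (Fin 2) ℚ_[p], (¬ IsEvenVertex g → degOn D (wideOpenAt g) = 0) ∧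
    (IsEvenVertex g → degOn D (affinoidAt g) = 0)

/-- The rational function `∏ (z - x) ^ (m x)` with divisor `D = ∑ m x (x)`
(for `D` of degree zero). -/
def ratFun (D : ℂ_[p] →₀ ℤ) (z : ℂ_[p]) : ℂ_[p] := D.prod fun x m => (z - x) ^ m

/-- The Weil symbol `[D₀ ; D₁] = f_{D₀} (D₁)` of two divisors of degree zero with disjoint
supports contained in the affine line. -/
def weilSymbol (D₀ D₁ : ℂ_[p] →₀ ℤ) : ℂ_[p] := D₁.prod fun y n => ratFun D₀ y ^ n

variable {a b : ℚ}

/-- The action of `B` on the `p`-adic upper half plane through a splitting `ι` of `B` at `p`. -/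
def act (ι : ℍ[ℚ_[p],(a : ℚ_[p]),(b : ℚ_[p])] ≃ₐ[ℚ_[p]] Matrix (Fin 2) (Fin 2) ℚ_[p])
    (x : ℍ[ℚ,a,b]) (z : ℂ_[p]) : ℂ_[p] :=
  moebius (ι (toField ℚ_[p] x)) z

/-- The support of the cycle `Δ(v)` (all of whose points have multiplicity one): the points
orthogonal to `v`, i.e. for the bilinear form `det (X + Y) - det X - det Y` on trace zero
matrices. -/
def heegnerPoints
    (ι : ℍ[ℚ_[p],(a : ℚ_[p]),(b : ℚ_[p])] ≃ₐ[ℚ_[p]] Matrix (Fin 2) (Fin 2) ℚ_[p])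
    (v : Fin 3 → ℚ) : Set (Hp p) :=
  {z | ((ι (toField ℚ_[p] (pureQuat a b v))).map (algebraMap ℚ_[p] ℂ_[p]) + nilp z.1).det -
      ((ι (toField ℚ_[p] (pureQuat a b v))).map (algebraMap ℚ_[p] ℂ_[p])).det - (nilp z.1).det = 0}

/-- The set `𝒟_S` of integers `D` such that there is a non-zero `v ∈ V` with `Q v = D` and
`Δ(v) ≠ 0`. -/
def DS (ι : ℍ[ℚ_[p],(a : ℚ_[p]),(b : ℚ_[p])] ≃ₐ[ℚ_[p]] Matrix (Fin 2) (Fin 2) ℚ_[p]) : Set ℤ :=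
  {D | ∃ v : Fin 3 → ℚ, v ≠ 0 ∧ qform a b v = (D : ℚ) ∧ (heegnerPoints ι v).Nonempty}

/-- The quotient `Γ \ ℋ_p`. -/
def ModCurve (R : Subalgebra (ZInv p) ℍ[ℚ,a,b])
    (ι : ℍ[ℚ_[p],(a : ℚ_[p]),(b : ℚ_[p])] ≃ₐ[ℚ_[p]] Matrix (Fin 2) (Fin 2) ℚ_[p]) : Type :=
  Quot fun z w : Hp p => ∃ γ ∈ Gam R, act ι (γ : ℍ[ℚ,a,b]) z.1 = w.1

/-- The projection `π : ℋ_p → Γ \ ℋ_p`. -/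
def proj (R : Subalgebra (ZInv p) ℍ[ℚ,a,b])
    (ι : ℍ[ℚ_[p],(a : ℚ_[p]),(b : ℚ_[p])] ≃ₐ[ℚ_[p]] Matrix (Fin 2) (Fin 2) ℚ_[p])
    (z : Hp p) : ModCurve R ι := Quot.mk _ z

/-- The set of `Γ`-orbits (for conjugation) of vectors `v ∈ V` with `Q v = D`. -/
def VecOrbit (R : Subalgebra (ZInv p) ℍ[ℚ,a,b]) (D : ℚ) : Type :=
  Quot fun v w : {v : Fin 3 → ℚ // qform a b v = D} =>
    ∃ γ ∈ Gam R, (γ : ℍ[ℚ,a,b]) * pureQuat a b v.1 * ((γ⁻¹ : (ℍ[ℚ,a,b])ˣ) : ℍ[ℚ,a,b]) = pureQuat a b w.1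

/-- The order of the stabilizer of `v` in `Γ / {±1}` (half the order of the stabilizer in `Γ`). -/
def stabCard (R : Subalgebra (ZInv p) ℍ[ℚ,a,b]) (v : Fin 3 → ℚ) : ℚ :=
  (Nat.card {γ : Gam R // ((γ : (ℍ[ℚ,a,b])ˣ) : ℍ[ℚ,a,b]) * pureQuat a b v =
    pureQuat a b v * ((γ : (ℍ[ℚ,a,b])ˣ) : ℍ[ℚ,a,b])} : ℚ) / 2

/-- The zero-cycle `Δ_Φ(D)` on `Γ \ ℋ_p`, given by its multiplicities: the sum over the
`v ∈ Γ \ V` with `Q v = D` of `Φ(v) / #Stab(v)` times the image of `Δ(v)`.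
(For a given point, at most two classes contribute.) -/
def heegnerDivisor (R : Subalgebra (ZInv p) ℍ[ℚ,a,b])
    (ι : ℍ[ℚ_[p],(a : ℚ_[p]),(b : ℚ_[p])] ≃ₐ[ℚ_[p]] Matrix (Fin 2) (Fin 2) ℚ_[p])
    (Φ : VAdele p → ℤ) (D : ℚ) : ModCurve R ι → ℚ :=
  fun c => ∑ᶠ o : VecOrbit R D,
    (stabCard R o.out.1)⁻¹ * (Φ (toVAdele p o.out.1) : ℚ) *
      ({z ∈ heegnerPoints ι o.out.1 | proj R ι z = c}.ncard : ℚ)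

/-- The divisor `𝒟` on `ℋ_p` lifts the cycle `Δ` on `Γ \ ℋ_p`, i.e. `π_* 𝒟 = Δ`. -/
def IsLift (R : Subalgebra (ZInv p) ℍ[ℚ,a,b])
    (ι : ℍ[ℚ_[p],(a : ℚ_[p]),(b : ℚ_[p])] ≃ₐ[ℚ_[p]] Matrix (Fin 2) (Fin 2) ℚ_[p])
    (𝒟 : Divisor p) (Δ : ModCurve R ι → ℚ) : Prop :=
  ∀ c : ModCurve R ι, ((𝒟.mapDomain (proj R ι) c : ℤ) : ℚ) = Δ c

/-- Cycles of strong degree zero on `Γ \ ℋ_p`. -/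
def StrongDegZero (R : Subalgebra (ZInv p) ℍ[ℚ,a,b])
    (ι : ℍ[ℚ_[p],(a : ℚ_[p]),(b : ℚ_[p])] ≃ₐ[ℚ_[p]] Matrix (Fin 2) (Fin 2) ℚ_[p])
    (Δ : ModCurve R ι → ℚ) : Prop :=
  (∃ 𝒟 : Divisor p, StrongDegZeroEven 𝒟 ∧ IsLift R ι 𝒟 Δ) ∧
    (∃ 𝒟 : Divisor p, StrongDegZeroOdd 𝒟 ∧ IsLift R ι 𝒟 Δ)

/-- Convenient Schwartz--Bruhat functions. -/
structure IsConvenient (R : Subalgebra (ZInv p) ℍ[ℚ,a,b]) (N : ℕ)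
    (ι : ℍ[ℚ_[p],(a : ℚ_[p]),(b : ℚ_[p])] ≃ₐ[ℚ_[p]] Matrix (Fin 2) (Fin 2) ℚ_[p])
    (Φ : VAdele p → ℤ) : Prop where
  special : IsSpecial R N Φ
  map_zero : Φ 0 = 0
  strongDegZero : ∀ D ∈ DS ι, StrongDegZero R ι (heegnerDivisor R ι Φ D)

/-- The base point `η` is admissible for `𝒟`: it is disjoint from all `Γ`-translates of the
support of `𝒟`. -/
def IsAdmissible (R : Subalgebra (ZInv p) ℍ[ℚ,a,b])
    (ι : ℍ[ℚ_[p],(a : ℚ_[p]),(b : ℚ_[p])] ≃ₐ[ℚ_[p]] Matrix (Fin 2) (Fin 2) ℚ_[p])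
    (η : Hp p) (𝒟 : Divisor p) : Prop :=
  ∀ α ∈ Gam R, ∀ x ∈ 𝒟.support, act ι (α : ℍ[ℚ,a,b]) x.1 ≠ η.1

/-- The factor `[(γ η) - (η) ; δ 𝒟]` of the modular Weil symbol. -/
def jFactor (R : Subalgebra (ZInv p) ℍ[ℚ,a,b])
    (ι : ℍ[ℚ_[p],(a : ℚ_[p]),(b : ℚ_[p])] ≃ₐ[ℚ_[p]] Matrix (Fin 2) (Fin 2) ℚ_[p])
    (η : Hp p) (𝒟 : Divisor p) (γ δ : Gam R) : ℂ_[p] :=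
  weilSymbol
    (Finsupp.single (act ι ((γ : (ℍ[ℚ,a,b])ˣ) : ℍ[ℚ,a,b]) η.1) 1 - Finsupp.single η.1 1)
    (𝒟.mapDomain fun z => act ι ((δ : (ℍ[ℚ,a,b])ˣ) : ℍ[ℚ,a,b]) z.1)

/-- The automorphy factor `j_𝒟(γ) = [(γ η) - (η) ; 𝒟]_Γ = ∏_{δ ∈ Γ} [(γ η) - (η) ; δ 𝒟]`. -/
def autFactor (R : Subalgebra (ZInv p) ℍ[ℚ,a,b])
    (ι : ℍ[ℚ_[p],(a : ℚ_[p]),(b : ℚ_[p])] ≃ₐ[ℚ_[p]] Matrix (Fin 2) (Fin 2) ℚ_[p])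
    (η : Hp p) (𝒟 : Divisor p) (γ : Gam R) : ℂ_[p] :=
  ∏' δ : Gam R, jFactor R ι η 𝒟 γ δ

open Classical in
/-- The coefficients of the generating series `G⁺_Φ(q)`, evaluated at `γ ∈ Γ`: the coefficient of
`q ^ D` is `j_{𝒟(D)_e} * j_{𝒟(D)_o}` if `D ∈ 𝒟_S`, and trivial otherwise. -/
def GPlus (R : Subalgebra (ZInv p) ℍ[ℚ,a,b])
    (ι : ℍ[ℚ_[p],(a : ℚ_[p]),(b : ℚ_[p])] ≃ₐ[ℚ_[p]] Matrix (Fin 2) (Fin 2) ℚ_[p])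
    (ηe ηo : ℤ → Hp p) (𝒟e 𝒟o : ℤ → Divisor p) (n : ℕ) (γ : Gam R) : ℂ_[p] :=
  if (n : ℤ) ∈ DS ι then
    autFactor R ι (ηe n) (𝒟e n) γ * autFactor R ι (ηo n) (𝒟o n) γ
  else 1

end UpperHalfPlane

end PadicGKZ

end

open PadicGKZ

/-! # Automorphy factors of Heegner divisors on `p`-adic modular curves -/

/-! A point `z` of `ℋ_p` defines the norm `(u, v) ↦ ‖u z + v‖` on `ℚ_p²`, whose homothety class is
the image of `z` in the geometric realization of the tree. For either parity, `ℋ_p` is therefore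
partitioned into cells: the wide opens at the vertices of that parity and the affinoids at the other
vertices. Strong degree zero means degree zero on every cell.

Since `B` is definite, `Γ` is discrete in `SL₂(ℚ_p)`. Hence the cross ratios over `Γ` tend to `1`
and their products converge (`IsDiscreteRep.tendsto_crossRatio`). This yields the periods `[(γ η) -
(η); (x) - (y)]_Γ`, which do not depend on `η`, are multiplicative in `γ` and are invariant under
simultaneous translation of `x` and `y` by `Γ`. As `Γ / {±1}` is torsion-free, stabilizers of cells
act trivially, so a point `b x` in the cell of `x` can be chosen equivariantly
(`IsDiscreteRep.exists_cellSection`). Then `b_* 𝒟 = 0`, and `j_𝒟(γ)` is the product of the periods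
of the pairs `(x, b x)`, with the multiplicities of `𝒟` (`IsDiscreteRep.hasProd_symbolFactor`). The
period of `(x, b x)` is `Γ`-invariant in `x`, so `j_𝒟` depends only on `π_* 𝒟`.

Absolute value: a Heegner point `x` is quadratic over `ℚ_p`, so it reduces to a vertex or to the
midpoint of an edge (`quadratic_dist`). Let the even and odd sections `b`, `b'` take values in
points reducing to vertices. At a midpoint, `b x` and `b' x` lie over the two ends of the edge, and
the square of the norm of `x` is, in the relevant sense, the product of the norms of the ends
(`exists_rowNorm_sq_eq`). For a generic `η` every single factor of the combined product then has
absolute value one (`IsDiscreteRep.norm_period_mul`).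

Rationality: let `K` be generated by the square roots of `-D`. Its automorphisms are isometries, so
they preserve cells, and they preserve the Heegner divisor. With a section that preserves
`K`-points, the automorphy factor is therefore fixed by the Galois group (`periodProd_mem_range`).
-/

open scoped Quaternion RestrictedProduct

noncomputable section

namespace PadicGKZ

open Filter Topology

/-! ### Lattice norms on `ℚ_p²` and distances in the tree. -/

section PadicNorms

variable {p : ℕ} [Fact p.Prime]

/-- The embedding of `ℚ_p` into `ℂ_p`. -/
abbrev emb : ℚ_[p] →+* ℂ_[p] := algebraMap ℚ_[p] ℂ_[p]

theorem norm_emb (x : ℚ_[p]) : ‖emb x‖ = ‖x‖ := norm_algebraMap' _ x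

theorem one_lt_cast_prime : (1 : ℝ) < p := by exact_mod_cast (Fact.out : p.Prime).one_lt

theorem cast_prime_pos : (0 : ℝ) < p := by exact_mod_cast (Fact.out : p.Prime).pos

theorem exists_norm_eq_zpow {x : ℚ_[p]} (hx : x ≠ 0) : ∃ n : ℤ, ‖x‖ = (p : ℝ) ^ n :=
  ⟨_, Padic.norm_eq_zpow_neg_valuation hx⟩

/-- The norm `(u, v) ↦ ‖u z + v‖` on `ℚ_p²` attached to a point `z`. -/
def nu (z : ℂ_[p]) (u v : ℚ_[p]) : ℝ := ‖emb u * z + emb v‖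

/-- The norm of the row vector `(u, v) * g`. -/
def lam (g : Matrix (Fin 2) (Fin 2) ℚ_[p]) (u v : ℚ_[p]) : ℝ :=
  max ‖u * g 0 0 + v * g 1 0‖ ‖u * g 0 1 + v * g 1 1‖

/-- The maximum of the norms of the entries of a matrix. -/
def mnorm (g : Matrix (Fin 2) (Fin 2) ℚ_[p]) : ℝ :=
  max (max ‖g 0 0‖ ‖g 0 1‖) (max ‖g 1 0‖ ‖g 1 1‖)

theorem norm_le_mnorm (g : Matrix (Fin 2) (Fin 2) ℚ_[p]) (i j : Fin 2) : ‖g i j‖ ≤ mnorm g := by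
  fin_cases i <;> fin_cases j <;> simp [mnorm]

theorem exists_norm_eq_mnorm (g : Matrix (Fin 2) (Fin 2) ℚ_[p]) : ∃ i j, ‖g i j‖ = mnorm g := by
  unfold mnorm
  rcases max_choice (max ‖g 0 0‖ ‖g 0 1‖) (max ‖g 1 0‖ ‖g 1 1‖) with h | h <;> rw [h]
  · rcases max_choice ‖g 0 0‖ ‖g 0 1‖ with h | h <;> exact ⟨_, _, h.symm⟩
  · rcases max_choice ‖g 1 0‖ ‖g 1 1‖ with h | h <;> exact ⟨_, _, h.symm⟩

theorem mnorm_le_iff {g : Matrix (Fin 2) (Fin 2) ℚ_[p]} {C : ℝ} :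
    mnorm g ≤ C ↔ ∀ i j, ‖g i j‖ ≤ C := by
  simp [mnorm, Fin.forall_fin_two]

theorem mnorm_nonneg (g : Matrix (Fin 2) (Fin 2) ℚ_[p]) : 0 ≤ mnorm g :=
  (norm_nonneg _).trans (norm_le_mnorm g 0 0)

theorem lam_nonneg (g : Matrix (Fin 2) (Fin 2) ℚ_[p]) (u v : ℚ_[p]) : 0 ≤ lam g u v :=
  (norm_nonneg _).trans (le_max_left _ _)

theorem norm_add_le_max_mul {a b : ℚ_[p]} {C : ℝ} (ha : ‖a‖ ≤ C) (hb : ‖b‖ ≤ C) : ‖a + b‖ ≤ C :=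
  (IsUltrametricDist.norm_add_le_max a b).trans (max_le ha hb)

theorem mnorm_mul_le (g h : Matrix (Fin 2) (Fin 2) ℚ_[p]) :
    mnorm (g * h) ≤ mnorm g * mnorm h := by
  rw [mnorm_le_iff]
  intro i j
  rw [Matrix.mul_apply, Fin.sum_univ_two]
  refine norm_add_le_max_mul ?_ ?_ <;> rw [norm_mul] <;>
    exact mul_le_mul (norm_le_mnorm _ _ _) (norm_le_mnorm _ _ _) (norm_nonneg _) (mnorm_nonneg _)

/-- For invertible `g` the quotient of the two sides is `p` to the distance from the vertex of `g`
to the standard vertex, by elementary divisors. The lemmas below use this quotient, taken at `g⁻¹ *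
h`, as a substitute for the distance. -/
theorem norm_det_le (g : Matrix (Fin 2) (Fin 2) ℚ_[p]) : ‖g.det‖ ≤ mnorm g ^ 2 := by
  rw [Matrix.det_fin_two, sub_eq_add_neg, sq]
  refine norm_add_le_max_mul ?_ ?_ <;> rw [← norm_neg] <;> simp only [neg_neg, norm_mul, norm_neg] <;>
    exact mul_le_mul (norm_le_mnorm _ _ _) (norm_le_mnorm _ _ _) (norm_nonneg _) (mnorm_nonneg _)

theorem lam_mul_le (g m : Matrix (Fin 2) (Fin 2) ℚ_[p]) (u v : ℚ_[p]) :
    lam (g * m) u v ≤ mnorm m * lam g u v := by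
  have key : ∀ j, u * (g * m) 0 j + v * (g * m) 1 j =
      (u * g 0 0 + v * g 1 0) * m 0 j + (u * g 0 1 + v * g 1 1) * m 1 j := by
    intro j
    simp only [Matrix.mul_apply, Fin.sum_univ_two]; ring
  refine max_le ?_ ?_ <;> rw [key] <;> refine norm_add_le_max_mul ?_ ?_ <;>
    rw [norm_mul, mul_comm]
  all_goals
    refine mul_le_mul (norm_le_mnorm _ _ _) ?_ (norm_nonneg _) (mnorm_nonneg _)
    simp [lam]

theorem lam_mul_apply (g m : Matrix (Fin 2) (Fin 2) ℚ_[p]) (u v : ℚ_[p]) :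
    lam (g * m) u v = lam m (u * g 0 0 + v * g 1 0) (u * g 0 1 + v * g 1 1) := by
  unfold lam
  simp only [Matrix.mul_apply, Fin.sum_univ_two]
  congr 2 <;> ring

theorem lam_one (u v : ℚ_[p]) : lam (1 : Matrix (Fin 2) (Fin 2) ℚ_[p]) u v = max ‖u‖ ‖v‖ := by
  simp [lam]

theorem mnorm_eq_lam (g m : Matrix (Fin 2) (Fin 2) ℚ_[p]) :
    mnorm (m * g) = max (lam g (m 0 0) (m 0 1)) (lam g (m 1 0) (m 1 1)) := by
  simp [mnorm, lam, Matrix.mul_apply, Fin.sum_univ_two]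

/-- The adjugate of a `2 × 2` matrix has the same entries up to order and sign. -/
theorem mnorm_inv (m : GL (Fin 2) ℚ_[p]) :
    mnorm ((m⁻¹ : GL (Fin 2) ℚ_[p]) : Matrix (Fin 2) (Fin 2) ℚ_[p]) =
      mnorm (m : Matrix (Fin 2) (Fin 2) ℚ_[p]) / ‖(m : Matrix (Fin 2) (Fin 2) ℚ_[p]).det‖ := by
  have hd : 0 < ‖(m : Matrix (Fin 2) (Fin 2) ℚ_[p]).det‖ :=
    norm_pos_iff.2 (Matrix.GeneralLinearGroup.det_ne_zero m)
  rw [eq_div_iff hd.ne', Matrix.coe_units_inv, Matrix.inv_def, Matrix.adjugate_fin_two]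
  simp only [mnorm, Matrix.smul_apply, smul_eq_mul, norm_mul, Ring.inverse_eq_inv', norm_inv,
    Matrix.of_apply, Matrix.cons_val', Matrix.cons_val_zero, Matrix.cons_val_one, norm_neg,
    Matrix.cons_val_fin_one]
  rw [← mul_max_of_nonneg _ _ (by positivity), ← mul_max_of_nonneg _ _ (by positivity),
    ← mul_max_of_nonneg _ _ (by positivity), mul_comm, mul_inv_cancel_left₀ hd.ne']
  rw [max_comm ‖_‖ ‖(m : Matrix (Fin 2) (Fin 2) ℚ_[p]) 0 1‖, max_comm ‖(m : Matrix (Fin 2) (Fin 2) ℚ_[p]) 1 0‖ ‖(m : Matrix (Fin 2) (Fin 2) ℚ_[p]) 0 0‖]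
  rw [max_comm, max_max_max_comm]

/-- If two lattice norms are sufficiently close, then they are proportional. -/
theorem lam_proportional {g h : GL (Fin 2) ℚ_[p]}
    (hm : mnorm ((g⁻¹ * h : GL (Fin 2) ℚ_[p]) : Matrix (Fin 2) (Fin 2) ℚ_[p]) ^ 2 ≤
      ‖((g⁻¹ * h : GL (Fin 2) ℚ_[p]) : Matrix (Fin 2) (Fin 2) ℚ_[p]).det‖) :
    ∃ C > 0, ∀ u v, lam (h : Matrix (Fin 2) (Fin 2) ℚ_[p]) u v =
      C * lam (g : Matrix (Fin 2) (Fin 2) ℚ_[p]) u v := by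
  set m := g⁻¹ * h with hm'
  have hd : 0 < ‖(m : Matrix (Fin 2) (Fin 2) ℚ_[p]).det‖ :=
    norm_pos_iff.2 (Matrix.GeneralLinearGroup.det_ne_zero m)
  have hh : (h : Matrix (Fin 2) (Fin 2) ℚ_[p]) = g * m := by simp [hm']
  have hg : (g : Matrix (Fin 2) (Fin 2) ℚ_[p]) = h * (m⁻¹ : GL (Fin 2) ℚ_[p]) := by
    rw [← Units.val_mul]; simp [hm']
  have hpos : 0 < mnorm (m : Matrix (Fin 2) (Fin 2) ℚ_[p]) := by
    have := norm_det_le (m : Matrix (Fin 2) (Fin 2) ℚ_[p])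
    have h0 := mnorm_nonneg (m : Matrix (Fin 2) (Fin 2) ℚ_[p])
    rcases h0.lt_or_eq with h | h
    · exact h
    · rw [← h] at this; norm_num at this; exact absurd this (Matrix.GeneralLinearGroup.det_ne_zero m)
  refine ⟨_, hpos, fun u v => le_antisymm ?_ ?_⟩
  · rw [hh]; exact lam_mul_le _ _ _ _
  · have h1 := lam_mul_le (h : Matrix (Fin 2) (Fin 2) ℚ_[p]) (m⁻¹ : GL (Fin 2) ℚ_[p]) u v
    rw [← hg] at h1
    rw [mnorm_inv] at h1
    calc _ ≤ mnorm (m : Matrix (Fin 2) (Fin 2) ℚ_[p]) * (mnorm (m : Matrix (Fin 2) (Fin 2) ℚ_[p]) /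
          ‖(m : Matrix (Fin 2) (Fin 2) ℚ_[p]).det‖ * lam (h : Matrix (Fin 2) (Fin 2) ℚ_[p]) u v) := by gcongr
      _ = (mnorm (m : Matrix (Fin 2) (Fin 2) ℚ_[p]) ^ 2 / ‖(m : Matrix (Fin 2) (Fin 2) ℚ_[p]).det‖) *
          lam (h : Matrix (Fin 2) (Fin 2) ℚ_[p]) u v := by ring
      _ ≤ 1 * lam (h : Matrix (Fin 2) (Fin 2) ℚ_[p]) u v := by
          have := lam_nonneg (h : Matrix (Fin 2) (Fin 2) ℚ_[p]) u v
          gcongr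
          rwa [div_le_one hd]
      _ = _ := one_mul _

/-- The parity of a vertex, shifted by `e`. -/
def par (e : ℤ) (g : GL (Fin 2) ℚ_[p]) : Prop :=
  Even (Padic.valuation (Matrix.det (g : Matrix (Fin 2) (Fin 2) ℚ_[p])) + e)

theorem valuation_det_mul (g m : GL (Fin 2) ℚ_[p]) :
    Padic.valuation (Matrix.det ((g * m : GL (Fin 2) ℚ_[p]) : Matrix (Fin 2) (Fin 2) ℚ_[p])) =
      Padic.valuation (Matrix.det (g : Matrix (Fin 2) (Fin 2) ℚ_[p])) +
      Padic.valuation (Matrix.det (m : Matrix (Fin 2) (Fin 2) ℚ_[p])) := by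
  rw [Units.val_mul, Matrix.det_mul, Padic.valuation_mul (Matrix.GeneralLinearGroup.det_ne_zero g)
    (Matrix.GeneralLinearGroup.det_ne_zero m)]

theorem mnorm_pos (m : GL (Fin 2) ℚ_[p]) : 0 < mnorm (m : Matrix (Fin 2) (Fin 2) ℚ_[p]) := by
  have hd : 0 < ‖(m : Matrix (Fin 2) (Fin 2) ℚ_[p]).det‖ :=
    norm_pos_iff.2 (Matrix.GeneralLinearGroup.det_ne_zero m)
  have := norm_det_le (m : Matrix (Fin 2) (Fin 2) ℚ_[p])
  by_contra h
  have h0 : mnorm (m : Matrix (Fin 2) (Fin 2) ℚ_[p]) = 0 :=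
    le_antisymm (not_lt.1 h) (mnorm_nonneg _)
  rw [h0] at this
  norm_num at this
  exact Matrix.GeneralLinearGroup.det_ne_zero m this

theorem exists_mnorm_eq_zpow (m : GL (Fin 2) ℚ_[p]) :
    ∃ l : ℤ, mnorm (m : Matrix (Fin 2) (Fin 2) ℚ_[p]) = (p : ℝ) ^ l := by
  obtain ⟨i, j, h⟩ := exists_norm_eq_mnorm (m : Matrix (Fin 2) (Fin 2) ℚ_[p])
  have := mnorm_pos m
  rw [← h] at this ⊢
  exact exists_norm_eq_zpow (norm_pos_iff.1 this)

theorem exists_mnorm_sq_eq_zpow (m : GL (Fin 2) ℚ_[p]) :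
    ∃ l : ℤ, mnorm (m : Matrix (Fin 2) (Fin 2) ℚ_[p]) ^ 2 = (p : ℝ) ^ (2 * l) := by
  obtain ⟨l, hl⟩ := exists_mnorm_eq_zpow m
  refine ⟨l, ?_⟩
  rw [hl, mul_comm, zpow_mul]
  rfl

/-- At distance zero `‖det (g⁻¹ * h)‖` equals the square of `mnorm (g⁻¹ * h)`, so the determinants
of `g` and `h` have valuations of the same parity. -/
theorem par_congr {e : ℤ} {g h : GL (Fin 2) ℚ_[p]}
    (hm : mnorm ((g⁻¹ * h : GL (Fin 2) ℚ_[p]) : Matrix (Fin 2) (Fin 2) ℚ_[p]) ^ 2 ≤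
      ‖((g⁻¹ * h : GL (Fin 2) ℚ_[p]) : Matrix (Fin 2) (Fin 2) ℚ_[p]).det‖) :
    par e g ↔ par e h := by
  obtain ⟨l, hl⟩ := exists_mnorm_sq_eq_zpow (g⁻¹ * h)
  have h1 := le_antisymm hm (norm_det_le _)
  rw [hl, Padic.norm_eq_zpow_neg_valuation (Matrix.GeneralLinearGroup.det_ne_zero _)] at h1
  have h2 := zpow_right_injective₀ cast_prime_pos one_lt_cast_prime.ne' h1
  have h3 := valuation_det_mul g (g⁻¹ * h)
  rw [mul_inv_cancel_left] at h3
  unfold par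
  rw [h3]
  simp only [Int.even_add]
  have : Even (Padic.valuation (Matrix.det ((g⁻¹ * h : GL (Fin 2) ℚ_[p]) : Matrix (Fin 2) (Fin 2) ℚ_[p]))) :=
    ⟨-l, by linarith⟩
  tauto

/-- Distances are integers: below one means zero. -/
theorem mnorm_sq_le_of_lt {g h : GL (Fin 2) ℚ_[p]}
    (hm : mnorm ((g⁻¹ * h : GL (Fin 2) ℚ_[p]) : Matrix (Fin 2) (Fin 2) ℚ_[p]) ^ 2 <
      p * ‖((g⁻¹ * h : GL (Fin 2) ℚ_[p]) : Matrix (Fin 2) (Fin 2) ℚ_[p]).det‖) :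
    mnorm ((g⁻¹ * h : GL (Fin 2) ℚ_[p]) : Matrix (Fin 2) (Fin 2) ℚ_[p]) ^ 2 ≤
      ‖((g⁻¹ * h : GL (Fin 2) ℚ_[p]) : Matrix (Fin 2) (Fin 2) ℚ_[p]).det‖ := by
  obtain ⟨l, hl⟩ := exists_mnorm_sq_eq_zpow (g⁻¹ * h)
  rw [hl, Padic.norm_eq_zpow_neg_valuation (Matrix.GeneralLinearGroup.det_ne_zero _)] at hm ⊢
  rw [← zpow_one_add₀ cast_prime_pos.ne', zpow_lt_zpow_iff_right₀ one_lt_cast_prime] at hm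
  rw [zpow_le_zpow_iff_right₀ one_lt_cast_prime]
  linarith

/-- Vertices of equal parity have even distance: below two means zero. -/
theorem mnorm_sq_le_of_par {e : ℤ} {g h : GL (Fin 2) ℚ_[p]} (hg : par e g) (hh : par e h)
    (hm : mnorm ((g⁻¹ * h : GL (Fin 2) ℚ_[p]) : Matrix (Fin 2) (Fin 2) ℚ_[p]) ^ 2 <
      p ^ 2 * ‖((g⁻¹ * h : GL (Fin 2) ℚ_[p]) : Matrix (Fin 2) (Fin 2) ℚ_[p]).det‖) :
    mnorm ((g⁻¹ * h : GL (Fin 2) ℚ_[p]) : Matrix (Fin 2) (Fin 2) ℚ_[p]) ^ 2 ≤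
      ‖((g⁻¹ * h : GL (Fin 2) ℚ_[p]) : Matrix (Fin 2) (Fin 2) ℚ_[p]).det‖ := by
  have h3 := valuation_det_mul g (g⁻¹ * h)
  rw [mul_inv_cancel_left] at h3
  obtain ⟨l, hl⟩ := exists_mnorm_sq_eq_zpow (g⁻¹ * h)
  rw [hl, Padic.norm_eq_zpow_neg_valuation (Matrix.GeneralLinearGroup.det_ne_zero _)] at hm ⊢
  rw [← zpow_natCast, ← zpow_add₀ cast_prime_pos.ne', zpow_lt_zpow_iff_right₀ one_lt_cast_prime] at hm
  rw [zpow_le_zpow_iff_right₀ one_lt_cast_prime]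
  obtain ⟨s, hs⟩ := hg
  obtain ⟨t, ht⟩ := hh
  rw [h3] at ht
  push_cast at *
  omega

/-- The rows of `g⁻¹` are unit vectors for `lam g`, so the two comparisons bound `mnorm (g⁻¹ * h)`
by `α` and `mnorm (h⁻¹ * g)` by `β`; the latter is turned around by `mnorm_inv`. -/
theorem mnorm_sq_le {g h : GL (Fin 2) ℚ_[p]} {α β : ℝ}
    (h1 : ∀ u v, lam (h : Matrix (Fin 2) (Fin 2) ℚ_[p]) u v ≤
      α * lam (g : Matrix (Fin 2) (Fin 2) ℚ_[p]) u v)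
    (h2 : ∀ u v, lam (g : Matrix (Fin 2) (Fin 2) ℚ_[p]) u v ≤
      β * lam (h : Matrix (Fin 2) (Fin 2) ℚ_[p]) u v) (hα : 0 ≤ α) :
    mnorm ((g⁻¹ * h : GL (Fin 2) ℚ_[p]) : Matrix (Fin 2) (Fin 2) ℚ_[p]) ^ 2 ≤
      α * β * ‖((g⁻¹ * h : GL (Fin 2) ℚ_[p]) : Matrix (Fin 2) (Fin 2) ℚ_[p]).det‖ := by
  have key : ∀ (g h : GL (Fin 2) ℚ_[p]) (α : ℝ), (∀ u v, lam (h : Matrix (Fin 2) (Fin 2) ℚ_[p]) u v ≤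
      α * lam (g : Matrix (Fin 2) (Fin 2) ℚ_[p]) u v) →
      mnorm ((g⁻¹ * h : GL (Fin 2) ℚ_[p]) : Matrix (Fin 2) (Fin 2) ℚ_[p]) ≤ α := by
    intro g h α hα
    rw [Units.val_mul, mnorm_eq_lam]
    have := mnorm_eq_lam (g : Matrix (Fin 2) (Fin 2) ℚ_[p])
      ((g⁻¹ : GL (Fin 2) ℚ_[p]) : Matrix (Fin 2) (Fin 2) ℚ_[p])
    have hrow : ∀ u v, lam (g : Matrix (Fin 2) (Fin 2) ℚ_[p])
        (u * (g⁻¹ : GL (Fin 2) ℚ_[p]).1 0 0 + v * (g⁻¹ : GL (Fin 2) ℚ_[p]).1 1 0)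
        (u * (g⁻¹ : GL (Fin 2) ℚ_[p]).1 0 1 + v * (g⁻¹ : GL (Fin 2) ℚ_[p]).1 1 1) = max ‖u‖ ‖v‖ := by
      intro u v
      rw [← lam_mul_apply, ← Units.val_mul, inv_mul_cancel, Units.val_one, lam_one]
    have r0 := hrow 1 0
    have r1 := hrow 0 1
    simp only [one_mul, zero_mul, add_zero, zero_add, norm_one, norm_zero] at r0 r1
    refine max_le ((hα _ _).trans ?_) ((hα _ _).trans ?_)
    · rw [r0]; simp
    · rw [r1]; simp
  have k1 := key g h α h1
  have k2 := key h g β h2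
  have hinv : h⁻¹ * g = (g⁻¹ * h)⁻¹ := by group
  have hd : 0 < ‖((g⁻¹ * h : GL (Fin 2) ℚ_[p]) : Matrix (Fin 2) (Fin 2) ℚ_[p]).det‖ :=
    norm_pos_iff.2 (Matrix.GeneralLinearGroup.det_ne_zero _)
  rw [hinv, mnorm_inv, div_le_iff₀ hd] at k2
  calc _ = mnorm ((g⁻¹ * h : GL (Fin 2) ℚ_[p]) : Matrix (Fin 2) (Fin 2) ℚ_[p]) *
        mnorm ((g⁻¹ * h : GL (Fin 2) ℚ_[p]) : Matrix (Fin 2) (Fin 2) ℚ_[p]) := sq _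
    _ ≤ α * (β * ‖((g⁻¹ * h : GL (Fin 2) ℚ_[p]) : Matrix (Fin 2) (Fin 2) ℚ_[p]).det‖) := 
        mul_le_mul k1 k2 (mnorm_nonneg _) hα
    _ = _ := by ring

end PadicNorms

/-! ### The reduction map to the tree and the decomposition of `ℋ_p` into cells. -/

section UpperHalfPlaneGeometry

variable {p : ℕ} [Fact p.Prime]

theorem Hp.lin_ne_zero (z : Hp p) {u v : ℚ_[p]} (h : u ≠ 0 ∨ v ≠ 0) : emb u * z.1 + emb v ≠ 0 := by
  intro h0
  by_cases hu : u = 0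
  · subst hu
    simp at h0 h
    exact h h0
  · refine z.2 ⟨-v / u, ?_⟩
    have hu' : emb u ≠ 0 := by simpa using hu
    rw [map_div₀, map_neg, div_eq_iff hu']
    linear_combination -h0

theorem Hp.ext {z w : Hp p} (h : z.1 = w.1) : z = w := Subtype.ext h

theorem nu_pos (z : Hp p) {u v : ℚ_[p]} (h : u ≠ 0 ∨ v ≠ 0) : 0 < nu z.1 u v :=
  norm_pos_iff.2 (z.lin_ne_zero h)

theorem GL_row_ne_zero (g : GL (Fin 2) ℚ_[p]) (i : Fin 2) : g.1 i 0 ≠ 0 ∨ g.1 i 1 ≠ 0 := by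
  by_contra! h
  apply Matrix.GeneralLinearGroup.det_ne_zero g
  fin_cases i <;> simp_all [Matrix.det_fin_two]

theorem Hp.den_ne_zero (g : GL (Fin 2) ℚ_[p]) (z : Hp p) :
    emb (g.1 1 0) * z.1 + emb (g.1 1 1) ≠ 0 :=
  z.lin_ne_zero (GL_row_ne_zero g 1)

theorem moebius_notMem_range (g : GL (Fin 2) ℚ_[p]) (z : Hp p) :
    moebius g.1 z.1 ∉ Set.range (algebraMap ℚ_[p] ℂ_[p]) := by
  rintro ⟨t, ht⟩
  unfold moebius at ht
  rw [eq_div_iff (z.den_ne_zero g)] at ht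
  have h0 : emb (g.1 0 0 - t * g.1 1 0) * z.1 + emb (g.1 0 1 - t * g.1 1 1) = 0 := by
    simp only [map_sub, map_mul]
    linear_combination -ht
  have h1 : ¬ ((g.1 0 0 - t * g.1 1 0) ≠ 0 ∨ (g.1 0 1 - t * g.1 1 1) ≠ 0) :=
    fun h => z.lin_ne_zero h h0
  push Not at h1
  apply Matrix.GeneralLinearGroup.det_ne_zero g
  rw [Matrix.det_fin_two]
  linear_combination (g.1 1 1) * h1.1 - (g.1 1 0) * h1.2

/-- The action of `GL₂(ℚ_p)` by Möbius transformations. -/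
instance : MulAction (GL (Fin 2) ℚ_[p]) (Hp p) where
  smul g z := ⟨moebius g.1 z.1, moebius_notMem_range g z⟩
  one_smul z := by
    apply Hp.ext
    change moebius _ _ = _
    simp [moebius]
  mul_smul g h z := by
    apply Hp.ext
    change moebius _ _ = moebius _ (moebius _ _)
    have h1 := z.den_ne_zero (g * h)
    have h2 := z.den_ne_zero h
    have h3 : emb (g.1 1 0) * moebius h.1 z.1 + emb (g.1 1 1) ≠ 0 :=
      Hp.den_ne_zero g ⟨moebius h.1 z.1, moebius_notMem_range h z⟩
    unfold moebius at h3 ⊢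
    rw [div_eq_div_iff h1 h3]
    simp only [Units.val_mul, Matrix.mul_apply, Fin.sum_univ_two, map_add, map_mul] at *
    field_simp
    ring

theorem Hp.smul_val (g : GL (Fin 2) ℚ_[p]) (z : Hp p) : (g • z).1 = moebius g.1 z.1 := rfl

theorem Hp.smul_mul_den (g : GL (Fin 2) ℚ_[p]) (z : Hp p) :
    (g • z).1 * (emb (g.1 1 0) * z.1 + emb (g.1 1 1)) = emb (g.1 0 0) * z.1 + emb (g.1 0 1) := by
  rw [Hp.smul_val, moebius, div_mul_cancel₀ _ (z.den_ne_zero g)]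

/-- Equivariance of the reduction map: up to the scalar `‖den‖`, moving `z` by `g` amounts to
multiplying row vectors by `g` on the right. -/
theorem nu_smul (g : GL (Fin 2) ℚ_[p]) (z : Hp p) (u v : ℚ_[p]) :
    nu (g • z).1 u v * nu z.1 (g.1 1 0) (g.1 1 1) =
      nu z.1 (u * g.1 0 0 + v * g.1 1 0) (u * g.1 0 1 + v * g.1 1 1) := by
  unfold nu
  rw [← norm_mul, add_mul, mul_assoc, Hp.smul_mul_den]
  congr 1
  simp only [map_add, map_mul]
  ring

/-- Every point of `ℋ_p` defines a norm on `ℚ_p²` that is diagonal in a suitable basis. -/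
theorem Hp.exists_center (z : Hp p) : ∃ c : ℚ_[p], 0 < ‖z.1 - emb c‖ ∧
    ∀ u v : ℚ_[p], nu z.1 u v = max (‖u‖ * ‖z.1 - emb c‖) ‖u * c + v‖ := by
  have hcont : Continuous fun c : ℚ_[p] => ‖z.1 - emb c‖ :=
    (continuous_const.sub (continuous_algebraMap _ _)).norm
  -- The distance from `z` to `ℚ_p` is attained because `ℚ_p` is locally compact; a closest point
  -- serves as centre.
  have htend : Tendsto (fun c : ℚ_[p] => ‖z.1 - emb c‖) (cocompact ℚ_[p]) atTop := by
    refine tendsto_atTop_mono (f := fun c : ℚ_[p] => -‖z.1‖ + ‖c‖) (fun c => ?_)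
      (tendsto_atTop_add_const_left _ _ tendsto_norm_cocompact_atTop)
    have h := norm_sub_norm_le (emb c) z.1
    rw [norm_emb, norm_sub_rev] at h
    linarith
  obtain ⟨c, hc⟩ := hcont.exists_forall_le htend
  refine ⟨c, ?_, fun u v => ?_⟩
  · rw [norm_pos_iff, sub_ne_zero]
    exact fun h => z.2 ⟨c, h.symm⟩
  by_cases hu : u = 0
  · simp [hu, nu]
  -- When both norms agree, the ultrametric inequality alone does not exclude cancellation;
  -- minimality of `c` does.
  have hd : ∀ d : ℚ_[p], ‖(z.1 - emb c) + emb d‖ = max ‖z.1 - emb c‖ ‖d‖ := by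
    intro d
    by_cases h : ‖z.1 - emb c‖ = ‖d‖
    · refine le_antisymm ?_ ?_
      · simpa using IsUltrametricDist.norm_add_le_max (z.1 - emb c) (emb d)
      · rw [← h, max_self]
        have := hc (c - d)
        rwa [map_sub, sub_sub_eq_add_sub, add_sub_right_comm] at this
    · rw [← norm_emb d] at h ⊢
      exact IsUltrametricDist.norm_add_eq_max_of_norm_ne_norm h
  have h1 : nu z.1 u v = ‖u‖ * ‖(z.1 - emb c) + emb (c + v / u)‖ := by
    unfold nu
    rw [← norm_emb u, ← norm_mul]
    congr 1
    have hu' : emb u ≠ 0 := by simpa using hu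
    rw [map_add, map_div₀]
    field_simp
    ring
  rw [h1, hd, mul_max_of_nonneg _ _ (norm_nonneg u), ← norm_mul]
  congr 2
  field_simp

theorem max_norm_shear {c : ℚ_[p]} (hc : ‖c‖ ≤ 1) (u v : ℚ_[p]) :
    max ‖u‖ ‖u * c + v‖ = max ‖u‖ ‖v‖ := by
  have huc : ‖u * c‖ ≤ ‖u‖ := by
    rw [norm_mul]; exact mul_le_of_le_one_right (norm_nonneg _) hc
  refine le_antisymm (max_le (le_max_left _ _) ?_) (max_le (le_max_left _ _) ?_)
  · exact norm_add_le_max_mul (huc.trans (le_max_left _ _)) (le_max_right _ _)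
  · have : v = -(u * c) + (u * c + v) := by ring
    conv_lhs => rw [this]
    refine norm_add_le_max_mul ?_ (le_max_right _ _)
    rw [norm_neg]
    exact huc.trans (le_max_left _ _)

theorem norm_le_one_of_lt_prime {c : ℚ_[p]} (hc : ‖c‖ < p) : ‖c‖ ≤ 1 := by
  by_cases h : c = 0
  · simp [h]
  obtain ⟨n, hn⟩ := exists_norm_eq_zpow h
  rw [hn] at hc ⊢
  nth_rw 2 [← zpow_one (p : ℝ)] at hc
  rw [zpow_lt_zpow_iff_right₀ one_lt_cast_prime] at hc
  exact zpow_le_one_of_nonpos₀ one_lt_cast_prime.le (by omega)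

/-- The inequalities force an integral centre at distance exactly `1`, and integral shears preserve
the standard norm. -/
theorem mem_stdAffinoid_iff (z : Hp p) :
    z.1 ∈ stdAffinoid p ↔ ∀ u v, nu z.1 u v = max ‖u‖ ‖v‖ := by
  constructor
  · rintro ⟨h1, h2⟩
    obtain ⟨c, hr, hc⟩ := z.exists_center
    have hz := hc 1 0
    simp only [nu, map_one, one_mul, map_zero, add_zero, norm_one] at hz
    rw [hz] at h1
    have hc1 : ‖c‖ ≤ 1 := (le_max_right _ _).trans h1
    have hr1 : ‖z.1 - emb c‖ = 1 :=
      le_antisymm ((le_max_left _ _).trans h1) (h2 ⟨c, hc1⟩)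
    intro u v
    rw [hc, hr1, mul_one, max_norm_shear hc1]
  · intro h
    refine ⟨?_, fun c => ?_⟩
    · have := h 1 0
      simp only [nu, map_one, one_mul, map_zero, add_zero, norm_one, norm_zero] at this
      rw [this]; simp
    · have := h 1 (-c)
      simp only [nu, map_one, one_mul, map_neg, norm_one, norm_neg, ← sub_eq_add_neg] at this
      rw [this]; exact le_max_left _ _

/-- This is the condition that `z` reduces to a point at distance less than one from the standard
vertex: the two norms agree within a factor smaller than `p`. -/
theorem mem_stdWideOpen_iff (z : Hp p) :
    z.1 ∈ stdWideOpen p ↔ ∃ C D : ℝ, 0 < C ∧ D < p * C ∧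
      ∀ u v, C * max ‖u‖ ‖v‖ ≤ nu z.1 u v ∧ nu z.1 u v ≤ D * max ‖u‖ ‖v‖ := by
  have hp := cast_prime_pos (p := p)
  constructor
  · rintro ⟨h1, h2⟩
    obtain ⟨c, hr, hc⟩ := z.exists_center
    have hz := hc 1 0
    simp only [nu, map_one, one_mul, map_zero, add_zero, norm_one] at hz
    rw [hz] at h1
    have hc1 : ‖c‖ ≤ 1 := norm_le_one_of_lt_prime ((le_max_right _ _).trans_lt h1)
    have hr1 : ‖z.1 - emb c‖ < p := (le_max_left _ _).trans_lt h1
    have hr2 : (p : ℝ)⁻¹ < ‖z.1 - emb c‖ := h2 ⟨c, hc1⟩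
    set r := ‖z.1 - emb c‖
    -- After a shear both norms are diagonal in the same basis, with ratios `r` and `1` on the axes,
    -- and `p⁻¹ < r < p`.
    refine ⟨min 1 r, max 1 r, by positivity, ?_, fun u v => ?_⟩
    · have h3 : 1 < p * r := by
        rwa [inv_lt_iff_one_lt_mul₀ hp, mul_comm] at hr2
      have := one_lt_cast_prime (p := p)
      rw [mul_min_of_nonneg _ _ hp.le]
      refine max_lt (lt_min (by linarith) h3) (lt_min (by linarith) ?_)
      exact lt_mul_of_one_lt_left hr this
    · rw [hc, ← max_norm_shear hc1 u v]
      have hu := norm_nonneg u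
      have hv := norm_nonneg (u * c + v)
      refine ⟨?_, ?_⟩
      · rw [mul_max_of_nonneg _ _ (by positivity), mul_comm ‖u‖]
        refine max_le_max ?_ ?_
        · gcongr; exact min_le_right _ _
        · exact mul_le_of_le_one_left hv (min_le_left _ _)
      · rw [mul_max_of_nonneg _ _ (by positivity), mul_comm ‖u‖]
        refine max_le_max ?_ ?_
        · gcongr; exact le_max_right _ _
        · exact le_mul_of_one_le_left hv (le_max_left _ _)
  · rintro ⟨C, D, hC, hD, h⟩
    have h01 := h 0 1
    have h10 := h 1 0
    simp only [nu, map_one, one_mul, map_zero, add_zero, norm_one, norm_zero, zero_mul, zero_add,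
      max_eq_left zero_le_one, max_eq_right zero_le_one (α := ℝ), mul_one] at h01 h10
    refine ⟨?_, fun c => ?_⟩
    · nlinarith
    · have h1 := (h 1 (-c)).1
      simp only [nu, map_one, one_mul, map_neg, norm_one, norm_neg, ← sub_eq_add_neg] at h1
      have h2 : C * 1 ≤ C * max 1 ‖(c : ℚ_[p])‖ := by gcongr; exact le_max_left _ _
      rw [inv_lt_iff_one_lt_mul₀ hp]
      nlinarith

theorem mem_affinoidAt_iff (g : GL (Fin 2) ℚ_[p]) (z : Hp p) :
    z ∈ affinoidAt g ↔ ∃ C > 0, ∀ u v, nu z.1 u v = C * lam g.1 u v := by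
  change (g⁻¹ • z).1 ∈ stdAffinoid p ↔ _
  rw [mem_stdAffinoid_iff]
  constructor
  · intro h
    have h0 := nu_pos (g⁻¹ • z) (GL_row_ne_zero g 1)
    refine ⟨_, inv_pos.2 h0, fun u v => ?_⟩
    have h1 := nu_smul g (g⁻¹ • z) u v
    rw [smul_inv_smul] at h1
    rw [eq_inv_mul_iff_mul_eq₀ h0.ne', mul_comm, h1, h]
    rfl
  · rintro ⟨C, hC, h⟩
    have h0 := nu_pos z (GL_row_ne_zero g⁻¹ 1)
    have h1 : ∀ u v, nu (g⁻¹ • z).1 u v =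
        (C / nu z.1 ((g⁻¹ : GL (Fin 2) ℚ_[p]).1 1 0) ((g⁻¹ : GL (Fin 2) ℚ_[p]).1 1 1)) * max ‖u‖ ‖v‖ := by
      intro u v
      rw [div_mul_eq_mul_div, eq_div_iff h0.ne', nu_smul, h, ← lam_mul_apply, ← Units.val_mul,
        inv_mul_cancel, Units.val_one, lam_one]
    have h2 := h1 0 1
    simp only [nu, map_one, map_zero, norm_one, norm_zero, zero_mul, zero_add,
      max_eq_right zero_le_one (α := ℝ), mul_one] at h2
    intro u v
    rw [h1]
    unfold nu
    rw [← h2, one_mul]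

theorem mem_wideOpenAt_iff (g : GL (Fin 2) ℚ_[p]) (z : Hp p) :
    z ∈ wideOpenAt g ↔ ∃ C D : ℝ, 0 < C ∧ D < p * C ∧
      ∀ u v, C * lam g.1 u v ≤ nu z.1 u v ∧ nu z.1 u v ≤ D * lam g.1 u v := by
  change (g⁻¹ • z).1 ∈ stdWideOpen p ↔ _
  rw [mem_stdWideOpen_iff]
  constructor
  · rintro ⟨C, D, hC, hD, h⟩
    have h0 := nu_pos (g⁻¹ • z) (GL_row_ne_zero g 1)
    set t := nu (g⁻¹ • z).1 (g.1 1 0) (g.1 1 1)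
    refine ⟨C / t, D / t, by positivity, by rw [← mul_div_assoc]; gcongr, fun u v => ?_⟩
    have h1 := nu_smul g (g⁻¹ • z) u v
    rw [smul_inv_smul] at h1
    rw [div_mul_eq_mul_div, div_mul_eq_mul_div, div_le_iff₀ h0, le_div_iff₀ h0, h1]
    exact h _ _
  · rintro ⟨C, D, hC, hD, h⟩
    have h0 := nu_pos z (GL_row_ne_zero g⁻¹ 1)
    set t := nu z.1 ((g⁻¹ : GL (Fin 2) ℚ_[p]).1 1 0) ((g⁻¹ : GL (Fin 2) ℚ_[p]).1 1 1)
    refine ⟨C / t, D / t, by positivity, by rw [← mul_div_assoc]; gcongr, fun u v => ?_⟩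
    have h1 : lam g.1 (u * (g⁻¹ : GL (Fin 2) ℚ_[p]).1 0 0 + v * (g⁻¹ : GL (Fin 2) ℚ_[p]).1 1 0)
        (u * (g⁻¹ : GL (Fin 2) ℚ_[p]).1 0 1 + v * (g⁻¹ : GL (Fin 2) ℚ_[p]).1 1 1) = max ‖u‖ ‖v‖ := by
      rw [← lam_mul_apply, ← Units.val_mul, inv_mul_cancel, Units.val_one, lam_one]
    rw [div_mul_eq_mul_div, div_mul_eq_mul_div, div_le_iff₀ h0, le_div_iff₀ h0, nu_smul, ← h1]
    exact h _ _

theorem affinoidAt_subset_wideOpenAt (g : GL (Fin 2) ℚ_[p]) :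
    affinoidAt g ⊆ wideOpenAt g := by
  intro z hz
  obtain ⟨C, hC, h⟩ := (mem_affinoidAt_iff g z).1 hz
  refine (mem_wideOpenAt_iff g z).2 ⟨C, C, hC, ?_, fun u v => ⟨(h u v).ge, (h u v).le⟩⟩
  exact lt_mul_of_one_lt_left hC one_lt_cast_prime

/-- The vertices given by `g` and `h` coincide. -/
def SameVertex (g h : GL (Fin 2) ℚ_[p]) : Prop :=
  mnorm (g⁻¹ * h).1 ^ 2 ≤ ‖(g⁻¹ * h).1.det‖

theorem SameVertex.affinoidAt {g h : GL (Fin 2) ℚ_[p]} (H : SameVertex g h) {z : Hp p} :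
    z ∈ affinoidAt h ↔ z ∈ affinoidAt g := by
  obtain ⟨E, hE, H⟩ := lam_proportional H
  simp only [mem_affinoidAt_iff, H]
  constructor
  · rintro ⟨C, hC, h⟩
    exact ⟨C * E, by positivity, fun u v => by rw [h]; ring⟩
  · rintro ⟨C, hC, h⟩
    exact ⟨C / E, by positivity, fun u v => by rw [h]; field_simp⟩

theorem SameVertex.wideOpenAt {g h : GL (Fin 2) ℚ_[p]} (H : SameVertex g h) {z : Hp p} :
    z ∈ wideOpenAt h ↔ z ∈ wideOpenAt g := by
  obtain ⟨E, hE, H⟩ := lam_proportional H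
  simp only [mem_wideOpenAt_iff, H]
  constructor
  · rintro ⟨C, D, hC, hD, h⟩
    refine ⟨C * E, D * E, by positivity, by rw [← mul_assoc]; gcongr, fun u v => ?_⟩
    rw [mul_assoc, mul_assoc]; exact h u v
  · rintro ⟨C, D, hC, hD, h⟩
    refine ⟨C / E, D / E, by positivity, by rw [← mul_div_assoc]; gcongr, fun u v => ?_⟩
    rw [← mul_assoc, ← mul_assoc, div_mul_cancel₀ _ hE.ne', div_mul_cancel₀ _ hE.ne']; exact h u v

/-- Triangle inequality in the tree, passing through the image of `z`. -/
theorem mnorm_sq_le_of_mem {g h : GL (Fin 2) ℚ_[p]} {z : Hp p} {C D C' D' : ℝ} (hC : 0 < C)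
    (hC' : 0 < C')
    (H : ∀ u v, C * lam g.1 u v ≤ nu z.1 u v ∧ nu z.1 u v ≤ D * lam g.1 u v)
    (H' : ∀ u v, C' * lam h.1 u v ≤ nu z.1 u v ∧ nu z.1 u v ≤ D' * lam h.1 u v) :
    mnorm (g⁻¹ * h).1 ^ 2 ≤ (D / C') * (D' / C) * ‖(g⁻¹ * h).1.det‖ ∧ 0 < D ∧ 0 < D' := by
  have hpos : 0 < nu z.1 0 1 := nu_pos z (Or.inr one_ne_zero)
  have hD : 0 < D := pos_of_mul_pos_left (hpos.trans_le (H 0 1).2) (lam_nonneg _ _ _)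
  have hD' : 0 < D' := pos_of_mul_pos_left (hpos.trans_le (H' 0 1).2) (lam_nonneg _ _ _)
  refine ⟨mnorm_sq_le (fun u v => ?_) (fun u v => ?_) (by positivity), hD, hD'⟩
  · rw [div_mul_eq_mul_div, le_div_iff₀ hC', mul_comm]
    exact (H' u v).1.trans (H u v).2
  · rw [div_mul_eq_mul_div, le_div_iff₀ hC, mul_comm]
    exact (H u v).1.trans (H' u v).2

theorem det_norm_pos (g : GL (Fin 2) ℚ_[p]) : 0 < ‖g.1.det‖ :=
  norm_pos_iff.2 (Matrix.GeneralLinearGroup.det_ne_zero g)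

/-- Both vertices have distance less than one from the image of `z`, hence less than two from each
other; the parity does the rest. -/
theorem sameVertex_of_mem_wideOpenAt {e : ℤ} {g h : GL (Fin 2) ℚ_[p]} (hg : par e g) (hh : par e h)
    {z : Hp p} (hzg : z ∈ wideOpenAt g) (hzh : z ∈ wideOpenAt h) : SameVertex g h := by
  obtain ⟨C, D, hC, hD, H⟩ := (mem_wideOpenAt_iff g z).1 hzg
  obtain ⟨C', D', hC', hD', H'⟩ := (mem_wideOpenAt_iff h z).1 hzh
  obtain ⟨h1, h2, h3⟩ := mnorm_sq_le_of_mem hC hC' H H'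
  refine mnorm_sq_le_of_par hg hh (h1.trans_lt ?_)
  have := det_norm_pos (g⁻¹ * h)
  gcongr
  rw [div_mul_div_comm, div_lt_iff₀ (by positivity)]
  calc D * D' < (p * C) * (p * C') := by gcongr
    _ = _ := by ring

/-- Here `z` reduces to the vertex of `h` itself, so the distance is below one and no parity is
needed. -/
theorem sameVertex_of_mem_affinoidAt {g h : GL (Fin 2) ℚ_[p]}
    {z : Hp p} (hzg : z ∈ wideOpenAt g) (hzh : z ∈ affinoidAt h) : SameVertex g h := by
  obtain ⟨C, D, hC, hD, H⟩ := (mem_wideOpenAt_iff g z).1 hzg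
  obtain ⟨C', hC', H'⟩ := (mem_affinoidAt_iff h z).1 hzh
  obtain ⟨h1, h2, h3⟩ := mnorm_sq_le_of_mem hC hC' H (fun u v => ⟨(H' u v).ge, (H' u v).le⟩)
  refine mnorm_sq_le_of_lt (h1.trans_lt ?_)
  have := det_norm_pos (g⁻¹ * h)
  gcongr
  rw [div_mul_div_comm, div_lt_iff₀ (by positivity)]
  calc D * C' < (p * C) * C' := by gcongr
    _ = _ := by ring

/-- Two points lie in the same cell of the decomposition of `ℋ_p` into the wide opens attached to
the vertices of the given parity and the affinoids attached to the other vertices. -/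
def SameCell (e : ℤ) (z w : Hp p) : Prop :=
  ∀ g : GL (Fin 2) ℚ_[p], (par e g → (z ∈ wideOpenAt g ↔ w ∈ wideOpenAt g)) ∧
    (¬ par e g → (z ∈ affinoidAt g ↔ w ∈ affinoidAt g))

theorem SameCell.refl (e : ℤ) (z : Hp p) : SameCell e z z := fun _ => ⟨fun _ => Iff.rfl, fun _ => Iff.rfl⟩

theorem SameCell.symm {e : ℤ} {z w : Hp p} (h : SameCell e z w) : SameCell e w z :=
  fun g => ⟨fun hg => ((h g).1 hg).symm, fun hg => ((h g).2 hg).symm⟩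

theorem SameCell.trans {e : ℤ} {z w x : Hp p} (h : SameCell e z w) (h' : SameCell e w x) :
    SameCell e z x :=
  fun g => ⟨fun hg => ((h g).1 hg).trans ((h' g).1 hg), fun hg => ((h g).2 hg).trans ((h' g).2 hg)⟩

/-- Distinct cells are disjoint, so a single common cell decides membership in all of them. -/
theorem sameCell_of_mem_wideOpenAt {e : ℤ} {g : GL (Fin 2) ℚ_[p]} (hg : par e g) {z w : Hp p}
    (hz : z ∈ wideOpenAt g) (hw : w ∈ wideOpenAt g) : SameCell e z w := by
  have key : ∀ {z w : Hp p}, z ∈ wideOpenAt g → w ∈ wideOpenAt g → ∀ h : GL (Fin 2) ℚ_[p],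
      (par e h → z ∈ wideOpenAt h → w ∈ wideOpenAt h) ∧
      (¬ par e h → ¬ z ∈ affinoidAt h) := by
    intro z w hz hw h
    refine ⟨fun hh hzh => ?_, fun hh hzh => ?_⟩
    · exact (sameVertex_of_mem_wideOpenAt hg hh hz hzh).wideOpenAt.2 hw
    · exact hh ((par_congr (sameVertex_of_mem_affinoidAt hz hzh)).1 hg)
  exact fun h => ⟨fun hh => ⟨(key hz hw h).1 hh, (key hw hz h).1 hh⟩,
    fun hh => iff_of_false ((key hz hw h).2 hh) ((key hw hz h).2 hh)⟩

theorem sameCell_of_mem_affinoidAt {e : ℤ} {g : GL (Fin 2) ℚ_[p]} {z w : Hp p}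
    (hz : z ∈ affinoidAt g) (hw : w ∈ affinoidAt g) : SameCell e z w := by
  by_cases hg : par e g
  · exact sameCell_of_mem_wideOpenAt hg (affinoidAt_subset_wideOpenAt g hz)
      (affinoidAt_subset_wideOpenAt g hw)
  have key : ∀ {z w : Hp p}, z ∈ affinoidAt g → w ∈ affinoidAt g → ∀ h : GL (Fin 2) ℚ_[p],
      (par e h → ¬ z ∈ wideOpenAt h) ∧
      (z ∈ affinoidAt h → w ∈ affinoidAt h) := by
    intro z w hz hw h
    refine ⟨fun hh hzh => ?_, fun hzh => ?_⟩
    · exact hg ((par_congr (sameVertex_of_mem_affinoidAt hzh hz)).1 hh)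
    · exact (sameVertex_of_mem_affinoidAt (affinoidAt_subset_wideOpenAt g hz) hzh).affinoidAt.2 hw
  exact fun h => ⟨fun hh => iff_of_false ((key hz hw h).1 hh) ((key hw hz h).1 hh),
    fun hh => ⟨(key hz hw h).2, (key hw hz h).2⟩⟩

/-- The matrix `(p ^ n c; 0 1)`. -/
def upperGL (n : ℤ) (c : ℚ_[p]) : GL (Fin 2) ℚ_[p] :=
  Matrix.GeneralLinearGroup.mkOfDetNeZero !![(p : ℚ_[p]) ^ n, c; 0, 1] (by
    rw [Matrix.det_fin_two_of, mul_one, mul_zero, sub_zero]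
    exact zpow_ne_zero _ (by exact_mod_cast (Fact.out : p.Prime).ne_zero))

theorem lam_upperGL (n : ℤ) (c u v : ℚ_[p]) :
    lam (upperGL n c).1 u v = max (‖u‖ * (p : ℝ) ^ (-n)) ‖u * c + v‖ := by
  simp [lam, upperGL, Matrix.GeneralLinearGroup.mkOfDetNeZero]

theorem par_upperGL (e n : ℤ) (c : ℚ_[p]) : par e (upperGL n c) ↔ Even (n + e) := by
  have : (upperGL n c).1.det = (p : ℚ_[p]) ^ n := by
    simp [upperGL, Matrix.GeneralLinearGroup.mkOfDetNeZero, Matrix.det_fin_two_of]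
  unfold par
  rw [this, Padic.valuation_zpow, Padic.valuation_p, mul_one]

theorem mem_affinoidAt_upperGL {z : Hp p} {c : ℚ_[p]} {n : ℤ}
    (hc : ∀ u v : ℚ_[p], nu z.1 u v = max (‖u‖ * ‖z.1 - emb c‖) ‖u * c + v‖)
    (hn : ‖z.1 - emb c‖ = (p : ℝ) ^ (-n)) : z ∈ affinoidAt (upperGL n c) := by
  rw [mem_affinoidAt_iff]
  refine ⟨1, one_pos, fun u v => ?_⟩
  rw [hc, hn, one_mul, lam_upperGL]

theorem mem_wideOpenAt_upperGL {z : Hp p} {c : ℚ_[p]} {n : ℤ}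
    (hc : ∀ u v : ℚ_[p], nu z.1 u v = max (‖u‖ * ‖z.1 - emb c‖) ‖u * c + v‖)
    (h1 : (p : ℝ) ^ (-n - 1) < ‖z.1 - emb c‖) (h2 : ‖z.1 - emb c‖ < (p : ℝ) ^ (-n + 1)) :
    z ∈ wideOpenAt (upperGL n c) := by
  have hp := cast_prime_pos (p := p)
  have hq : (0 : ℝ) < (p : ℝ) ^ (-n) := by positivity
  rw [zpow_sub_one₀ hp.ne'] at h1
  rw [zpow_add_one₀ hp.ne'] at h2
  rw [mem_wideOpenAt_iff]
  set r := ‖z.1 - emb c‖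
  set q := (p : ℝ) ^ (-n)
  have hr : 0 < r := lt_trans (by positivity) h1
  rw [mul_inv_lt_iff₀ hp] at h1
  refine ⟨min 1 (r / q), max 1 (r / q), by positivity, ?_, fun u v => ?_⟩
  · have := one_lt_cast_prime (p := p)
    rw [mul_min_of_nonneg _ _ hp.le]
    have h3 : r / q < p := by rw [div_lt_iff₀ hq]; linarith
    have h4 : 1 < p * (r / q) := by rw [← mul_div_assoc, lt_div_iff₀ hq]; linarith
    have h5 : 0 < r / q := by positivity
    exact max_lt (lt_min (by linarith) h4) (lt_min (by linarith) (lt_mul_of_one_lt_left h5 this))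
  · rw [hc, lam_upperGL]
    have hu := norm_nonneg u
    have hv := norm_nonneg (u * c + v)
    have hur : ‖u‖ * r = (r / q) * (‖u‖ * q) := by field_simp
    refine ⟨?_, ?_⟩ <;> rw [mul_max_of_nonneg _ _ (by positivity), hur]
    · refine max_le_max ?_ ?_
      · gcongr; exact min_le_right _ _
      · exact mul_le_of_le_one_left hv (min_le_left _ _)
    · refine max_le_max ?_ ?_
      · gcongr; exact le_max_right _ _
      · exact le_mul_of_one_le_left hv (le_max_left _ _)

theorem exists_zpow_le {r : ℝ} (hr : 0 < r) :
    ∃ n : ℤ, (p : ℝ) ^ (-n - 1) < r ∧ r ≤ (p : ℝ) ^ (-n) := by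
  obtain ⟨n, h1, h2⟩ := exists_mem_Ioc_zpow hr (one_lt_cast_prime (p := p))
  exact ⟨-n - 1, by simpa using h1, by rwa [neg_sub, sub_neg_eq_add, add_comm]⟩

/-- A point with centre `c` and radius `p ^ (-n)` reduces to the vertex of `upperGL n c`. If the
radius lies strictly between `p ^ (-n - 1)` and `p ^ (-n)`, the point reduces to the open edge from
there to `upperGL (n + 1) c`, and exactly one end has the required parity. -/
theorem exists_mem_cell (e : ℤ) (z : Hp p) :
    ∃ g : GL (Fin 2) ℚ_[p], (par e g ∧ z ∈ wideOpenAt g) ∨ (¬ par e g ∧ z ∈ affinoidAt g) := by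
  obtain ⟨c, hr, hc⟩ := z.exists_center
  obtain ⟨n, h1, h2⟩ := exists_zpow_le (p := p) hr
  rcases h2.eq_or_lt with h2 | h2
  · have hA := mem_affinoidAt_upperGL hc h2
    refine ⟨upperGL n c, ?_⟩
    by_cases h : par e (upperGL n c)
    · exact Or.inl ⟨h, affinoidAt_subset_wideOpenAt _ hA⟩
    · exact Or.inr ⟨h, hA⟩
  · have hmono : (p : ℝ) ^ (-n) < (p : ℝ) ^ (-n + 1) :=
      zpow_lt_zpow_right₀ one_lt_cast_prime (by omega)
    by_cases h : par e (upperGL n c)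
    · exact ⟨_, Or.inl ⟨h, mem_wideOpenAt_upperGL hc h1 (h2.trans hmono)⟩⟩
    · refine ⟨upperGL (n + 1) c, Or.inl ⟨?_, mem_wideOpenAt_upperGL hc (lt_trans ?_ h1) ?_⟩⟩
      · rw [par_upperGL] at h ⊢
        rw [add_right_comm, Int.even_add_one]; exact h
      · exact zpow_lt_zpow_right₀ one_lt_cast_prime (by omega)
      · rwa [neg_add, neg_add_cancel_right]

theorem smul_mem_affinoidAt {g h : GL (Fin 2) ℚ_[p]} {z : Hp p} :
    g • z ∈ affinoidAt h ↔ z ∈ affinoidAt (g⁻¹ * h) := by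
  change (h⁻¹ • (g • z)).1 ∈ stdAffinoid p ↔ ((g⁻¹ * h)⁻¹ • z).1 ∈ stdAffinoid p
  rw [mul_inv_rev, inv_inv, mul_smul]

theorem smul_mem_wideOpenAt {g h : GL (Fin 2) ℚ_[p]} {z : Hp p} :
    g • z ∈ wideOpenAt h ↔ z ∈ wideOpenAt (g⁻¹ * h) := by
  change (h⁻¹ • (g • z)).1 ∈ stdWideOpen p ↔ ((g⁻¹ * h)⁻¹ • z).1 ∈ stdWideOpen p
  rw [mul_inv_rev, inv_inv, mul_smul]

theorem par_mul_of_det_eq_one {e : ℤ} {g h : GL (Fin 2) ℚ_[p]} (hg : g.1.det = 1) :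
    par e (g * h) ↔ par e h := by
  unfold par
  rw [valuation_det_mul, hg, Padic.valuation_one, zero_add]

theorem det_inv_eq_one {g : GL (Fin 2) ℚ_[p]} (hg : g.1.det = 1) : (g⁻¹).1.det = 1 := by
  have : (g⁻¹ * g).1.det = 1 := by simp
  rwa [Units.val_mul, Matrix.det_mul, hg, mul_one] at this

theorem SameCell.smul {e : ℤ} {g : GL (Fin 2) ℚ_[p]} (hg : g.1.det = 1) {z w : Hp p}
    (h : SameCell e z w) : SameCell e (g • z) (g • w) := by
  intro k
  simp only [smul_mem_affinoidAt, smul_mem_wideOpenAt]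
  rw [← par_mul_of_det_eq_one (h := k) (det_inv_eq_one hg)]
  exact h _

/-- The cell depends on the attached norm only; this makes isometric Galois actions preserve cells.
-/
theorem sameCell_of_nu_eq (e : ℤ) {z w : Hp p} (h : ∀ u v, nu z.1 u v = nu w.1 u v) :
    SameCell e z w := by
  intro g
  simp only [mem_affinoidAt_iff, mem_wideOpenAt_iff, h, implies_true, and_self]

/-- An element of determinant one that maps a point to a point of the same cell is conjugate to an
integral matrix. -/
theorem mnorm_conj_le_one {e : ℤ} {γ : GL (Fin 2) ℚ_[p]} (hγ : γ.1.det = 1) {z : Hp p}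
    (h : SameCell e z (γ • z)) : ∃ g : GL (Fin 2) ℚ_[p], mnorm (g⁻¹ * γ⁻¹ * g).1 ≤ 1 := by
  obtain ⟨g, hg⟩ := exists_mem_cell e z
  -- A cell determines its vertex, and determinant one preserves parity, so `γ` fixes the vertex of
  -- `g`.
  have key : SameVertex g (γ⁻¹ * g) := by
    rcases hg with ⟨hg, hz⟩ | ⟨hg, hz⟩
    · refine sameVertex_of_mem_wideOpenAt hg ((par_mul_of_det_eq_one (det_inv_eq_one hγ)).2 hg) hz ?_
      rw [← smul_mem_wideOpenAt]
      exact ((h g).1 hg).1 hz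
    · refine sameVertex_of_mem_affinoidAt (affinoidAt_subset_wideOpenAt _ hz) ?_
      rw [← smul_mem_affinoidAt]
      exact ((h g).2 hg).1 hz
  unfold SameVertex at key
  refine ⟨g, ?_⟩
  rw [← mul_assoc] at key
  have hd : (g⁻¹ * γ⁻¹ * g).1.det = 1 := by
    rw [Units.val_mul, Units.val_mul, Matrix.det_mul, Matrix.det_mul, det_inv_eq_one hγ, mul_one,
      ← Matrix.det_mul, ← Units.val_mul, inv_mul_cancel, Units.val_one, Matrix.det_one]
  rw [hd, norm_one] at key
  exact (sq_le_one_iff₀ (mnorm_nonneg _)).1 key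

end UpperHalfPlaneGeometry

/-! ### Convergence of infinite products in nonarchimedean fields. -/

section NonarchimedeanProducts

theorem norm_prod_sub_one_le {K ι : Type*} [NormedField K] [IsUltrametricDist K] {f : ι → K} {ε : ℝ}
    (hε : 0 ≤ ε) (hε1 : ε ≤ 1) (s : Finset ι) (h : ∀ i ∈ s, ‖f i - 1‖ ≤ ε) :
    ‖∏ i ∈ s, f i - 1‖ ≤ ε ∧ ‖∏ i ∈ s, f i‖ ≤ 1 := by
  classical
  have key : ∀ x : K, ‖x - 1‖ ≤ ε → ‖x‖ ≤ 1 := by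
    intro x hx
    have := IsUltrametricDist.norm_add_le_max (x - 1) 1
    rw [sub_add_cancel, norm_one] at this
    exact this.trans (max_le (hx.trans hε1) le_rfl)
  suffices h' : ‖∏ i ∈ s, f i - 1‖ ≤ ε from ⟨h', key _ h'⟩
  induction s using Finset.induction_on with
  | empty => simpa using hε
  | insert a s ha ih =>
    have ih := ih fun i hi => h i (Finset.mem_insert_of_mem hi)
    rw [Finset.prod_insert ha]
    have h1 : f a * ∏ i ∈ s, f i - 1 = (f a - 1) * ∏ i ∈ s, f i + (∏ i ∈ s, f i - 1) := by ring
    rw [h1]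
    refine (IsUltrametricDist.norm_add_le_max _ _).trans (max_le ?_ ih)
    rw [norm_mul]
    exact (mul_le_of_le_one_right (norm_nonneg _) (key _ ih)).trans (h a (Finset.mem_insert_self _ _))

/-- Enlarging a finite set of indices multiplies the partial product by something close to `1`,
which is harmless once the partial products are bounded. The limit may still be zero. -/
theorem multipliable_of_tendsto_one {K ι : Type*} [NormedField K] [IsUltrametricDist K]
    [CompleteSpace K] {f : ι → K} (hf : Tendsto f cofinite (𝓝 1)) : Multipliable f := by
  classical
  rw [multipliable_iff_cauchySeq_finset]
  have hfin : ∀ ε > 0, {i | ε < ‖f i - 1‖}.Finite := by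
    intro ε hε
    have h := hf.eventually (Metric.closedBall_mem_nhds (1 : K) hε)
    refine (h : {i | _}ᶜ.Finite).subset ?_
    intro i hi
    simpa [dist_eq_norm] using hi
  -- Outside `N0` all factors have norm at most one, so partial products over sets containing `N0`
  -- stay bounded.
  set N0 := (hfin 1 one_pos).toFinset
  have hN0 : ∀ s : Finset ι, N0 ⊆ s → ‖∏ i ∈ s, f i‖ ≤ ‖∏ i ∈ N0, f i‖ := by
    intro s hs
    rw [← Finset.prod_sdiff hs, norm_mul]
    refine mul_le_of_le_one_left (norm_nonneg _) (norm_prod_sub_one_le zero_le_one le_rfl _ ?_).2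
    intro i hi
    have := (Finset.mem_sdiff.1 hi).2
    simpa [N0] using this
  rw [Metric.cauchySeq_iff']
  intro ε hε
  set B := ‖∏ i ∈ N0, f i‖ + 1
  have hB : 0 < B := by positivity
  set d := min 1 (ε / (2 * B)) with hd
  have hd0 : 0 < d := by positivity
  refine ⟨N0 ∪ (hfin d hd0).toFinset, fun n hn => ?_⟩
  set N := N0 ∪ (hfin d hd0).toFinset
  have hn : N ⊆ n := hn
  have h1 : ∏ i ∈ n, f i - ∏ i ∈ N, f i = (∏ i ∈ n \ N, f i - 1) * ∏ i ∈ N, f i := by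
    rw [← Finset.prod_sdiff hn]; ring
  rw [dist_eq_norm, h1, norm_mul]
  have h2 : ‖∏ i ∈ n \ N, f i - 1‖ ≤ d := by
    refine (norm_prod_sub_one_le hd0.le (min_le_left _ _) _ ?_).1
    intro i hi
    have := (Finset.mem_sdiff.1 hi).2
    simp only [N, Finset.mem_union, not_or, Set.Finite.mem_toFinset, Set.mem_ofPred_eq, not_lt] at this
    exact this.2
  have h3 : ‖∏ i ∈ N, f i‖ ≤ B := (hN0 N Finset.subset_union_left).trans (by simp [B])
  calc _ ≤ d * B := by gcongr
    _ ≤ ε / (2 * B) * B := by gcongr; exact min_le_right _ _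
    _ = ε / 2 := by field_simp
    _ < ε := by linarith

theorem hasProd_zpow_of_ne_zero {K ι : Type*} [NormedField K] {f : ι → K} {a : K} (hf : HasProd f a)
    (ha : a ≠ 0) (m : ℤ) : HasProd (fun i => f i ^ m) (a ^ m) := by
  have := Tendsto.zpow₀ hf m (Or.inl ha)
  unfold HasProd
  simpa only [Finset.prod_zpow] using this

end NonarchimedeanProducts

/-! ### Cross ratios, theta products over a discrete group and their invariance. -/

section CrossRatios

variable {p : ℕ} [Fact p.Prime]

/-- The numerator of `g x - a`. -/
def pairing (g : GL (Fin 2) ℚ_[p]) (x a : Hp p) : ℂ_[p] :=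
  (emb (g.1 0 0) * x.1 + emb (g.1 0 1)) - a.1 * (emb (g.1 1 0) * x.1 + emb (g.1 1 1))

/-- The denominator in the Möbius action. -/
def den (g : GL (Fin 2) ℚ_[p]) (x : Hp p) : ℂ_[p] := emb (g.1 1 0) * x.1 + emb (g.1 1 1)

theorem pairing_eq (g : GL (Fin 2) ℚ_[p]) (x a : Hp p) :
    pairing g x a = ((g • x).1 - a.1) * den g x := by
  rw [den, sub_mul, Hp.smul_mul_den]; rfl

theorem den_ne_zero (g : GL (Fin 2) ℚ_[p]) (x : Hp p) : den g x ≠ 0 := x.den_ne_zero g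

theorem pairing_ne_zero {g : GL (Fin 2) ℚ_[p]} {x a : Hp p} (h : g • x ≠ a) : pairing g x a ≠ 0 := by
  rw [pairing_eq]
  exact mul_ne_zero (sub_ne_zero.2 fun h' => h (Hp.ext h')) (den_ne_zero g x)

theorem pairing_mul_right (g h : GL (Fin 2) ℚ_[p]) (x a : Hp p) :
    pairing (g * h) x a = pairing g (h • x) a * den h x := by
  have h1 := Hp.smul_mul_den h x
  unfold pairing den at *
  simp only [Units.val_mul, Matrix.mul_apply, Fin.sum_univ_two, map_add, map_mul]
  linear_combination (-emb (g.1 0 0) + a.1 * emb (g.1 1 0)) * h1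

/-- `pairing g x a` is the row `(1, -a)` times `g` times the column `(x, 1)`, and the row `(1, -(h •
a)) h` is proportional to `(1, -a)`. -/
theorem pairing_mul_left (g h : GL (Fin 2) ℚ_[p]) (x a : Hp p) :
    pairing (h * g) x (h • a) * den h a = emb h.1.det * pairing g x a := by
  have h1 := Hp.smul_mul_den h a
  unfold pairing den at *
  rw [Matrix.det_fin_two]
  simp only [Units.val_mul, Matrix.mul_apply, Fin.sum_univ_two, map_add, map_mul, map_sub]
  linear_combination (-((emb (h.1 1 0) * emb (g.1 0 0) + emb (h.1 1 1) * emb (g.1 1 0)) * x.1 +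
    (emb (h.1 1 0) * emb (g.1 0 1) + emb (h.1 1 1) * emb (g.1 1 1)))) * h1

theorem Hp.exists_nu_lower_bound (z : Hp p) : ∃ C > 0, ∀ u v, C * max ‖u‖ ‖v‖ ≤ nu z.1 u v := by
  obtain ⟨g, hg⟩ := exists_mem_cell 0 z
  have hz : z ∈ wideOpenAt g := hg.elim (fun h => h.2) fun h => affinoidAt_subset_wideOpenAt g h.2
  obtain ⟨C, D, hC, -, h⟩ := (mem_wideOpenAt_iff g z).1 hz
  have hm := mnorm_pos g⁻¹
  refine ⟨C / mnorm (g⁻¹).1, by positivity, fun u v => le_trans ?_ (h u v).1⟩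
  have := lam_mul_le g.1 (g⁻¹).1 u v
  rw [← Units.val_mul, mul_inv_cancel, Units.val_one, lam_one] at this
  rw [div_mul_eq_mul_div, div_le_iff₀ hm, mul_assoc, mul_comm (lam _ _ _)]
  gcongr

/-- If `e` is an entry of `g` of maximal norm, `e g` is the product of the column and the row
through `e`, up to one entry `± det g = ±1`. So `e` times the pairing is a product of two linear
forms, each of size at least a multiple of `mnorm g`, up to a bounded error `w`. -/
theorem exists_pairing_lower_bound (x a : Hp p) : ∃ K > 0, ∃ B, ∀ g : GL (Fin 2) ℚ_[p],
    g.1.det = 1 → B ≤ mnorm g.1 → K * mnorm g.1 ≤ ‖pairing g x a‖ := by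
  obtain ⟨C, hC, hx⟩ := x.exists_nu_lower_bound
  obtain ⟨C', hC', ha⟩ := a.exists_nu_lower_bound
  set M := max 1 ‖x.1‖ * max 1 ‖a.1‖ with hM
  have hM1 : 1 ≤ max 1 ‖x.1‖ := le_max_left _ _
  have hM2 : 1 ≤ max 1 ‖a.1‖ := le_max_left _ _
  -- `M` dominates every error term `w`; beyond this bound the product of the linear forms has norm
  -- greater than `M`.
  refine ⟨C * C', by positivity, max 1 ((M + 1) / (C * C')), fun g hg hB => ?_⟩
  have hs1 : 1 ≤ mnorm g.1 := (le_max_left _ _).trans hB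
  have hs2 : M < C * C' * mnorm g.1 ^ 2 := by
    have := (le_max_right _ _).trans hB
    rw [div_le_iff₀ (by positivity)] at this
    nlinarith [mul_pos hC hC', mul_le_mul_of_nonneg_left hs1 (mul_pos hC hC').le]
  have hdet : emb (g.1 0 0) * emb (g.1 1 1) - emb (g.1 0 1) * emb (g.1 1 0) = 1 := by
    rw [Matrix.det_fin_two] at hg
    rw [← map_mul, ← map_mul, ← map_sub, hg, map_one]
  have key : ∀ (e u v u' v' : ℚ_[p]) (w : ℂ_[p]), ‖e‖ = mnorm g.1 → ‖w‖ ≤ M →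
      ‖e‖ ≤ max ‖u‖ ‖v‖ → ‖e‖ ≤ max ‖u'‖ ‖v'‖ →
      emb e * pairing g x a - w = (emb u * x.1 + emb v) * (emb u' * a.1 + emb v') →
      C * C' * mnorm g.1 ≤ ‖pairing g x a‖ := by
    intro e u v u' v' w he hw huv huv' h
    rw [he] at huv huv'
    have h1 : C * mnorm g.1 ≤ ‖emb u * x.1 + emb v‖ := le_trans (by gcongr) (hx u v)
    have h2 : C' * mnorm g.1 ≤ ‖emb u' * a.1 + emb v'‖ := le_trans (by gcongr) (ha u' v')
    have h3 : C * C' * mnorm g.1 ^ 2 ≤ ‖emb e * pairing g x a - w‖ := by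
      rw [h, norm_mul]
      calc _ = (C * mnorm g.1) * (C' * mnorm g.1) := by ring
        _ ≤ _ := by gcongr
    have h4 : C * C' * mnorm g.1 ^ 2 ≤ ‖emb e * pairing g x a‖ := by
      have h5 := IsUltrametricDist.norm_add_le_max (emb e * pairing g x a) (-w)
      rw [← sub_eq_add_neg, norm_neg] at h5
      rcases le_max_iff.1 (h3.trans h5) with h6 | h6
      · exact h6
      · exact absurd (h6.trans hw) (not_le.2 hs2)
    rw [norm_mul, norm_emb, he] at h4
    have : 0 < mnorm g.1 := by linarith
    refine le_of_mul_le_mul_left ?_ this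
    linarith
  obtain ⟨i, j, hij⟩ := exists_norm_eq_mnorm g.1
  have hxM : ‖x.1‖ ≤ M := (le_max_right _ _).trans (le_mul_of_one_le_right (by positivity) hM2)
  have haM : ‖a.1‖ ≤ M := (le_max_right _ _).trans (le_mul_of_one_le_left (by positivity) hM1)
  have hM0 : (1 : ℝ) ≤ M := one_le_mul_of_one_le_of_one_le hM1 hM2
  have haxM : ‖a.1 * x.1‖ ≤ M := by
    rw [norm_mul, mul_comm]
    exact mul_le_mul (le_max_right _ _) (le_max_right _ _) (norm_nonneg _) (by positivity)
  fin_cases i <;> fin_cases j <;> simp only [Fin.zero_eta, Fin.mk_one] at hij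
  · refine key _ (g.1 0 0) (g.1 0 1) (-g.1 1 0) (g.1 0 0) (-a.1) hij (by rwa [norm_neg])
      (le_max_left _ _) (le_max_right _ _) ?_
    simp only [pairing, map_neg]
    linear_combination (-a.1) * hdet
  · refine key _ (g.1 0 0) (g.1 0 1) (-g.1 1 1) (g.1 0 1) (a.1 * x.1) hij haxM
      (le_max_right _ _) (le_max_right _ _) ?_
    simp only [pairing, map_neg]
    linear_combination (a.1 * x.1) * hdet
  · refine key _ (g.1 1 0) (g.1 1 1) (-g.1 1 0) (g.1 0 0) (-1) hij (by simpa using hM0)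
      (le_max_left _ _) (by rw [norm_neg]; exact le_max_left _ _) ?_
    simp only [pairing, map_neg]
    linear_combination -hdet
  · refine key _ (g.1 1 0) (g.1 1 1) (-g.1 1 1) (g.1 0 1) x.1 hij hxM
      (le_max_right _ _) (by rw [norm_neg]; exact le_max_left _ _) ?_
    simp only [pairing, map_neg]
    linear_combination x.1 * hdet

/-- The cross ratio `[(a) - (b); (g x) - (g y)]`. -/
def crossRatio (a b x y : Hp p) (g : GL (Fin 2) ℚ_[p]) : ℂ_[p] :=
  (pairing g x a * pairing g y b) / (pairing g x b * pairing g y a)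

/-- Plücker relation: for determinant one the numerator of the difference does not involve `g`. -/
theorem crossRatio_sub_one {a b x y : Hp p} {g : GL (Fin 2) ℚ_[p]} (hg : g.1.det = 1)
    (hx : g • x ≠ b) (hy : g • y ≠ a) :
    crossRatio a b x y g - 1 =
      (x.1 - y.1) * (a.1 - b.1) / (pairing g x b * pairing g y a) := by
  have hdet : emb (g.1 0 0) * emb (g.1 1 1) - emb (g.1 0 1) * emb (g.1 1 0) = 1 := by
    rw [Matrix.det_fin_two] at hg
    rw [← map_mul, ← map_mul, ← map_sub, hg, map_one]
  have h0 := mul_ne_zero (pairing_ne_zero hx) (pairing_ne_zero hy)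
  unfold crossRatio
  rw [div_sub_one h0]
  congr 1
  unfold pairing
  linear_combination (x.1 - y.1) * (a.1 - b.1) * hdet

theorem crossRatio_mul_smul (a b x y : Hp p) (g h : GL (Fin 2) ℚ_[p]) :
    crossRatio a b (h • x) (h • y) g = crossRatio a b x y (g * h) := by
  unfold crossRatio
  simp only [pairing_mul_right]
  have h1 := den_ne_zero h x
  have h2 := den_ne_zero h y
  rw [mul_mul_mul_comm, mul_mul_mul_comm (pairing g (h • x) b), mul_div_mul_right _ _ (mul_ne_zero h1 h2)]

theorem crossRatio_smul_smul (a b x y : Hp p) (g h : GL (Fin 2) ℚ_[p]) :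
    crossRatio (h • a) (h • b) x y (h * g) = crossRatio a b x y g := by
  have key : ∀ x a : Hp p, pairing (h * g) x (h • a) = emb h.1.det * pairing g x a / den h a :=
    fun x a => by rw [eq_div_iff (den_ne_zero h a), pairing_mul_left]
  have hd : emb h.1.det ≠ 0 := by
    simpa using Matrix.GeneralLinearGroup.det_ne_zero h
  have h1 := den_ne_zero h a
  have h2 := den_ne_zero h b
  unfold crossRatio
  simp only [key]
  by_cases h3 : pairing g x b = 0
  · simp [h3]
  by_cases h4 : pairing g y a = 0
  · simp [h4]
  field_simp

variable {G : Type*} [Group G]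

/-- A representation with values in `SL₂(ℚ_p)` that has discrete image and finite kernel. -/
structure IsDiscreteRep (ρ : G →* GL (Fin 2) ℚ_[p]) : Prop where
  det : ∀ g, (ρ g).1.det = 1
  finite : ∀ C : ℝ, {g | mnorm (ρ g).1 ≤ C}.Finite

/-- The points `a` and `x` are not in the same orbit. -/
def Adm (ρ : G →* GL (Fin 2) ℚ_[p]) (a x : Hp p) : Prop := ∀ g, ρ g • x ≠ a

/-- The infinite product of the cross ratios over the group. -/
def theta (ρ : G →* GL (Fin 2) ℚ_[p]) (a b x y : Hp p) : ℂ_[p] := ∏' g, crossRatio a b x y (ρ g)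

variable {ρ : G →* GL (Fin 2) ℚ_[p]}

theorem Adm.smul_left {a x : Hp p} (h : Adm ρ a x) (γ : G) : Adm ρ (ρ γ • a) x := by
  intro g hg
  refine h (γ⁻¹ * g) ?_
  rw [map_mul, mul_smul, hg, ← mul_smul, ← map_mul, inv_mul_cancel, map_one, one_smul]

theorem Adm.smul_right {a x : Hp p} (h : Adm ρ a x) (γ : G) : Adm ρ a (ρ γ • x) := by
  intro g hg
  refine h (g * γ) ?_
  rw [map_mul, mul_smul, hg]

/-- The distance of the cross ratio from `1` is `O(mnorm (ρ g) ^ (-2))`, and discreteness leaves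
only finitely many `g` of bounded `mnorm`. -/
theorem IsDiscreteRep.tendsto_crossRatio (hρ : IsDiscreteRep ρ) {a b x y : Hp p}
    (hx : Adm ρ b x) (hy : Adm ρ a y) :
    Tendsto (fun g => crossRatio a b x y (ρ g)) cofinite (𝓝 1) := by
  rw [Metric.tendsto_nhds]
  intro ε hε
  obtain ⟨K, hK, B, H⟩ := exists_pairing_lower_bound x b
  obtain ⟨K', hK', B', H'⟩ := exists_pairing_lower_bound y a
  set E := ‖x.1 - y.1‖ * ‖a.1 - b.1‖
  refine (hρ.finite (max (max B B') (max 1 (E / (ε * (K * K')))))).subset ?_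
  intro g hg
  by_contra hlt
  refine hg ?_
  simp only [Set.mem_ofPred_eq, not_le, max_lt_iff] at hlt
  obtain ⟨⟨h1, h2⟩, h3, h4⟩ := hlt
  have hs : 0 < mnorm (ρ g).1 := by linarith
  rw [Set.mem_ofPred_eq, dist_eq_norm, crossRatio_sub_one (hρ.det g) (hx g) (hy g), norm_div, norm_mul, norm_mul]
  rw [div_lt_iff₀ (by positivity)] at h4
  have h5 := H _ (hρ.det g) h1.le
  have h6 := H' _ (hρ.det g) h2.le
  have h7 : 0 < ‖pairing (ρ g) x b‖ := lt_of_lt_of_le (by positivity) h5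
  have h8 : 0 < ‖pairing (ρ g) y a‖ := lt_of_lt_of_le (by positivity) h6
  rw [div_lt_iff₀ (by positivity)]
  calc _ < mnorm (ρ g).1 * (ε * (K * K')) := h4
    _ ≤ mnorm (ρ g).1 * mnorm (ρ g).1 * (ε * (K * K')) := by
        gcongr
        nlinarith
    _ = ε * ((K * mnorm (ρ g).1) * (K' * mnorm (ρ g).1)) := by ring
    _ ≤ _ := by gcongr

theorem IsDiscreteRep.hasProd_theta (hρ : IsDiscreteRep ρ) {a b x y : Hp p}
    (hx : Adm ρ b x) (hy : Adm ρ a y) :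
    HasProd (fun g => crossRatio a b x y (ρ g)) (theta ρ a b x y) :=
  (multipliable_of_tendsto_one (hρ.tendsto_crossRatio hx hy)).hasProd

theorem IsDiscreteRep.theta_mul_right (hρ : IsDiscreteRep ρ) {a b x y z : Hp p}
    (hbx : Adm ρ b x) (hay : Adm ρ a y) (hby : Adm ρ b y) (haz : Adm ρ a z) :
    theta ρ a b x y * theta ρ a b y z = theta ρ a b x z := by
  refine ((hρ.hasProd_theta hbx hay).mul (hρ.hasProd_theta hby haz)).unique ?_
  convert hρ.hasProd_theta hbx haz using 2 with g
  have h1 := pairing_ne_zero (hbx g)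
  have h2 := pairing_ne_zero (hay g)
  have h3 := pairing_ne_zero (hby g)
  have h4 := pairing_ne_zero (haz g)
  unfold crossRatio
  field_simp

theorem IsDiscreteRep.theta_mul_left (hρ : IsDiscreteRep ρ) {a b c x y : Hp p}
    (hbx : Adm ρ b x) (hay : Adm ρ a y) (hcx : Adm ρ c x) (hby : Adm ρ b y) :
    theta ρ a b x y * theta ρ b c x y = theta ρ a c x y := by
  refine ((hρ.hasProd_theta hbx hay).mul (hρ.hasProd_theta hcx hby)).unique ?_
  convert hρ.hasProd_theta hcx hay using 2 with g
  have h1 := pairing_ne_zero (hbx g)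
  have h2 := pairing_ne_zero (hay g)
  have h3 := pairing_ne_zero (hcx g)
  have h4 := pairing_ne_zero (hby g)
  unfold crossRatio
  field_simp

theorem IsDiscreteRep.theta_self (hρ : IsDiscreteRep ρ) {a b x : Hp p}
    (hax : Adm ρ a x) (hbx : Adm ρ b x) : theta ρ a b x x = 1 := by
  refine (hρ.hasProd_theta hbx hax).unique ?_
  convert hasProd_one using 2 with g
  have h1 := pairing_ne_zero (hbx g)
  have h2 := pairing_ne_zero (hax g)
  unfold crossRatio
  field_simp

/-- Convergence alone does not exclude zero, but exchanging `x` and `y` gives an inverse. -/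
theorem IsDiscreteRep.theta_ne_zero (hρ : IsDiscreteRep ρ) {a b x y : Hp p}
    (hax : Adm ρ a x) (hbx : Adm ρ b x) (hay : Adm ρ a y) (hby : Adm ρ b y) :
    theta ρ a b x y ≠ 0 := by
  intro h
  have := hρ.theta_mul_right hbx hay hby hax
  rw [h, zero_mul, hρ.theta_self hax hbx] at this
  exact zero_ne_one this

theorem theta_smul_left (γ : G) (a b x y : Hp p) :
    theta ρ (ρ γ • a) (ρ γ • b) x y = theta ρ a b x y := by
  unfold theta
  rw [← Equiv.tprod_eq (Equiv.mulLeft γ)]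
  simp only [Equiv.coe_mulLeft, map_mul, crossRatio_smul_smul]

theorem theta_smul_right (γ : G) (a b x y : Hp p) :
    theta ρ a b (ρ γ • x) (ρ γ • y) = theta ρ a b x y := by
  unfold theta
  conv_rhs => rw [← Equiv.tprod_eq (Equiv.mulRight γ)]
  simp only [Equiv.coe_mulRight, map_mul, crossRatio_mul_smul]

/-- Decompose `(γ a) - (b)` through `a` and through `γ b`; the parts `(a) - (b)` and `(γ a) - (γ b)`
have equal, nonzero theta products and cancel. -/
theorem IsDiscreteRep.theta_base (hρ : IsDiscreteRep ρ) (γ : G) {a b x y : Hp p}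
    (hax : Adm ρ a x) (hbx : Adm ρ b x) (hay : Adm ρ a y) (hby : Adm ρ b y) :
    theta ρ (ρ γ • a) a x y = theta ρ (ρ γ • b) b x y := by
  have h1 := hρ.theta_mul_left hax (hay.smul_left γ) hbx hay
  have h2 := hρ.theta_mul_left (hbx.smul_left γ) (hay.smul_left γ) hbx (hby.smul_left γ)
  rw [theta_smul_left, ← h1, mul_comm] at h2
  exact (mul_right_cancel₀ (hρ.theta_ne_zero hax hbx hay hby) h2).symm

end CrossRatios

/-! ### Periods of pairs of points and equivariant choices of points in cells. -/

section ThetaCocycle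

variable {p : ℕ} [Fact p.Prime] {G : Type*} [Group G] {ρ : G →* GL (Fin 2) ℚ_[p]}

theorem IsDiscreteRep.countable (hρ : IsDiscreteRep ρ) : Countable G := by
  rw [← Set.countable_univ_iff]
  have : (Set.univ : Set G) = ⋃ n : ℕ, {g | mnorm (ρ g).1 ≤ n} := by
    symm
    rw [Set.eq_univ_iff_forall]
    intro g
    obtain ⟨n, hn⟩ := exists_nat_ge (mnorm (ρ g).1)
    exact Set.mem_iUnion.2 ⟨n, hn⟩
  rw [this]
  exact Set.countable_iUnion fun n => (hρ.finite n).countable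

theorem upperGL_zero_smul_val (c : ℚ_[p]) (x : Hp p) : (upperGL 0 c • x).1 = x.1 + emb c := by
  rw [Hp.smul_val]
  simp [moebius, upperGL, Matrix.GeneralLinearGroup.mkOfDetNeZero]

theorem uncountable_padic : ¬ (Set.univ : Set ℚ_[p]).Countable := by
  intro h
  have h1 := continuum_le_cardinal_of_nontriviallyNormedField ℚ_[p]
  have := Set.countable_univ_iff.1 h
  exact absurd (h1.trans Cardinal.mk_le_aleph0) (not_le.2 Cardinal.aleph0_lt_continuum)

/-- Every point can be translated so that it avoids the orbits of finitely many points. -/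
theorem IsDiscreteRep.exists_adm (hρ : IsDiscreteRep ρ) (x₀ : Hp p) {Z : Set (Hp p)}
    (hZ : Z.Finite) : ∃ c : ℚ_[p], ∀ x ∈ Z, Adm ρ (upperGL 0 c • x₀) x := by
  have := hρ.countable
  have hinj : Function.Injective fun c : ℚ_[p] => upperGL 0 c • x₀ := by
    intro c d h
    have h' : (upperGL 0 c • x₀).1 = (upperGL 0 d • x₀).1 := congrArg Subtype.val h
    rw [upperGL_zero_smul_val, upperGL_zero_smul_val] at h'
    exact (algebraMap ℚ_[p] ℂ_[p]).injective (add_left_cancel h')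
  have hc : (⋃ g : G, (fun x => ρ g • x) '' Z).Countable :=
    Set.countable_iUnion fun g => (hZ.image _).countable
  have hc' := hc.preimage hinj
  by_contra! H
  -- There are uncountably many translates but only countably many points in the orbits of `Z`.
  -- Translating by `ℚ_p` keeps the base point in any field containing `x₀`, which `period_galAct`
  -- needs.
  refine uncountable_padic (p := p) (hc'.mono fun c _ => ?_)
  obtain ⟨x, hx, h⟩ := H c
  unfold Adm at h
  push Not at h
  obtain ⟨g, hg⟩ := h
  exact Set.mem_iUnion.2 ⟨g, x, hx, hg⟩

open Classical in
/-- The value of the product `[(γ η) - (η); (x) - (y)]` over the group, for any `η` outside of the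
orbits of `x` and `y`. -/
def period (ρ : G →* GL (Fin 2) ℚ_[p]) (γ : G) (x y : Hp p) : ℂ_[p] :=
  if h : ∃ η, Adm ρ η x ∧ Adm ρ η y then theta ρ (ρ γ • h.choose) h.choose x y else 1

theorem IsDiscreteRep.period_eq (hρ : IsDiscreteRep ρ) (γ : G) {η x y : Hp p} (hx : Adm ρ η x)
    (hy : Adm ρ η y) : period ρ γ x y = theta ρ (ρ γ • η) η x y := by
  have h : ∃ η, Adm ρ η x ∧ Adm ρ η y := ⟨η, hx, hy⟩
  unfold period
  rw [dif_pos h]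
  exact hρ.theta_base γ h.choose_spec.1 hx h.choose_spec.2 hy

theorem IsDiscreteRep.period_mul_right (hρ : IsDiscreteRep ρ) (γ : G) (x y z : Hp p) :
    period ρ γ x y * period ρ γ y z = period ρ γ x z := by
  obtain ⟨c, hc⟩ := hρ.exists_adm x (Z := {x, y, z}) (by simp)
  simp only [Set.mem_insert_iff, Set.mem_singleton_iff, forall_eq_or_imp, forall_eq] at hc
  obtain ⟨h1, h2, h3⟩ := hc
  rw [hρ.period_eq γ h1 h2, hρ.period_eq γ h2 h3, hρ.period_eq γ h1 h3]
  exact hρ.theta_mul_right h1 (h2.smul_left γ) h2 (h3.smul_left γ)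

/-- This shows that the default value in `period` never occurs for a discrete representation. -/
theorem IsDiscreteRep.exists_adm_pair (hρ : IsDiscreteRep ρ) (x y : Hp p) :
    ∃ η, Adm ρ η x ∧ Adm ρ η y := by
  obtain ⟨c, hc⟩ := hρ.exists_adm x (Z := {x, y}) (by simp)
  exact ⟨_, hc x (by simp), hc y (by simp)⟩

theorem IsDiscreteRep.period_ne_zero (hρ : IsDiscreteRep ρ) (γ : G) (x y : Hp p) :
    period ρ γ x y ≠ 0 := by
  obtain ⟨η, hx, hy⟩ := hρ.exists_adm_pair x y
  rw [hρ.period_eq γ hx hy]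
  exact hρ.theta_ne_zero (hx.smul_left γ) hx (hy.smul_left γ) hy

theorem IsDiscreteRep.period_smul (hρ : IsDiscreteRep ρ) (γ α : G) (x y : Hp p) :
    period ρ γ (ρ α • x) (ρ α • y) = period ρ γ x y := by
  obtain ⟨η, hx, hy⟩ := hρ.exists_adm_pair x y
  rw [hρ.period_eq γ hx hy, hρ.period_eq γ (hx.smul_right α) (hy.smul_right α), theta_smul_right]

/-- Pass from `γ γ' η` to `η` through `γ' η`, and use `γ' η` as the base point for `γ`. -/
theorem IsDiscreteRep.period_mul (hρ : IsDiscreteRep ρ) (γ γ' : G) (x y : Hp p) :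
    period ρ (γ * γ') x y = period ρ γ x y * period ρ γ' x y := by
  obtain ⟨η, hx, hy⟩ := hρ.exists_adm_pair x y
  rw [hρ.period_eq _ hx hy, hρ.period_eq γ (hx.smul_left γ') (hy.smul_left γ'),
    hρ.period_eq γ' hx hy, hρ.theta_mul_left (hx.smul_left γ') ((hy.smul_left γ').smul_left γ) hx
    (hy.smul_left γ'), map_mul, mul_smul]

/-- The divisor `𝒟` has strong degree zero for the decomposition of `ℋ_p` of the given parity. -/
def StrongDegZeroPar (e : ℤ) (𝒟 : Divisor p) : Prop :=
  ∀ g : GL (Fin 2) ℚ_[p], (par e g → degOn 𝒟 (wideOpenAt g) = 0) ∧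
    (¬ par e g → degOn 𝒟 (affinoidAt g) = 0)

theorem strongDegZeroPar_zero {𝒟 : Divisor p} (h : StrongDegZeroEven 𝒟) : StrongDegZeroPar 0 𝒟 := by
  intro g
  have : par 0 g ↔ IsEvenVertex g := by simp [par, IsEvenVertex]
  rw [this]
  exact h g

theorem strongDegZeroPar_one {𝒟 : Divisor p} (h : StrongDegZeroOdd 𝒟) : StrongDegZeroPar 1 𝒟 := by
  intro g
  have : par 1 g ↔ ¬ IsEvenVertex g := by simp [par, IsEvenVertex]
  rw [this, not_not]
  exact h g

/-- A function that chooses a point in each cell, compatibly with the group action. -/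
structure IsCellSection (ρ : G →* GL (Fin 2) ℚ_[p]) (e : ℤ) (b : Hp p → Hp p) : Prop where
  sameCell : ∀ x, SameCell e x (b x)
  congr : ∀ {x y}, SameCell e x y → b x = b y
  smul : ∀ γ x, b (ρ γ • x) = ρ γ • b x

/-- The fibres of `b` are exactly the cells, and `𝒟` has degree zero on each of them. -/
theorem StrongDegZeroPar.mapDomain_eq_zero {e : ℤ} {b : Hp p → Hp p} (hb : IsCellSection ρ e b)
    {𝒟 : Divisor p} (h : StrongDegZeroPar e 𝒟) : 𝒟.mapDomain b = 0 := by
  classical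
  ext y
  rw [Finsupp.zero_apply, Finsupp.mapDomain, Finsupp.sum_apply]
  simp only [Finsupp.single_apply, Finsupp.sum]
  rw [← Finset.sum_filter]
  by_cases hy : ∃ x₀, b x₀ = y
  · obtain ⟨x₀, rfl⟩ := hy
    have key : ∀ x, b x = b x₀ ↔ SameCell e x₀ x := fun x => by
      refine ⟨fun h => ?_, fun h => (hb.congr h).symm⟩
      have := (hb.sameCell x)
      rw [h] at this
      exact (hb.sameCell x₀).trans this.symm
    obtain ⟨g, ⟨hg, hz⟩ | ⟨hg, hz⟩⟩ := exists_mem_cell e x₀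
    · rw [← (h g).1 hg]
      unfold degOn
      refine Finset.sum_congr (Finset.filter_congr fun x _ => ?_) fun _ _ => rfl
      rw [key]
      exact ⟨fun h => ((h g).1 hg).1 hz, fun h => sameCell_of_mem_wideOpenAt hg hz h⟩
    · rw [← (h g).2 hg]
      unfold degOn
      refine Finset.sum_congr (Finset.filter_congr fun x _ => ?_) fun _ _ => rfl
      rw [key]
      exact ⟨fun h => ((h g).2 hg).1 hz, fun h => sameCell_of_mem_affinoidAt hz h⟩
  · rw [Finset.filter_false_of_mem, Finset.sum_empty]
    exact fun x _ hx => hy ⟨x, hx⟩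

/-- Torsion elements act trivially. -/
def TorsionActsTrivially (ρ : G →* GL (Fin 2) ℚ_[p]) : Prop :=
  ∀ γ : G, ∀ n : ℕ, 0 < n → γ ^ n = 1 → ∀ z : Hp p, ρ γ • z = z

theorem mnorm_pow_le_one {m : GL (Fin 2) ℚ_[p]} (hm : mnorm m.1 ≤ 1) (n : ℕ) :
    mnorm (m ^ n).1 ≤ 1 := by
  induction n with
  | zero => simp [mnorm]
  | succ n ih =>
    rw [pow_succ, Units.val_mul]
    exact (mnorm_mul_le _ _).trans (mul_le_one₀ ih (mnorm_nonneg _) hm)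

/-- An element that stabilizes a cell acts trivially. -/
theorem IsDiscreteRep.smul_eq_of_sameCell (hρ : IsDiscreteRep ρ) (ht : TorsionActsTrivially ρ)
    {e : ℤ} {γ : G} {z : Hp p} (h : SameCell e z (ρ γ • z)) (w : Hp p) : ρ γ • w = w := by
  obtain ⟨g, hg⟩ := mnorm_conj_le_one (hρ.det γ) h
  -- All powers of a conjugate of `γ⁻¹` are integral, so the powers of `γ⁻¹` are bounded, hence
  -- finite in number by discreteness.
  have hfin : ((Submonoid.powers γ⁻¹ : Submonoid G) : Set G).Finite := by
    refine (hρ.finite (mnorm g.1 * 1 * mnorm (g⁻¹).1)).subset ?_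
    rintro _ ⟨n, rfl⟩
    have h1 : ρ (γ⁻¹ ^ n) = g * (g⁻¹ * (ρ γ)⁻¹ * g) ^ n * g⁻¹ := by
      have : (g⁻¹ * (ρ γ)⁻¹ * g) ^ n = g⁻¹ * ((ρ γ)⁻¹) ^ n * g := by
        simpa using conj_pow (a := g⁻¹) (b := (ρ γ)⁻¹) (i := n)
      rw [this, map_pow, map_inv]
      group
    change mnorm (ρ (γ⁻¹ ^ n)).1 ≤ _
    rw [h1, Units.val_mul, Units.val_mul]
    refine (mnorm_mul_le _ _).trans ?_
    refine mul_le_mul_of_nonneg_right ?_ (mnorm_nonneg _)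
    refine (mnorm_mul_le _ _).trans ?_
    exact mul_le_mul_of_nonneg_left (mnorm_pow_le_one hg n) (mnorm_nonneg _)
  obtain ⟨n, hn, h1⟩ := isOfFinOrder_iff_pow_eq_one.1 (finite_powers.1 hfin)
  refine ht γ n hn ?_ w
  rwa [inv_pow, inv_eq_one] at h1

/-- One cell is chosen in every orbit of cells, a point in it, and this point is moved around by the
group. The stable set `Pr` is used twice: for points reducing to vertices (absolute values) and for
points over a field (rationality). -/
theorem IsDiscreteRep.exists_cellSection (hρ : IsDiscreteRep ρ) (ht : TorsionActsTrivially ρ) (e : ℤ)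
    {Pr : Set (Hp p)} (hPr : ∀ γ, ∀ z ∈ Pr, ρ γ • z ∈ Pr) :
    ∃ b, IsCellSection ρ e b ∧ ∀ x y, SameCell e x y → y ∈ Pr → b x ∈ Pr := by
  classical
  let S : Setoid (Hp p) :=
    { r := fun x y => ∃ γ, SameCell e (ρ γ • x) y
      iseqv :=
        { refl := fun x => ⟨1, by rw [map_one, one_smul]; exact SameCell.refl e x⟩
          symm := by
            rintro x y ⟨γ, h⟩
            refine ⟨γ⁻¹, ?_⟩
            have := (h.smul (hρ.det γ⁻¹)).symm
            rwa [← mul_smul, ← map_mul, inv_mul_cancel, map_one, one_smul] at this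
          trans := by
            rintro x y z ⟨γ, h⟩ ⟨γ', h'⟩
            refine ⟨γ' * γ, ?_⟩
            rw [map_mul, mul_smul]
            exact (h.smul (hρ.det γ')).trans h' } }
  have hs : ∀ z : Hp p, ∃ w, SameCell e z w ∧ ∀ y, SameCell e z y → y ∈ Pr → w ∈ Pr := by
    intro z
    by_cases h : ∃ y, SameCell e z y ∧ y ∈ Pr
    · obtain ⟨y, h1, h2⟩ := h
      exact ⟨y, h1, fun _ _ _ => h2⟩
    · exact ⟨z, SameCell.refl e z, fun y h1 h2 => absurd ⟨y, h1, h2⟩ h⟩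
  choose s hs1 hs2 using hs
  let rep : Hp p → Hp p := fun x => (Quotient.mk S x).out
  have hrep : ∀ x, ∃ γ, SameCell e (ρ γ • x) (rep x) := fun x =>
    S.symm (Quotient.mk_out (s := S) x)
  have hrep' : ∀ x y, (∃ γ, SameCell e (ρ γ • x) y) → rep x = rep y := fun x y h => by
    change (Quotient.mk S x).out = (Quotient.mk S y).out
    rw [Quotient.sound (s := S) h]
  choose c hc using hrep
  -- Two elements moving `x` into the chosen cell differ by an element stabilizing that cell, which
  -- acts trivially. Hence the transported point does not depend on the choice of `c x`.
  have huniq : ∀ x γ, SameCell e (ρ γ • x) (rep x) → ∀ w : Hp p, ρ γ⁻¹ • w = ρ (c x)⁻¹ • w := by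
    intro x γ h w
    have h1 : SameCell e (ρ (c x) • x) (ρ (γ * (c x)⁻¹) • (ρ (c x) • x)) := by
      rw [← mul_smul, ← map_mul, inv_mul_cancel_right]
      exact (hc x).trans h.symm
    conv_lhs => rw [← hρ.smul_eq_of_sameCell ht h1 w]
    rw [← mul_smul, ← map_mul, inv_mul_cancel_left]
  refine ⟨fun x => ρ (c x)⁻¹ • s (rep x), ⟨fun x => ?_, fun {x y} h => ?_, fun γ x => ?_⟩, ?_⟩
  · have := ((hc x).trans (hs1 (rep x))).smul (hρ.det (c x)⁻¹)
    rwa [← mul_smul, ← map_mul, inv_mul_cancel, map_one, one_smul] at this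
  · have h1 : rep x = rep y := hrep' x y ⟨1, by rwa [map_one, one_smul]⟩
    rw [← huniq x (c y), h1]
    rw [h1]
    exact (h.smul (hρ.det (c y))).trans (hc y)
  · have h1 : rep (ρ γ • x) = rep x := (hrep' x _ ⟨γ, SameCell.refl e _⟩).symm
    have := hc (ρ γ • x)
    rw [h1, ← mul_smul, ← map_mul] at this
    rw [h1, ← huniq x _ this, ← mul_smul, ← map_mul, mul_inv_rev, mul_inv_cancel_left]
  · intro x y hxy hy
    refine hPr _ _ (hs2 _ (ρ (c x) • y) ?_ (hPr _ _ hy))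
    exact (hc x).symm.trans (hxy.smul (hρ.det _))

end ThetaCocycle

/-! ### Generic base points and the absolute values of periods. -/

section GenericPoints

variable {p : ℕ} [Fact p.Prime]

/-- The residue field of `ℂ_p` is infinite. -/
theorem exists_norm_sub_ge_one {A : Set ℂ_[p]} (hA : A.Finite) :
    ∃ η : ℂ_[p], ‖η‖ ≤ 1 ∧ ∀ a ∈ A, 1 ≤ ‖η - a‖ := by
  classical
  -- The order `n + 1` is prime to `p` and exceeds the number of points of `A`; some root of unity
  -- of this order then avoids all their residue discs.
  set n := p * hA.toFinset.card with hn
  have hcast : ‖((n + 1 : ℕ) : ℂ_[p])‖ = 1 := by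
    rw [← map_natCast (algebraMap ℚ_[p] ℂ_[p]), norm_algebraMap', Padic.norm_natCast_eq_one_iff]
    simp [hn]
  have : NeZero ((n + 1 : ℕ) : ℂ_[p]) := ⟨fun h => by rw [h, norm_zero] at hcast; norm_num at hcast⟩
  obtain ⟨μ, hμ⟩ := HasEnoughRootsOfUnity.exists_primitiveRoot ℂ_[p] (n + 1)
  have hμ1 : ‖μ‖ = 1 := by
    rw [← pow_eq_one_iff_of_nonneg (norm_nonneg _) n.succ_ne_zero, ← norm_pow, hμ.pow_eq_one, norm_one]
  have hle : ∀ k, ‖1 - μ ^ k‖ ≤ 1 := by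
    intro k
    have := IsUltrametricDist.norm_add_le_max 1 (-μ ^ k)
    rwa [← sub_eq_add_neg, norm_neg, norm_pow, hμ1, one_pow, norm_one, max_self] at this
  -- The product of these factors is `n + 1`, of norm one, while each factor has norm at most one.
  have hge : ∀ k ∈ Finset.range n, ‖1 - μ ^ (k + 1)‖ = 1 := by
    have h1 := congrArg norm (IsPrimitiveRoot.prod_one_sub_pow_eq_order hμ)
    rw [norm_prod] at h1
    intro k hk
    refine le_antisymm (hle _) ?_
    rw [← Finset.mul_prod_erase _ _ hk] at h1
    have h2 : ∏ x ∈ (Finset.range n).erase k, ‖1 - μ ^ (x + 1)‖ ≤ 1 :=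
      Finset.prod_le_one (fun _ _ => norm_nonneg _) fun _ _ => hle _
    have h3 : (1 : ℝ) = ‖1 - μ ^ (k + 1)‖ * ∏ x ∈ (Finset.range n).erase k, ‖1 - μ ^ (x + 1)‖ := by
      rw [h1, ← hcast]; push_cast; rfl
    rw [h3]
    exact mul_le_of_le_one_right (norm_nonneg _) h2
  by_contra! H
  have H' : ∀ i : ℕ, ∃ a ∈ hA.toFinset, ‖μ ^ i - a‖ < 1 := by
    intro i
    obtain ⟨a, ha, h⟩ := H (μ ^ i) (by rw [norm_pow, hμ1, one_pow])
    exact ⟨a, hA.mem_toFinset.2 ha, h⟩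
  choose f hf hf' using H'
  have hcard : hA.toFinset.card < (Finset.range (n + 1)).card := by
    rw [Finset.card_range, hn, Nat.lt_succ_iff]
    exact Nat.le_mul_of_pos_left _ (Fact.out : p.Prime).pos
  obtain ⟨i, hi, j, hj, hij, hfij⟩ :=
    Finset.exists_ne_map_eq_of_card_lt_of_maps_to hcard (fun i _ => hf i)
  have key : ∀ i j, i < j → j < n + 1 → f i = f j → False := by
    intro i j hij hj h
    have h1 : ‖μ ^ i - μ ^ j‖ < 1 := by
      have h2 := IsUltrametricDist.norm_add_le_max (μ ^ i - f i) (-(μ ^ j - f j))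
      rw [norm_neg, h] at h2
      have h3 := hf' i
      rw [h] at h3
      have e : μ ^ i - μ ^ j = μ ^ i - f j + -(μ ^ j - f j) := by ring
      rw [e]
      exact h2.trans_lt (max_lt h3 (hf' j))
    have h2 : μ ^ i - μ ^ j = μ ^ i * (1 - μ ^ ((j - i - 1) + 1)) := by
      rw [mul_sub, mul_one, ← pow_add]; congr 2; omega
    rw [h2, norm_mul, norm_pow, hμ1, one_pow, one_mul, hge _ (Finset.mem_range.2 (by omega))] at h1
    exact lt_irrefl _ h1
  rw [Finset.mem_range] at hi hj
  rcases lt_or_gt_of_ne hij with h | h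
  · exact key i j h hj hfij
  · exact key j i h hi hfij.symm

theorem norm_sub_lt_one_trans {a b c : ℂ_[p]} (h1 : ‖a - b‖ < 1) (h2 : ‖b - c‖ < 1) :
    ‖a - c‖ < 1 := by
  have := IsUltrametricDist.norm_add_le_max (a - b) (b - c)
  rw [sub_add_sub_cancel] at this
  exact this.trans_lt (max_lt h1 h2)

theorem exists_mem_stdAffinoid {A : Set ℂ_[p]} (hA : A.Finite) :
    ∃ η : Hp p, η.1 ∈ stdAffinoid p ∧ ∀ a ∈ A, 1 ≤ ‖η.1 - a‖ := by
  -- The integers `0, …, p - 1` are avoided as well: they represent the residue classes of `ℤ_p`.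
  obtain ⟨η, h1, h2⟩ := exists_norm_sub_ge_one (p := p)
    (hA.union ((Finset.range p).finite_toSet.image fun n : ℕ => (n : ℂ_[p])))
  have h3 : ∀ c : ℤ_[p], 1 ≤ ‖η - algebraMap ℚ_[p] ℂ_[p] c‖ := by
    intro c
    by_contra! h
    obtain ⟨n, hn, hc⟩ := PadicInt.exists_mem_range c
    rw [IsLocalRing.mem_maximalIdeal, PadicInt.mem_nonunits, PadicInt.norm_def] at hc
    refine absurd (h2 n (Or.inr ⟨n, by simpa using hn, rfl⟩)) (not_le.2 ?_)
    refine norm_sub_lt_one_trans h ?_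
    rw [← norm_emb] at hc
    simpa using hc
  refine ⟨⟨η, ?_⟩, ⟨h1, h3⟩, fun a ha => h2 a (Or.inl ha)⟩
  rintro ⟨t, rfl⟩
  rw [norm_algebraMap'] at h1
  have := h3 ⟨t, h1⟩
  rw [sub_self, norm_zero] at this
  norm_num at this

/-- The maximum of the norm attached to `x` on the rows of `g`. -/
def rowNorm (g : GL (Fin 2) ℚ_[p]) (x : Hp p) : ℝ :=
  max (nu x.1 (g.1 0 0) (g.1 0 1)) (nu x.1 (g.1 1 0) (g.1 1 1))

theorem rowNorm_pos (g : GL (Fin 2) ℚ_[p]) (x : Hp p) : 0 < rowNorm g x :=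
  lt_max_of_lt_left (nu_pos x (GL_row_ne_zero g 0))

/-- There is no cancellation in `g x - η`: its norm is `max ‖g x‖ 1`. If `‖g x‖ = 1` and the two
points were congruent, `g x` would lie in the standard affinoid with `η`, contrary to `h`. -/
theorem norm_pairing_eq {g : GL (Fin 2) ℚ_[p]} {x η : Hp p} (hη : η.1 ∈ stdAffinoid p)
    (h : (g • x).1 ∈ stdAffinoid p → 1 ≤ ‖η.1 - (g • x).1‖) :
    ‖pairing g x η‖ = rowNorm g x := by
  have hη1 : ‖η.1‖ = 1 := by
    refine le_antisymm hη.1 ?_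
    simpa using hη.2 0
  have h0 : 0 < ‖den g x‖ := norm_pos_iff.2 (den_ne_zero g x)
  have hW : nu x.1 (g.1 1 0) (g.1 1 1) = ‖den g x‖ := rfl
  have hU : nu x.1 (g.1 0 0) (g.1 0 1) = ‖(g • x).1‖ * ‖den g x‖ := by
    rw [den, ← norm_mul, Hp.smul_mul_den]; rfl
  have key : ‖(g • x).1 - η.1‖ = max ‖(g • x).1‖ 1 := by
    by_cases hne : ‖(g • x).1‖ = 1
    · have h1 : ‖(g • x).1 - η.1‖ ≤ 1 := by
        have := IsUltrametricDist.norm_add_le_max (g • x).1 (-η.1)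
        rwa [← sub_eq_add_neg, norm_neg, hne, hη1, max_self] at this
      rw [hne, max_self]
      refine le_antisymm h1 ?_
      by_contra! hlt
      rw [norm_sub_rev] at hlt
      refine absurd (h ⟨hne.le, fun c => ?_⟩) (not_le.2 hlt)
      by_contra! h2
      exact absurd (hη.2 c) (not_le.2 (norm_sub_lt_one_trans hlt h2))
    · have := IsUltrametricDist.norm_add_eq_max_of_norm_ne_norm (x := (g • x).1) (y := -η.1)
        (by rwa [norm_neg, hη1])
      rwa [← sub_eq_add_neg, norm_neg, hη1] at this
  rw [pairing_eq, norm_mul, key, rowNorm, hU, hW, max_mul_of_nonneg _ _ h0.le, one_mul]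

variable {G : Type*} [Group G] {ρ : G →* GL (Fin 2) ℚ_[p]}

/-- Any two such `g` satisfy that `g g₀⁻¹` fixes the standard vertex, which bounds `mnorm (ρ g)`. -/
theorem IsDiscreteRep.finite_smul_mem (hρ : IsDiscreteRep ρ) (x : Hp p) :
    {g | (ρ g • x).1 ∈ stdAffinoid p}.Finite := by
  by_cases h : ∃ g₀, (ρ g₀ • x).1 ∈ stdAffinoid p
  swap
  · convert Set.finite_empty
    rw [Set.eq_empty_iff_forall_notMem]
    exact fun g hg => h ⟨g, hg⟩
  obtain ⟨g₀, h₀⟩ := h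
  refine (hρ.finite (mnorm (ρ g₀).1)).subset fun g hg => ?_
  have key : ∀ g, (ρ g • x).1 ∈ stdAffinoid p → x ∈ affinoidAt (ρ g)⁻¹ := by
    intro g hg
    change (((ρ g)⁻¹)⁻¹ • x).1 ∈ stdAffinoid p
    rwa [inv_inv]
  have h1 := sameVertex_of_mem_affinoidAt (affinoidAt_subset_wideOpenAt _ (key g hg)) (key g₀ h₀)
  rw [SameVertex, inv_inv, ← map_inv, ← map_mul, hρ.det, norm_one,
    sq_le_one_iff₀ (mnorm_nonneg _)] at h1
  have h2 : ρ g = ρ (g * g₀⁻¹) * ρ g₀ := by rw [← map_mul, inv_mul_cancel_right]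
  rw [Set.mem_ofPred_eq, h2, Units.val_mul]
  exact (mnorm_mul_le _ _).trans (mul_le_of_le_one_left (mnorm_nonneg _) h1)

theorem IsDiscreteRep.exists_generic (hρ : IsDiscreteRep ρ) {Z : Set (Hp p)} (hZ : Z.Finite) :
    ∃ η : Hp p, ∀ x ∈ Z, ∀ g, ‖pairing (ρ g) x η‖ = rowNorm (ρ g) x := by
  have hA : (⋃ x ∈ Z, (fun g => (ρ g • x).1) '' {g | (ρ g • x).1 ∈ stdAffinoid p}).Finite :=
    hZ.biUnion fun x _ => (hρ.finite_smul_mem x).image _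
  obtain ⟨η, h1, h2⟩ := exists_mem_stdAffinoid hA
  refine ⟨η, fun x hx g => norm_pairing_eq h1 fun h => h2 _ ?_⟩
  exact Set.mem_biUnion hx ⟨g, h, rfl⟩

/-- For generic `η` the pairings have the norms `rowNorm`, and for `γ η` those of `γ⁻¹ g`, up to a
factor that cancels. The hypothesis at `g` and at `γ⁻¹ g`, with the same `C`, makes every factor of
the product have norm one. -/
theorem IsDiscreteRep.norm_period_mul (hρ : IsDiscreteRep ρ) (γ : G) {x y y' : Hp p}
    (h : ∃ C > 0, ∀ g : GL (Fin 2) ℚ_[p], rowNorm g x ^ 2 = C * (rowNorm g y * rowNorm g y')) :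
    ‖period ρ γ x y * period ρ γ x y'‖ = 1 := by
  obtain ⟨C, hC, h⟩ := h
  obtain ⟨η, hη⟩ := hρ.exists_generic (Z := {x, y, y'}) (by simp)
  have hadm : ∀ z ∈ ({x, y, y'} : Set (Hp p)), Adm ρ η z := by
    intro z hz g hg
    have h1 := hη z hz g
    rw [pairing_eq, hg, sub_self, zero_mul, norm_zero] at h1
    exact (rowNorm_pos (ρ g) z).ne h1
  have hn : ∀ z ∈ ({x, y, y'} : Set (Hp p)), ∀ g, ‖pairing (ρ g) z (ρ γ • η)‖ =
      rowNorm (ρ (γ⁻¹ * g)) z / ‖den (ρ γ) η‖ := by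
    intro z hz g
    rw [eq_div_iff (norm_ne_zero_iff.2 (den_ne_zero _ _)), ← norm_mul]
    have h1 : ρ g = ρ γ * ρ (γ⁻¹ * g) := by rw [← map_mul, mul_inv_cancel_left]
    conv_lhs => rw [h1]
    rw [pairing_mul_left, hρ.det, map_one, one_mul, hη z hz]
  have hx := hadm x (by simp)
  have hy := hadm y (by simp)
  have hy' := hadm y' (by simp)
  rw [hρ.period_eq γ hx hy, hρ.period_eq γ hx hy']
  have hprod := ((hρ.hasProd_theta hx (hy.smul_left γ)).mul
    (hρ.hasProd_theta hx (hy'.smul_left γ))).norm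
  refine hprod.unique ?_
  convert hasProd_one using 2 with g
  have hd : 0 < ‖den (ρ γ) η‖ := norm_pos_iff.2 (den_ne_zero _ _)
  unfold crossRatio
  simp only [norm_mul, norm_div]
  rw [hn x (by simp), hn y (by simp), hn y' (by simp), hη x (by simp), hη y (by simp),
    hη y' (by simp)]
  have e1 := h (ρ g)
  have e2 := h (ρ (γ⁻¹ * g))
  have p1 := rowNorm_pos (ρ g) x
  have p2 := rowNorm_pos (ρ g) y
  have p3 := rowNorm_pos (ρ g) y'
  have p4 := rowNorm_pos (ρ (γ⁻¹ * g)) x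
  have p5 := rowNorm_pos (ρ (γ⁻¹ * g)) y
  have p6 := rowNorm_pos (ρ (γ⁻¹ * g)) y'
  field_simp
  rw [e1, e2]
  ring

/-- The points reducing to a vertex. -/
def vertexPoints (p : ℕ) [Fact p.Prime] : Set (Hp p) := {z | ∃ g, z ∈ affinoidAt g}

theorem exists_vertexPoint (e : ℤ) (x : Hp p) : ∃ y ∈ vertexPoints p, SameCell e x y := by
  obtain ⟨η, hη, -⟩ := exists_mem_stdAffinoid (p := p) Set.finite_empty
  obtain ⟨g, hg⟩ := exists_mem_cell e x
  have h1 : g • η ∈ affinoidAt g := by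
    change (g⁻¹ • g • η).1 ∈ stdAffinoid p
    rwa [inv_smul_smul]
  refine ⟨g • η, ⟨g, h1⟩, ?_⟩
  rcases hg with ⟨hg, hx⟩ | ⟨hg, hx⟩
  · exact sameCell_of_mem_wideOpenAt hg hx (affinoidAt_subset_wideOpenAt g h1)
  · exact sameCell_of_mem_affinoidAt hx h1

theorem smul_mem_vertexPoints (g : GL (Fin 2) ℚ_[p]) {z : Hp p} (hz : z ∈ vertexPoints p) :
    g • z ∈ vertexPoints p := by
  obtain ⟨h, hh⟩ := hz
  refine ⟨g * h, ?_⟩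
  rwa [smul_mem_affinoidAt, inv_mul_cancel_left]

/-- The only vertex in the star formed by `L` and its open edges is `L` itself. -/
theorem mem_affinoidAt_of_wideOpenAt {e : ℤ} {g : GL (Fin 2) ℚ_[p]} (hg : par e g) {x y : Hp p}
    (hx : x ∈ wideOpenAt g) (h : SameCell e x y) (hy : y ∈ vertexPoints p) : y ∈ affinoidAt g := by
  obtain ⟨k, hk⟩ := hy
  exact (sameVertex_of_mem_affinoidAt (((h g).1 hg).1 hx) hk).affinoidAt.1 hk

theorem mem_affinoidAt_of_affinoidAt {e : ℤ} {g : GL (Fin 2) ℚ_[p]} {x y : Hp p}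
    (hx : x ∈ affinoidAt g) (h : SameCell e x y) (hy : y ∈ vertexPoints p) : y ∈ affinoidAt g := by
  by_cases hg : par e g
  · exact mem_affinoidAt_of_wideOpenAt hg (affinoidAt_subset_wideOpenAt g hx) h hy
  · exact ((h g).2 hg).1 hx

theorem exists_rowNorm_eq {k : GL (Fin 2) ℚ_[p]} {x : Hp p} (hx : x ∈ affinoidAt k) :
    ∃ C > 0, ∀ g : GL (Fin 2) ℚ_[p], rowNorm g x = C * mnorm (g * k).1 := by
  obtain ⟨C, hC, h⟩ := (mem_affinoidAt_iff k x).1 hx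
  refine ⟨C, hC, fun g => ?_⟩
  rw [rowNorm, h, h, Units.val_mul, mnorm_eq_lam, mul_max_of_nonneg _ _ hC.le]

/-- `r` is the geometric mean of `q` and `q / p`. Since `V` is not strictly between `U q / p` and `U
q`, the same argument attains all three maxima. -/
theorem max_sq_eq_mul_max {U V q r : ℝ} (hU : 0 ≤ U) (hq : 0 < q) (hr : 0 < r)
    (hrq : r ^ 2 = q * (q * (p : ℝ)⁻¹)) (hUV : V < U * q → V ≤ U * (q * (p : ℝ)⁻¹)) :
    max (U * r) V ^ 2 = max (U * q) V * max (U * (q * (p : ℝ)⁻¹)) V := by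
  have hp := one_lt_cast_prime (p := p)
  have hp0 := cast_prime_pos (p := p)
  have hpi : (p : ℝ)⁻¹ < 1 := inv_lt_one_of_one_lt₀ hp
  have hpi0 : 0 < (p : ℝ)⁻¹ := inv_pos.2 hp0
  have h1 : q * (p : ℝ)⁻¹ < q := mul_lt_of_lt_one_right hq hpi
  have h2 : r < q := by nlinarith
  have h3 : q * (p : ℝ)⁻¹ < r := by
    by_contra! h
    nlinarith [mul_pos hq hpi0]
  rcases lt_or_ge V (U * q) with h | h
  · have h4 := hUV h
    rw [max_eq_left h.le, max_eq_left h4, max_eq_left (h4.trans (by gcongr))]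
    rw [mul_pow, hrq]; ring
  · rw [max_eq_right h, max_eq_right (le_trans (by gcongr) h), max_eq_right (le_trans (by gcongr) h),
      sq]

theorem eq_zero_or_zpow (x y : ℚ_[p]) : max ‖x‖ ‖y‖ = 0 ∨ ∃ n : ℤ, max ‖x‖ ‖y‖ = (p : ℝ) ^ n := by
  have key : ∀ x : ℚ_[p], ‖x‖ = 0 ∨ ∃ n : ℤ, ‖x‖ = (p : ℝ) ^ n := by
    intro x
    by_cases h : x = 0
    · simp [h]
    · exact Or.inr (exists_norm_eq_zpow h)
  rcases max_choice ‖x‖ ‖y‖ with h | h <;> rw [h] <;> exact key _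

/-- By `hx` the point `x` reduces to a vertex or to the midpoint of an edge. In the first case `y`
and `y'` reduce to the same vertex, and all three row norms are proportional. In the second they
reduce to the two ends, whose norms differ from that of `x` by a factor `p ^ (± 1/2)` on one axis of
a common basis. -/
theorem exists_rowNorm_sq_eq {x y y' : Hp p}
    (hx : ∀ c : ℚ_[p], ∃ k : ℤ, ‖x.1 - emb c‖ ^ 2 = (p : ℝ) ^ k)
    (hy : y ∈ vertexPoints p) (hy' : y' ∈ vertexPoints p) (h : SameCell 0 x y)
    (h' : SameCell 1 x y') :
    ∃ C > 0, ∀ g : GL (Fin 2) ℚ_[p], rowNorm g x ^ 2 = C * (rowNorm g y * rowNorm g y') := by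
  have hp0 := cast_prime_pos (p := p)
  obtain ⟨c, hr, hc⟩ := x.exists_center
  obtain ⟨n, h1, h2⟩ := exists_zpow_le (p := p) hr
  rcases h2.eq_or_lt with h2 | h2
  · have hA := mem_affinoidAt_upperGL hc h2
    obtain ⟨C, hC, e⟩ := exists_rowNorm_eq hA
    obtain ⟨C₁, hC₁, e₁⟩ := exists_rowNorm_eq (mem_affinoidAt_of_affinoidAt hA h hy)
    obtain ⟨C₂, hC₂, e₂⟩ := exists_rowNorm_eq (mem_affinoidAt_of_affinoidAt hA h' hy')
    refine ⟨C ^ 2 / (C₁ * C₂), by positivity, fun g => ?_⟩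
    rw [e, e₁, e₂]
    field_simp
  · have hmono : (p : ℝ) ^ (-n) < (p : ℝ) ^ (-n + 1) :=
      zpow_lt_zpow_right₀ one_lt_cast_prime (by omega)
    have hmono' : (p : ℝ) ^ (-n - 2) < (p : ℝ) ^ (-n - 1) :=
      zpow_lt_zpow_right₀ one_lt_cast_prime (by omega)
    have hW0 : x ∈ wideOpenAt (upperGL n c) := mem_wideOpenAt_upperGL hc h1 (h2.trans hmono)
    have hW1 : x ∈ wideOpenAt (upperGL (n + 1) c) :=
      mem_wideOpenAt_upperGL hc (by rw [neg_add, ← sub_eq_add_neg, sub_sub]; exact hmono'.trans h1)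
        (by rwa [neg_add, neg_add_cancel_right])
    -- The square is a power of `p` strictly between `p ^ (-2n - 2)` and `p ^ (-2n)`, hence equal to
    -- `p ^ (-2n - 1)`: the midpoint.
    have hrq : ‖x.1 - emb c‖ ^ 2 = (p : ℝ) ^ (-n) * ((p : ℝ) ^ (-n) * (p : ℝ)⁻¹) := by
      obtain ⟨k, hk⟩ := hx c
      have hk1 : (p : ℝ) ^ ((-n - 1) * (2 : ℕ)) < (p : ℝ) ^ k := by
        rw [← hk, zpow_mul, zpow_natCast]; gcongr
      have hk2 : (p : ℝ) ^ k < (p : ℝ) ^ ((-n) * (2 : ℕ)) := by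
        rw [← hk, zpow_mul, zpow_natCast]; gcongr
      rw [zpow_lt_zpow_iff_right₀ one_lt_cast_prime] at hk1 hk2
      rw [hk, ← zpow_sub_one₀ hp0.ne', ← zpow_add₀ hp0.ne']
      congr 1
      push_cast at hk1 hk2
      omega
    have key : ∀ g : GL (Fin 2) ℚ_[p], rowNorm g x ^ 2 =
        mnorm (g * upperGL n c).1 * mnorm (g * upperGL (n + 1) c).1 := by
      intro g
      set U := max ‖g.1 0 0‖ ‖g.1 1 0‖ with hU
      set V := max ‖g.1 0 0 * c + g.1 0 1‖ ‖g.1 1 0 * c + g.1 1 1‖ with hV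
      have e0 : ∀ t : ℝ, 0 ≤ t → max (max (‖g.1 0 0‖ * t) ‖g.1 0 0 * c + g.1 0 1‖)
          (max (‖g.1 1 0‖ * t) ‖g.1 1 0 * c + g.1 1 1‖) = max (U * t) V := by
        intro t ht
        rw [max_max_max_comm, hU, max_mul_of_nonneg _ _ ht]
      have e1 : rowNorm g x = max (U * ‖x.1 - emb c‖) V := by
        rw [rowNorm, hc, hc, e0 _ (norm_nonneg _)]
      have e2 : ∀ m : ℤ, mnorm (g * upperGL m c).1 = max (U * (p : ℝ) ^ (-m)) V := by
        intro m
        rw [Units.val_mul, mnorm_eq_lam, lam_upperGL, lam_upperGL, e0 _ (by positivity)]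
      rw [e1, e2, e2, neg_add, ← sub_eq_add_neg, zpow_sub_one₀ hp0.ne']
      refine max_sq_eq_mul_max (by positivity) (by positivity) hr hrq ?_
      intro hlt
      rcases eq_zero_or_zpow (g.1 0 0 * c + g.1 0 1) (g.1 1 0 * c + g.1 1 1) with hV0 | ⟨b, hb⟩
      · rw [hV, hV0]; positivity
      rcases eq_zero_or_zpow (g.1 0 0) (g.1 1 0) with hU0 | ⟨a, ha⟩
      · rw [hU, hU0, zero_mul] at hlt
        exact absurd hlt (not_lt.2 (by positivity))
      rw [hU, hV, ha, hb] at hlt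
      rw [hU, hV, ha, hb]
      rw [← zpow_add₀ hp0.ne', zpow_lt_zpow_iff_right₀ one_lt_cast_prime] at hlt
      rw [← zpow_sub_one₀ hp0.ne', ← zpow_add₀ hp0.ne', zpow_le_zpow_iff_right₀ one_lt_cast_prime]
      omega
    -- The parity of `n` decides which end of the edge carries the even cell of `x`, hence `y`, and
    -- which carries `y'`.
    by_cases hpar : Even n
    · obtain ⟨C₁, hC₁, e₁⟩ := exists_rowNorm_eq (mem_affinoidAt_of_wideOpenAt
        (by rw [par_upperGL, add_zero]; exact hpar) hW0 h hy)
      obtain ⟨C₂, hC₂, e₂⟩ := exists_rowNorm_eq (mem_affinoidAt_of_wideOpenAt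
        (by rw [par_upperGL, add_assoc]; exact hpar.add (by decide)) hW1 h' hy')
      refine ⟨1 / (C₁ * C₂), by positivity, fun g => ?_⟩
      rw [key, e₁, e₂]
      field_simp
    · obtain ⟨C₁, hC₁, e₁⟩ := exists_rowNorm_eq (mem_affinoidAt_of_wideOpenAt
        (by rw [par_upperGL, add_zero, Int.even_add_one]; exact hpar) hW1 h hy)
      obtain ⟨C₂, hC₂, e₂⟩ := exists_rowNorm_eq (mem_affinoidAt_of_wideOpenAt
        (by rw [par_upperGL, Int.even_add_one]; exact hpar) hW0 h' hy')
      refine ⟨1 / (C₁ * C₂), by positivity, fun g => ?_⟩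
      rw [key, e₁, e₂]
      field_simp

end GenericPoints

/-! ### Automorphy factors as finite products of periods. -/

section AutomorphyFactors

variable {p : ℕ} [Fact p.Prime] {G : Type*} [Group G] {ρ : G →* GL (Fin 2) ℚ_[p]}

/-- The factor `[(γ η) - (η) ; δ 𝒟]`. -/
def symbolFactor (ρ : G →* GL (Fin 2) ℚ_[p]) (η : Hp p) (𝒟 : Divisor p) (γ δ : G) : ℂ_[p] :=
  weilSymbol (Finsupp.single (ρ γ • η).1 1 - Finsupp.single η.1 1)
    (𝒟.mapDomain fun z => (ρ δ • z).1)

theorem ratFun_single_sub_single {u v y : ℂ_[p]} (hu : y ≠ u) (hv : y ≠ v) :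
    ratFun (Finsupp.single u 1 - Finsupp.single v 1) y = (y - u) / (y - v) := by
  classical
  have h1 := sub_ne_zero.2 hu
  have h2 := sub_ne_zero.2 hv
  by_cases huv : u = v
  · subst huv
    rw [sub_self, div_self h1]
    exact Finsupp.prod_zero_index
  unfold ratFun
  rw [Finsupp.prod_of_support_subset _ (s := {u, v}) _ _ (fun _ _ => zpow_zero _)]
  · rw [Finset.prod_pair huv]
    simp [huv, Ne.symm huv, div_eq_mul_inv]
  · intro z hz
    by_contra h
    simp only [Finset.mem_insert, Finset.mem_singleton, not_or] at h
    simp [Ne.symm h.1, Ne.symm h.2] at hz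

theorem Adm.symm {a x : Hp p} (h : Adm ρ a x) : Adm ρ x a := by
  intro g hg
  refine h g⁻¹ ?_
  rw [← hg, ← mul_smul, ← map_mul, inv_mul_cancel, map_one, one_smul]

/-- In degree zero an auxiliary point `y` can be subtracted from every point of `𝒟` without changing
the symbol: the extra factor is `q y` to the power `deg 𝒟`. -/
theorem symbolFactor_eq {η : Hp p} {𝒟 : Divisor p} (hη : ∀ x ∈ 𝒟.support, Adm ρ η x)
    (hdeg : (𝒟.sum fun _ m => m) = 0) {y : Hp p} (hy : Adm ρ η y) (γ δ : G) :
    symbolFactor ρ η 𝒟 γ δ = 𝒟.prod fun x m => crossRatio (ρ γ • η) η x y (ρ δ) ^ m := by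
  have hinj : Function.Injective fun z : Hp p => (ρ δ • z).1 := fun z w h =>
    MulAction.injective (ρ δ) (Hp.ext h)
  set q : Hp p → ℂ_[p] := fun x => pairing (ρ δ) x (ρ γ • η) / pairing (ρ δ) x η
  have hq : ∀ x, Adm ρ η x → ((ρ δ • x).1 - (ρ γ • η).1) / ((ρ δ • x).1 - η.1) = q x := by
    intro x hx
    simp only [q, pairing_eq]
    rw [mul_div_mul_right _ _ (den_ne_zero _ _)]
  have hqy : q y ≠ 0 := div_ne_zero (pairing_ne_zero (hy.smul_left γ δ)) (pairing_ne_zero (hy δ))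
  have h1 : (𝒟.prod fun _ m => q y ^ m) = 1 := by
    have : ∀ s : Finset (Hp p), ∏ x ∈ s, q y ^ 𝒟 x = q y ^ (∑ x ∈ s, 𝒟 x) := by
      classical
      intro s
      induction s using Finset.induction_on with
      | empty => simp
      | insert a s ha ih => rw [Finset.prod_insert ha, Finset.sum_insert ha, zpow_add₀ hqy, ih]
    rw [Finsupp.prod, this]
    rw [Finsupp.sum] at hdeg
    rw [hdeg, zpow_zero]
  unfold symbolFactor weilSymbol
  rw [Finsupp.prod_mapDomain_index_inj hinj]
  rw [← mul_one (𝒟.prod fun x m => crossRatio _ _ _ _ _ ^ m), ← h1, ← Finsupp.prod_mul]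
  refine Finsupp.prod_congr fun x hx => ?_
  have hx1 : (ρ δ • x).1 ≠ (ρ γ • η).1 := fun h => (hη x hx).smul_left γ δ (Hp.ext h)
  have hx2 : (ρ δ • x).1 ≠ η.1 := fun h => hη x hx δ (Hp.ext h)
  rw [ratFun_single_sub_single hx1 hx2, hq x (hη x hx), ← mul_zpow]
  congr 1
  have e1 := pairing_ne_zero (hy.smul_left γ δ)
  have e2 := pairing_ne_zero (hy δ)
  have e3 := pairing_ne_zero (hη x hx δ)
  simp only [q, crossRatio]
  field_simp

theorem StrongDegZeroPar.sum_eq_zero {e : ℤ} {b : Hp p → Hp p} (hb : IsCellSection ρ e b)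
    {𝒟 : Divisor p} (h : StrongDegZeroPar e 𝒟) : (𝒟.sum fun _ m => m) = 0 := by
  have h1 := Finsupp.sum_mapDomain_index (f := b) (s := 𝒟) (h := fun _ m => m)
    (fun _ => rfl) (fun _ _ _ => rfl)
  rw [← h1, h.mapDomain_eq_zero hb, Finsupp.sum_zero_index]

/-- The product that computes the automorphy factor of a divisor of strong degree zero. -/
def periodProd (ρ : G →* GL (Fin 2) ℚ_[p]) (b : Hp p → Hp p) (𝒟 : Divisor p) (γ : G) : ℂ_[p] :=
  𝒟.prod fun x m => period ρ γ x (b x) ^ m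

/-- The product over the group is a product of periods of `(x, y)` for an auxiliary `y`; dividing by
the trivial product of the periods of `(b x, y)` removes `y`. -/
theorem IsDiscreteRep.hasProd_symbolFactor (hρ : IsDiscreteRep ρ) {e : ℤ} {b : Hp p → Hp p}
    (hb : IsCellSection ρ e b) {𝒟 : Divisor p} (h : StrongDegZeroPar e 𝒟) {η : Hp p}
    (hη : ∀ x ∈ 𝒟.support, Adm ρ η x) (γ : G) :
    HasProd (symbolFactor ρ η 𝒟 γ) (periodProd ρ b 𝒟 γ) := by
  obtain ⟨c, hc⟩ := hρ.exists_adm η (Z := {η}) (by simp)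
  set y := upperGL 0 c • η
  have hy : Adm ρ η y := (hc η rfl).symm
  have h1 : periodProd ρ b 𝒟 γ = 𝒟.prod fun x m => period ρ γ x y ^ m := by
    -- This product only sees `b_* 𝒟 = 0`.
    have h2 : (𝒟.prod fun x m => period ρ γ (b x) y ^ m) = 1 := by
      have := Finsupp.prod_mapDomain_index (f := b) (s := 𝒟) (h := fun x m => period ρ γ x y ^ m)
        (fun _ => zpow_zero _) (fun x _ _ => zpow_add₀ (hρ.period_ne_zero γ x y) _ _)
      rw [← this, h.mapDomain_eq_zero hb, Finsupp.prod_zero_index]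
    rw [periodProd, ← mul_one (𝒟.prod _), ← h2, ← Finsupp.prod_mul]
    refine Finsupp.prod_congr fun x _ => ?_
    rw [← mul_zpow, hρ.period_mul_right]
  rw [h1]
  have h3 : symbolFactor ρ η 𝒟 γ = fun δ => ∏ x ∈ 𝒟.support,
      crossRatio (ρ γ • η) η x y (ρ δ) ^ 𝒟 x :=
    funext fun δ => symbolFactor_eq hη (h.sum_eq_zero hb) hy γ δ
  rw [h3]
  refine hasProd_prod fun x hx => ?_
  have := hρ.hasProd_theta (hη x hx) (hy.smul_left γ)
  rw [← hρ.period_eq γ (hη x hx) hy] at this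
  exact hasProd_zpow_of_ne_zero this (hρ.period_ne_zero γ x y) _

theorem IsDiscreteRep.periodProd_mul (hρ : IsDiscreteRep ρ) (b : Hp p → Hp p) (𝒟 : Divisor p)
    (γ γ' : G) : periodProd ρ b 𝒟 (γ * γ') = periodProd ρ b 𝒟 γ * periodProd ρ b 𝒟 γ' := by
  rw [periodProd, periodProd, periodProd, ← Finsupp.prod_mul]
  refine Finsupp.prod_congr fun x _ => ?_
  rw [← mul_zpow, hρ.period_mul]

/-- The map `proj` is a quotient map for the action of `G` on `ℋ_p`. -/
structure IsOrbitMap (ρ : G →* GL (Fin 2) ℚ_[p]) {M : Type*} (proj : Hp p → M) : Prop where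
  surjective : Function.Surjective proj
  lift : ∀ f : Hp p → ℂ_[p], (∀ γ x, f (ρ γ • x) = f x) → ∃ F : M → ℂ_[p], ∀ x, F (proj x) = f x

theorem IsOrbitMap.exists_lift {M : Type*} {proj : Hp p → M} (h : IsOrbitMap ρ proj)
    {f : Hp p → ℂ_[p]} (hf : ∀ γ x, f (ρ γ • x) = f x) (hf0 : ∀ x, f x ≠ 0) :
    ∃ F : M → ℂ_[p], (∀ x, F (proj x) = f x) ∧ ∀ 𝒟 : Divisor p,
      (𝒟.prod fun x m => f x ^ m) = (𝒟.mapDomain proj).prod fun c m => F c ^ m := by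
  obtain ⟨F, hF⟩ := h.lift f hf
  have hF0 : ∀ c, F c ≠ 0 := fun c => by
    obtain ⟨x, rfl⟩ := h.surjective c
    rw [hF]; exact hf0 x
  refine ⟨F, hF, fun 𝒟 => ?_⟩
  rw [Finsupp.prod_mapDomain_index (fun _ => zpow_zero _) (fun c _ _ => zpow_add₀ (hF0 c) _ _)]
  simp only [hF]

theorem IsDiscreteRep.period_section_smul (hρ : IsDiscreteRep ρ) {e : ℤ} {b : Hp p → Hp p}
    (hb : IsCellSection ρ e b) (γ α : G) (x : Hp p) :
    period ρ γ (ρ α • x) (b (ρ α • x)) = period ρ γ x (b x) := by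
  rw [hb.smul, hρ.period_smul]

/-- Both products are computed on the common image in the quotient, where the factors for `b` and
`b'` are paired point by point. Only points in the support of the image matter, although the lifts
may contain others that cancel. -/
theorem IsDiscreteRep.norm_periodProd_mul (hρ : IsDiscreteRep ρ) {M : Type*} {proj : Hp p → M}
    (hproj : IsOrbitMap ρ proj) {b b' : Hp p → Hp p}
    (hb : IsCellSection ρ 0 b) (hb' : IsCellSection ρ 1 b')
    (hbv : ∀ x, b x ∈ vertexPoints p) (hbv' : ∀ x, b' x ∈ vertexPoints p) {𝒟 𝒟' : Divisor p}
    (h𝒟 : 𝒟.mapDomain proj = 𝒟'.mapDomain proj)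
    (hsupp : ∀ c ∈ (𝒟.mapDomain proj).support, ∃ x, proj x = c ∧
      ∀ c : ℚ_[p], ∃ k : ℤ, ‖x.1 - emb c‖ ^ 2 = (p : ℝ) ^ k) (γ : G) :
    ‖periodProd ρ b 𝒟 γ * periodProd ρ b' 𝒟' γ‖ = 1 := by
  obtain ⟨F, hF, h1⟩ := hproj.exists_lift (f := fun x => period ρ γ x (b x)) (hρ.period_section_smul hb γ)
    (fun x => hρ.period_ne_zero γ _ _)
  obtain ⟨F', hF', h1'⟩ := hproj.exists_lift (f := fun x => period ρ γ x (b' x)) (hρ.period_section_smul hb' γ)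
    (fun x => hρ.period_ne_zero γ _ _)
  rw [periodProd, periodProd, h1, h1', ← h𝒟, ← Finsupp.prod_mul, Finsupp.prod, norm_prod]
  refine Finset.prod_eq_one fun c hc => ?_
  obtain ⟨x, rfl, hx⟩ := hsupp c hc
  rw [← mul_zpow, norm_zpow, hF, hF', hρ.norm_period_mul γ (exists_rowNorm_sq_eq hx (hbv x) (hbv' x)
    (hb.sameCell x) (hb'.sameCell x)), one_zpow]

end AutomorphyFactors

/-! ### Galois action on periods and descent to `ℚ_p`. -/

section GaloisDescent

variable {p : ℕ} [Fact p.Prime] {G : Type*} [Group G] {ρ : G →* GL (Fin 2) ℚ_[p]}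
  {K : IntermediateField ℚ_[p] ℂ_[p]}

theorem emb_mem (K : IntermediateField ℚ_[p] ℂ_[p]) (x : ℚ_[p]) : emb x ∈ K := K.algebraMap_mem x

/-- The points of `ℋ_p` with coordinate in `K`. -/
def fieldPoints (K : IntermediateField ℚ_[p] ℂ_[p]) : Set (Hp p) := {z | z.1 ∈ K}

theorem smul_mem_fieldPoints (g : GL (Fin 2) ℚ_[p]) {z : Hp p} (h : z ∈ fieldPoints K) :
    g • z ∈ fieldPoints K := by
  change (g • z).1 ∈ K
  rw [Hp.smul_val]
  exact K.div_mem (K.add_mem (K.mul_mem (emb_mem K _) h) (emb_mem K _))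
    (K.add_mem (K.mul_mem (emb_mem K _) h) (emb_mem K _))

open Classical in
/-- The action of an automorphism of `K` on the `K`-points of `ℋ_p`, extended by the identity. -/
def galAct (σ : K ≃ₐ[ℚ_[p]] K) (z : Hp p) : Hp p :=
  if h : z ∈ fieldPoints K then ⟨σ ⟨z.1, h⟩, by
    rintro ⟨t, ht⟩
    refine z.2 ⟨t, ?_⟩
    have h1 : σ ⟨z.1, h⟩ = algebraMap ℚ_[p] K t := Subtype.ext ht.symm
    rw [← σ.commutes t] at h1
    exact (congrArg Subtype.val (σ.injective h1)).symm⟩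
  else z

theorem galAct_val (σ : K ≃ₐ[ℚ_[p]] K) {z : Hp p} (h : z ∈ fieldPoints K) :
    (galAct σ z).1 = σ ⟨z.1, h⟩ := by
  exact congrArg Subtype.val (dif_pos h)

theorem galAct_of_notMem (σ : K ≃ₐ[ℚ_[p]] K) {z : Hp p} (h : z ∉ fieldPoints K) :
    galAct σ z = z := by
  exact dif_neg h

theorem galAct_mem (σ : K ≃ₐ[ℚ_[p]] K) {z : Hp p} (h : z ∈ fieldPoints K) :
    galAct σ z ∈ fieldPoints K := by
  change (galAct σ z).1 ∈ K
  rw [galAct_val σ h]; exact Subtype.property _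

theorem galAct_symm (σ : K ≃ₐ[ℚ_[p]] K) (z : Hp p) : galAct σ.symm (galAct σ z) = z := by
  by_cases h : z ∈ fieldPoints K
  · apply Hp.ext
    rw [galAct_val σ.symm (galAct_mem σ h)]
    have h1 : (⟨(galAct σ z).1, galAct_mem σ h⟩ : K) = σ ⟨z.1, h⟩ := Subtype.ext (galAct_val σ h)
    rw [h1, AlgEquiv.symm_apply_apply]
  · rw [galAct_of_notMem σ h, galAct_of_notMem σ.symm h]

theorem galAct_injective (σ : K ≃ₐ[ℚ_[p]] K) : Function.Injective (galAct σ) :=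
  Function.LeftInverse.injective (galAct_symm σ)

theorem galAct_smul (σ : K ≃ₐ[ℚ_[p]] K) (g : GL (Fin 2) ℚ_[p]) (z : Hp p) :
    galAct σ (g • z) = g • galAct σ z := by
  by_cases h : z ∈ fieldPoints K
  · apply Hp.ext
    have h1 : (⟨(g • z).1, smul_mem_fieldPoints g h⟩ : K) =
        (algebraMap ℚ_[p] K (g.1 0 0) * ⟨z.1, h⟩ + algebraMap ℚ_[p] K (g.1 0 1)) /
        (algebraMap ℚ_[p] K (g.1 1 0) * ⟨z.1, h⟩ + algebraMap ℚ_[p] K (g.1 1 1)) := Subtype.ext rfl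
    rw [galAct_val σ (smul_mem_fieldPoints g h), h1, Hp.smul_val, galAct_val σ h]
    simp only [map_div₀, map_add, map_mul, AlgEquiv.commutes]
    rfl
  · have h' : g • z ∉ fieldPoints K := fun h' => h (by
      have := smul_mem_fieldPoints g⁻¹ h'
      rwa [inv_smul_smul] at this)
    rw [galAct_of_notMem σ h, galAct_of_notMem σ h']

theorem Adm.galAct {a x : Hp p} (h : Adm ρ a x) (σ : K ≃ₐ[ℚ_[p]] K) :
    Adm ρ (galAct σ a) (galAct σ x) := by
  intro g hg
  rw [← galAct_smul] at hg
  exact h g (galAct_injective σ hg)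

/-- `pairing` with values in `K`. -/
def pairingIn (g : GL (Fin 2) ℚ_[p]) (x a : K) : K :=
  (algebraMap ℚ_[p] K (g.1 0 0) * x + algebraMap ℚ_[p] K (g.1 0 1)) -
    a * (algebraMap ℚ_[p] K (g.1 1 0) * x + algebraMap ℚ_[p] K (g.1 1 1))

theorem pairingIn_galAct (σ : K ≃ₐ[ℚ_[p]] K) (g : GL (Fin 2) ℚ_[p]) {x a : Hp p}
    (hx : x.1 ∈ K) (ha : a.1 ∈ K) :
    ((σ (pairingIn g ⟨x.1, hx⟩ ⟨a.1, ha⟩) : K) : ℂ_[p]) = pairing g (galAct σ x) (galAct σ a) := by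
  unfold pairingIn pairing
  rw [galAct_val σ hx, galAct_val σ ha]
  simp only [map_sub, map_add, map_mul, AlgEquiv.commutes]
  rfl

variable [FiniteDimensional ℚ_[p] K]

theorem continuous_algEquiv (σ : K ≃ₐ[ℚ_[p]] K) : Continuous σ :=
  LinearMap.continuous_of_finiteDimensional σ.toLinearMap

/-- Automorphisms of finite extensions of `ℚ_p` are isometries. -/
theorem norm_algEquiv (σ : K ≃ₐ[ℚ_[p]] K) (x : K) : ‖σ x‖ = ‖x‖ := by
  have key : ∀ (σ : K ≃ₐ[ℚ_[p]] K) (x : K), ‖σ x‖ ≤ ‖x‖ := by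
    intro σ x
    set L := LinearMap.toContinuousLinearMap σ.toLinearMap
    -- A bounded multiplicative map is contracting: apply the operator bound to `x ^ n` and let `n`
    -- grow.
    have h1 : ∀ n : ℕ, ‖σ x‖ ^ n ≤ ‖L‖ * ‖x‖ ^ n := by
      intro n
      rw [← norm_pow, ← norm_pow, ← map_pow]
      exact L.le_opNorm (x ^ n)
    by_contra! hlt
    rcases eq_or_ne x 0 with rfl | hx
    · simp at hlt
    have hx' : 0 < ‖x‖ := norm_pos_iff.2 hx
    have h2 : 1 < ‖σ x‖ / ‖x‖ := (one_lt_div hx').2 hlt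
    obtain ⟨n, hn⟩ := pow_unbounded_of_one_lt ‖L‖ h2
    rw [div_pow, lt_div_iff₀ (by positivity)] at hn
    exact absurd (h1 n) (not_le.2 hn)
  refine le_antisymm (key σ x) ?_
  simpa using key σ.symm (σ x)

theorem isClosed_intermediateField : IsClosed (K : Set ℂ_[p]) :=
  Submodule.closed_of_finiteDimensional (Subalgebra.toSubmodule K.toSubalgebra)

theorem nu_galAct (σ : K ≃ₐ[ℚ_[p]] K) (z : Hp p) (u v : ℚ_[p]) :
    nu z.1 u v = nu (galAct σ z).1 u v := by
  by_cases h : z ∈ fieldPoints K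
  · rw [galAct_val σ h]
    have h1 := norm_algEquiv σ (algebraMap ℚ_[p] K u * ⟨z.1, h⟩ + algebraMap ℚ_[p] K v)
    rw [map_add, map_mul, AlgEquiv.commutes, AlgEquiv.commutes] at h1
    exact h1.symm
  · rw [galAct_of_notMem σ h]

theorem sameCell_galAct (e : ℤ) (σ : K ≃ₐ[ℚ_[p]] K) (z : Hp p) : SameCell e z (galAct σ z) :=
  sameCell_of_nu_eq e (nu_galAct σ z)

/-- `K` is closed in `ℂ_p` and `σ` is continuous, so the infinite product lies in `K` and `σ` may be
applied factor by factor; `σ` fixes the entries of `ρ g`. -/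
theorem theta_galAct (hρ : IsDiscreteRep ρ) {a b x y : Hp p} (ha : a ∈ fieldPoints K)
    (hb : b ∈ fieldPoints K) (hx : x ∈ fieldPoints K) (hy : y ∈ fieldPoints K) (hbx : Adm ρ b x)
    (hay : Adm ρ a y) : ∃ t : K, (t : ℂ_[p]) = theta ρ a b x y ∧ ∀ σ : K ≃ₐ[ℚ_[p]] K,
      ((σ t : K) : ℂ_[p]) = theta ρ (galAct σ a) (galAct σ b) (galAct σ x) (galAct σ y) := by
  set f : G → K := fun g => (pairingIn (ρ g) ⟨x.1, hx⟩ ⟨a.1, ha⟩ * pairingIn (ρ g) ⟨y.1, hy⟩ ⟨b.1, hb⟩) /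
    (pairingIn (ρ g) ⟨x.1, hx⟩ ⟨b.1, hb⟩ * pairingIn (ρ g) ⟨y.1, hy⟩ ⟨a.1, ha⟩) with hf
  have h1 := hρ.hasProd_theta hbx hay
  have h2 : ∀ g, crossRatio a b x y (ρ g) = K.val (f g) := fun g => rfl
  simp only [h2] at h1
  have hmem : theta ρ a b x y ∈ K := by
    refine isClosed_intermediateField.mem_of_tendsto h1 (Eventually.of_forall fun s => ?_)
    rw [← map_prod]
    exact Subtype.property _
  have h3 : HasProd f ⟨theta ρ a b x y, hmem⟩ := by
    have hind : Topology.IsInducing K.val := Topology.IsInducing.subtypeVal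
    rw [← hind.hasProd_iff]
    exact h1
  refine ⟨⟨theta ρ a b x y, hmem⟩, rfl, fun σ => ?_⟩
  have h4 := (h3.map σ (continuous_algEquiv σ)).map K.val continuous_subtype_val
  refine h4.unique ?_
  have h5 : (K.val ∘ σ ∘ f) = fun g => crossRatio (galAct σ a) (galAct σ b) (galAct σ x) (galAct σ y) (ρ g) := by
    funext g
    unfold crossRatio
    rw [← pairingIn_galAct σ _ hx ha, ← pairingIn_galAct σ _ hy hb, ← pairingIn_galAct σ _ hx hb,
      ← pairingIn_galAct σ _ hy ha]
    simp only [Function.comp_apply, hf, map_div₀, map_mul]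
    rfl
  rw [h5]
  exact hρ.hasProd_theta (hbx.galAct σ) (hay.galAct σ)

theorem period_galAct (hρ : IsDiscreteRep ρ) (γ : G) {x y : Hp p} (hx : x ∈ fieldPoints K)
    (hy : y ∈ fieldPoints K) : ∃ t : K, (t : ℂ_[p]) = period ρ γ x y ∧ ∀ σ : K ≃ₐ[ℚ_[p]] K,
      ((σ t : K) : ℂ_[p]) = period ρ γ (galAct σ x) (galAct σ y) := by
  obtain ⟨c, hc⟩ := hρ.exists_adm x (Z := {x, y}) (by simp)
  set η := upperGL 0 c • x
  have h1 : Adm ρ η x := hc x (by simp)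
  have h2 : Adm ρ η y := hc y (by simp)
  have hη : η ∈ fieldPoints K := smul_mem_fieldPoints _ hx
  obtain ⟨t, ht, h⟩ := theta_galAct hρ (smul_mem_fieldPoints (ρ γ) hη) hη hx hy h1 (h2.smul_left γ)
  refine ⟨t, by rw [ht, hρ.period_eq γ h1 h2], fun σ => ?_⟩
  rw [h, hρ.period_eq γ (h1.galAct σ) (h2.galAct σ), galAct_smul]

/-- Galois descent for the automorphy factors. -/
theorem periodProd_mem_range [IsGalois ℚ_[p] K] (hρ : IsDiscreteRep ρ) {M : Type*} {proj : Hp p → M}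
    (hproj : IsOrbitMap ρ proj) {e : ℤ} {b : Hp p → Hp p} (hb : IsCellSection ρ e b)
    (hbK : ∀ x ∈ fieldPoints K, b x ∈ fieldPoints K) {𝒟 : Divisor p} (h𝒟 : StrongDegZeroPar e 𝒟)
    (hsupp : ∀ c ∈ (𝒟.mapDomain proj).support, ∃ x ∈ fieldPoints K, proj x = c)
    (τ : (K ≃ₐ[ℚ_[p]] K) → M ≃ M) (hτ : ∀ σ x, τ σ (proj x) = proj (galAct σ x))
    (hinv : ∀ σ c, 𝒟.mapDomain proj (τ σ c) = 𝒟.mapDomain proj c) (γ : G) :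
    ∃ t : ℚ_[p], emb t = periodProd ρ b 𝒟 γ := by
  set E := 𝒟.mapDomain proj with hE
  obtain ⟨F, hF, h1⟩ := hproj.exists_lift (f := fun x => period ρ γ x (b x)) (hρ.period_section_smul hb γ)
    (fun x => hρ.period_ne_zero γ _ _)
  -- The section need not commute with `σ`. The discrepancy, the periods of `(b x, σ (b x))`,
  -- depends only on `b x`, so its total product is trivial because `b_* 𝒟 = 0`.
  have hU : ∀ σ : K ≃ₐ[ℚ_[p]] K, ∃ FU : M → ℂ_[p],
      (∀ x, FU (proj x) = period ρ γ (b x) (galAct σ (b x))) ∧ (E.prod fun c m => FU c ^ m) = 1 := by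
    intro σ
    obtain ⟨FU, hFU, h2⟩ := hproj.exists_lift (f := fun x => period ρ γ (b x) (galAct σ (b x)))
      (fun α x => by rw [hb.smul, galAct_smul, hρ.period_smul]) (fun x => hρ.period_ne_zero γ _ _)
    refine ⟨FU, hFU, ?_⟩
    rw [hE, ← h2]
    have h3 := Finsupp.prod_mapDomain_index (f := b) (s := 𝒟)
      (h := fun x m => period ρ γ x (galAct σ x) ^ m)
      (fun _ => zpow_zero _) (fun x _ _ => zpow_add₀ (hρ.period_ne_zero γ x _) _ _)
    rw [← h3, h𝒟.mapDomain_eq_zero hb, Finsupp.prod_zero_index]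
  choose FU hFU hFU1 using hU
  have hT : ∀ c, ∃ t : K, c ∈ E.support → (t : ℂ_[p]) = F c ∧ ∀ σ : K ≃ₐ[ℚ_[p]] K,
      ((σ t : K) : ℂ_[p]) = F (τ σ c) * FU σ c := by
    intro c
    by_cases hc : c ∈ E.support
    swap
    · exact ⟨0, fun h => absurd h hc⟩
    obtain ⟨x, hx, rfl⟩ := hsupp c hc
    obtain ⟨t, ht, h2⟩ := period_galAct hρ γ hx (hbK x hx)
    refine ⟨t, fun _ => ⟨by rw [ht, hF], fun σ => ?_⟩⟩
    -- As `σ` preserves cells, `b (σ x) = b x`, and the period of `(σ x, σ (b x))` splits at this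
    -- point.
    rw [h2, hτ, hF, hFU, ← hb.congr (sameCell_galAct e σ x), hρ.period_mul_right]
  choose t ht using hT
  set J : K := ∏ c ∈ E.support, t c ^ E c with hJ
  have hJ1 : (J : ℂ_[p]) = periodProd ρ b 𝒟 γ := by
    change K.val J = _
    rw [periodProd, h1, hJ, map_prod, Finsupp.prod]
    refine Finset.prod_congr rfl fun c hc => ?_
    rw [map_zpow₀, ← (ht c hc).1]
    rfl
  have hJσ : ∀ σ : K ≃ₐ[ℚ_[p]] K, σ J = J := by
    intro σ
    apply Subtype.ext
    rw [hJ1, periodProd, h1]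
    change K.val (σ J) = _
    rw [hJ, map_prod, map_prod]
    have h4 : ∀ c ∈ E.support, K.val (σ (t c ^ E c)) = F (τ σ c) ^ E c * FU σ c ^ E c := by
      intro c hc
      rw [map_zpow₀, map_zpow₀, ← mul_zpow, ← (ht c hc).2 σ]
      rfl
    rw [Finset.prod_congr rfl h4, Finset.prod_mul_distrib]
    have h5 : ∏ c ∈ E.support, FU σ c ^ E c = 1 := hFU1 σ
    rw [h5, mul_one]
    have h6 : E.mapDomain (τ σ) = E := by
      ext c
      rw [Finsupp.mapDomain_equiv_apply, ← hinv σ, Equiv.apply_symm_apply]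
    conv_rhs => rw [← hE, ← h6]
    rw [Finsupp.prod_mapDomain_index_inj (τ σ).injective]
    rfl
  obtain ⟨q, hq⟩ := IntermediateField.mem_bot.1 ((IsGalois.mem_bot_iff_fixed J).2 hJσ)
  refine ⟨q, ?_⟩
  rw [← hJ1, ← hq]
  rfl

end GaloisDescent

/-! ### Reduced norm and trace under a splitting. -/

section QuaternionBasics

variable {a b : ℚ}

theorem nrd_eq {K : Type*} [CommRing K] {a b : K} (x : ℍ[K,a,b]) :
    nrd x = x.re * x.re - a * (x.imI * x.imI) - b * (x.imJ * x.imJ) +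
      a * b * (x.imK * x.imK) := by
  simp [nrd]
  ring

/-- `toField` as a monoid homomorphism. -/
def toFieldHom (K : Type*) [Field K] [CharZero K] (a b : ℚ) :
    ℍ[ℚ,a,b] →* ℍ[K,(a : K),(b : K)] where
  toFun := toField K
  map_one' := by ext <;> simp [toField]
  map_mul' x y := by ext <;> simp [toField]

theorem nrd_toField {K : Type*} [Field K] [CharZero K] (x : ℍ[ℚ,a,b]) :
    nrd (toField K x) = ((nrd x : ℚ) : K) := by
  simp only [nrd_eq, toField]
  push_cast
  ring

theorem qform_eq (v : Fin 3 → ℚ) :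
    qform a b v = -a * (v 0 * v 0) - b * (v 1 * v 1) + a * b * (v 2 * v 2) := by
  simp only [qform, nrd_eq, pureQuat]
  ring

theorem quaternion_sq {K : Type*} [CommRing K] {a b : K} (y : ℍ[K,a,b]) :
    y * y = (2 * y.re) • y - nrd y • 1 := by
  rw [nrd_eq]
  ext <;> simp <;> ring

variable {K : Type*} [Field K] {a b : K}
  (ι : ℍ[K,a,b] ≃ₐ[K] Matrix (Fin 2) (Fin 2) K)

/-- The quadratic equation of `y` and Cayley–Hamilton for `ι y` must agree, since `ι y` and `1` are
linearly independent for non-scalar `y`. -/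
theorem trace_and_det (y : ℍ[K,a,b]) (hy : ∀ c : K, y ≠ c • 1) :
    (ι y).trace = 2 * y.re ∧ (ι y).det = nrd y := by
  have h1 : ι y * ι y = (2 * y.re) • ι y - nrd y • 1 := by
    rw [← map_mul, quaternion_sq, map_sub, map_smul, map_smul, map_one]
  have h2 : ι y * ι y = (ι y).trace • ι y - (ι y).det • 1 := by
    ext i j
    fin_cases i <;> fin_cases j <;>
      simp [Matrix.mul_apply, Matrix.trace_fin_two, Matrix.det_fin_two] <;> ring
  have h3 : ((ι y).trace - 2 * y.re) • ι y = ((ι y).det - nrd y) • 1 := by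
    rw [sub_smul, sub_smul]
    rw [h1] at h2
    rw [sub_eq_sub_iff_add_eq_add] at h2 ⊢
    rw [← h2, add_comm]
  have h4 : (ι y).trace = 2 * y.re := by
    by_contra h
    have h' := sub_ne_zero.2 h
    refine hy (((ι y).trace - 2 * y.re)⁻¹ * ((ι y).det - nrd y)) (ι.injective ?_)
    rw [map_smul, map_one, mul_smul, ← h3, smul_smul, inv_mul_cancel₀ h', one_smul]
  refine ⟨h4, ?_⟩
  rw [h4, sub_self, zero_smul] at h3
  have := congrFun (congrFun h3 0) 0
  simpa [sub_eq_zero] using this.symm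

theorem det_eq_nrd (y : ℍ[K,a,b]) : (ι y).det = nrd y := by
  by_cases hy : ∀ c : K, y ≠ c • 1
  · exact (trace_and_det ι y hy).2
  · push Not at hy
    obtain ⟨c, rfl⟩ := hy
    rw [map_smul, map_one, Matrix.det_smul, Matrix.det_one, nrd_eq]
    simp [sq]

theorem trace_eq_zero [CharZero K] (y : ℍ[K,a,b]) (hy : y.re = 0) : (ι y).trace = 0 := by
  by_cases h : ∀ c : K, y ≠ c • 1
  · rw [(trace_and_det ι y h).1, hy, mul_zero]
  · push Not at h
    obtain ⟨c, rfl⟩ := h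
    have : c = 0 := by simpa using hy
    rw [this, zero_smul, map_zero, Matrix.trace_zero]

end QuaternionBasics

/-! ### Ramification at infinity makes the norm form definite. -/

section Definite

variable {a b : ℚ}

theorem nonempty_algEquiv_of_injective {A B : ℝ} (f : ℍ[ℝ,A,B] →ₐ[ℝ] Matrix (Fin 2) (Fin 2) ℝ)
    (hf : Function.Injective f) :
    Nonempty (ℍ[ℝ,A,B] ≃ₐ[ℝ] Matrix (Fin 2) (Fin 2) ℝ) := by
  have h : Module.finrank ℝ ℍ[ℝ,A,B] = Module.finrank ℝ (Matrix (Fin 2) (Fin 2) ℝ) := by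
    rw [QuaternionAlgebra.finrank_eq_four, Module.finrank_matrix]; simp
  exact ⟨AlgEquiv.ofBijective f ⟨hf,
    (LinearMap.injective_iff_surjective_of_finrank_eq_finrank (f := f.toLinearMap) h).1 hf⟩⟩

/-- With `s ^ 2 = a`, send `i` to `diag(s, -s)`; the four matrix entries determine the quaternion,
and dimensions agree. -/
theorem isSplitOver_of_pos_left (ha : 0 < a) (hb : b ≠ 0) : IsSplitOver ℝ a b := by
  have ha' : (0 : ℝ) < a := by exact_mod_cast ha
  have hb' : (b : ℝ) ≠ 0 := by exact_mod_cast hb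
  set s := √(a : ℝ)
  have hs : s * s = a := Real.mul_self_sqrt ha'.le
  have hs0 : s ≠ 0 := (Real.sqrt_pos.2 ha').ne'
  let q : QuaternionAlgebra.Basis (Matrix (Fin 2) (Fin 2) ℝ) (a : ℝ) 0 (b : ℝ) :=
    { i := !![s, 0; 0, -s]
      j := !![0, (b : ℝ); 1, 0]
      k := !![0, s * b; -s, 0]
      i_mul_i := by ext i j; fin_cases i <;> fin_cases j <;> simp [hs]
      j_mul_j := by ext i j; fin_cases i <;> fin_cases j <;> simp
      i_mul_j := by ext i j; fin_cases i <;> fin_cases j <;> simp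
      j_mul_i := by ext i j; fin_cases i <;> fin_cases j <;> simp [mul_comm] }
  refine nonempty_algEquiv_of_injective q.liftHom ((injective_iff_map_eq_zero _).2 fun x hx => ?_)
  have e : ∀ i j, q.liftHom x i j = 0 := fun i j => by rw [hx]; rfl
  have e1 := e 0 0
  have e2 := e 0 1
  have e3 := e 1 0
  have e4 := e 1 1
  simp [QuaternionAlgebra.Basis.liftHom, QuaternionAlgebra.Basis.lift, q, Matrix.algebraMap_matrix_apply] at e1 e2 e3 e4
  have r1 : x.imI = 0 := mul_right_cancel₀ hs0 (by linarith)
  have r2 : x.imK = 0 := by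
    have : b * (x.imJ + x.imK * s) = 0 := by linarith
    have := (mul_eq_zero.1 this).resolve_left hb'
    exact mul_right_cancel₀ hs0 (by linarith)
  ext
  · simp; rw [r1] at e1; linarith
  · simpa using r1
  · simp; rw [r2] at e3; linarith
  · simpa using r2

theorem isSplitOver_of_pos_right (hb : 0 < b) (ha : a ≠ 0) : IsSplitOver ℝ a b := by
  have hb' : (0 : ℝ) < b := by exact_mod_cast hb
  have ha' : (a : ℝ) ≠ 0 := by exact_mod_cast ha
  set t := √(b : ℝ)
  have ht : t * t = b := Real.mul_self_sqrt hb'.le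
  have ht0 : t ≠ 0 := (Real.sqrt_pos.2 hb').ne'
  let q : QuaternionAlgebra.Basis (Matrix (Fin 2) (Fin 2) ℝ) (a : ℝ) 0 (b : ℝ) :=
    { i := !![0, (a : ℝ); 1, 0]
      j := !![t, 0; 0, -t]
      k := !![0, -(a * t); t, 0]
      i_mul_i := by ext i j; fin_cases i <;> fin_cases j <;> simp
      j_mul_j := by ext i j; fin_cases i <;> fin_cases j <;> simp [ht]
      i_mul_j := by ext i j; fin_cases i <;> fin_cases j <;> simp
      j_mul_i := by ext i j; fin_cases i <;> fin_cases j <;> simp [mul_comm] }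
  refine nonempty_algEquiv_of_injective q.liftHom ((injective_iff_map_eq_zero _).2 fun x hx => ?_)
  have e : ∀ i j, q.liftHom x i j = 0 := fun i j => by rw [hx]; rfl
  have e1 := e 0 0
  have e2 := e 0 1
  have e3 := e 1 0
  have e4 := e 1 1
  simp [QuaternionAlgebra.Basis.liftHom, QuaternionAlgebra.Basis.lift, q, Matrix.algebraMap_matrix_apply] at e1 e2 e3 e4
  have r1 : x.imJ = 0 := mul_right_cancel₀ ht0 (by linarith)
  have r2 : x.imK = 0 := by
    have : a * (x.imI - x.imK * t) = 0 := by linarith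
    have := (mul_eq_zero.1 this).resolve_left ha'
    exact mul_right_cancel₀ ht0 (by linarith)
  ext
  · simp; rw [r1] at e1; linarith
  · simp; rw [r2] at e3; linarith
  · simpa using r1
  · simpa using r2

theorem RamifiedExactlyAtInfinityAnd.neg {T : Finset ℕ} (h : RamifiedExactlyAtInfinityAnd T a b) :
    a < 0 ∧ b < 0 := by
  obtain ⟨ha, hb, hs, -⟩ := h
  constructor
  · by_contra! h
    exact hs (isSplitOver_of_pos_left (lt_of_le_of_ne h ha.symm) hb)
  · by_contra! h
    exact hs (isSplitOver_of_pos_right (lt_of_le_of_ne h hb.symm) ha)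

theorem qform_ne_zero (ha : a < 0) (hb : b < 0) {v : Fin 3 → ℚ} (hv : v ≠ 0) :
    qform a b v ≠ 0 := by
  intro h
  rw [qform_eq] at h
  have h1 : 0 ≤ -a * (v 0 * v 0) := mul_nonneg (by linarith) (mul_self_nonneg _)
  have h2 : 0 ≤ -b * (v 1 * v 1) := mul_nonneg (by linarith) (mul_self_nonneg _)
  have hab := mul_pos_of_neg_of_neg ha hb
  have h3 : 0 ≤ a * b * (v 2 * v 2) := mul_nonneg hab.le (mul_self_nonneg _)
  have e1 : -a * (v 0 * v 0) = 0 := by linarith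
  have e2 : -b * (v 1 * v 1) = 0 := by linarith
  have e3 : a * b * (v 2 * v 2) = 0 := by linarith
  refine hv (funext fun i => ?_)
  fin_cases i
  · simpa [ha.ne] using e1
  · simpa [hb.ne] using e2
  · simpa [ha.ne, hb.ne] using e3

end Definite

/-! ### Finiteness from bounds at infinity, at `p` and on denominators. -/

section Discreteness

variable {p : ℕ} {a b : ℚ}

theorem ZInv.exists_pow_mul {x : ℚ} (hx : x ∈ ZInv p) (hp : p ≠ 0) :
    ∃ (n : ℕ) (z : ℤ), (p : ℚ) ^ n * x = z := by
  have hp' : (p : ℚ) ≠ 0 := by exact_mod_cast hp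
  induction hx using Subring.closure_induction with
  | mem x hx =>
    rw [Set.mem_singleton_iff.1 hx]
    exact ⟨1, 1, by simp [hp']⟩
  | zero => exact ⟨0, 0, by simp⟩
  | one => exact ⟨0, 1, by simp⟩
  | add x y _ _ hx hy =>
    obtain ⟨n, z, h⟩ := hx
    obtain ⟨n', z', h'⟩ := hy
    refine ⟨n + n', p ^ n' * z + p ^ n * z', ?_⟩
    push_cast
    rw [← h, ← h']
    ring
  | neg x _ hx =>
    obtain ⟨n, z, h⟩ := hx
    exact ⟨n, -z, by push_cast; rw [← h]; ring⟩
  | mul x y _ _ hx hy =>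
    obtain ⟨n, z, h⟩ := hx
    obtain ⟨n', z', h'⟩ := hy
    refine ⟨n + n', z * z', ?_⟩
    push_cast
    rw [← h, ← h']
    ring

/-- A linear functional has bounded denominators away from `p` on a finitely generated
`ℤ[1/p]`-module. -/
theorem exists_denominator {P : Submodule (ZInv p) ℍ[ℚ,a,b]} (hP : P.FG) (hp : p ≠ 0)
    (f : ℍ[ℚ,a,b] →ₗ[ℚ] ℚ) :
    ∃ m : ℕ, m ≠ 0 ∧ ∀ x ∈ P, ∃ (n : ℕ) (z : ℤ), (p : ℚ) ^ n * (m * f x) = z := by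
  obtain ⟨s, rfl⟩ := hP
  refine ⟨∏ y ∈ s, (f y).den, Finset.prod_ne_zero_iff.2 fun y _ => (f y).den_nz, fun x hx => ?_⟩
  induction hx using Submodule.span_induction with
  | mem x hx =>
    obtain ⟨k, hk⟩ := Finset.dvd_prod_of_mem (fun y => (f y).den) (Finset.mem_coe.1 hx)
    refine ⟨0, k * (f x).num, ?_⟩
    rw [hk]
    push_cast
    rw [pow_zero, one_mul, mul_right_comm, mul_comm _ (f x), Rat.mul_den_eq_num, mul_comm]
  | zero => exact ⟨0, 0, by simp⟩
  | add x y _ _ hx hy =>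
    obtain ⟨n, z, h⟩ := hx
    obtain ⟨n', z', h'⟩ := hy
    refine ⟨n + n', p ^ n' * z + p ^ n * z', ?_⟩
    push_cast
    rw [← h, ← h', map_add]
    push_cast
    ring
  | smul c x _ hx =>
    obtain ⟨n, z, h⟩ := hx
    obtain ⟨n', z', h'⟩ := ZInv.exists_pow_mul c.2 hp
    refine ⟨n + n', z * z', ?_⟩
    push_cast
    rw [← h, ← h', Subring.smul_def, map_smul, smul_eq_mul]
    push_cast
    ring

/-- Containment in one of the two maximal orders is enough for bounding denominators. -/
theorem IsEichlerOrder.exists_fg {R : Subalgebra (ZInv p) ℍ[ℚ,a,b]} {M : ℕ} (h : IsEichlerOrder R M) :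
    ∃ P : Submodule (ZInv p) ℍ[ℚ,a,b], P.FG ∧ ∀ x ∈ R, x ∈ P := by
  obtain ⟨O₁, O₂, h1, -, rfl, -⟩ := h
  exact ⟨_, h1.1.1, fun x hx => hx.1⟩

variable [Fact p.Prime]

theorem exists_int_of_norm_le_one {r : ℚ} {n : ℕ} {z : ℤ} (h : (p : ℚ) ^ n * r = z)
    (hr : ‖(r : ℚ_[p])‖ ≤ 1) : ∃ w : ℤ, r = w := by
  have hp : (p : ℚ) ≠ 0 := by exact_mod_cast (Fact.out : p.Prime).ne_zero
  have h1 : ‖(z : ℚ_[p])‖ ≤ (p : ℝ) ^ (-n : ℤ) := by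
    have h2 : (z : ℚ_[p]) = (p : ℚ_[p]) ^ n * (r : ℚ_[p]) := by exact_mod_cast congrArg (Rat.cast : ℚ → ℚ_[p]) h.symm
    rw [h2, norm_mul, norm_pow, Padic.norm_p, inv_pow, zpow_neg, zpow_natCast]
    exact mul_le_of_le_one_right (by positivity) hr
  obtain ⟨w, hw⟩ := (Padic.norm_int_le_pow_iff_dvd z n).1 h1
  refine ⟨w, mul_left_cancel₀ (pow_ne_zero n hp) ?_⟩
  rw [h, hw]
  push_cast
  ring

theorem finite_of_bounded {S : Set ℚ} {m : ℕ} (hm : m ≠ 0) {B C : ℝ}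
    (h1 : ∀ x ∈ S, ∃ (n : ℕ) (z : ℤ), (p : ℚ) ^ n * (m * x) = z)
    (h2 : ∀ x ∈ S, |(x : ℝ)| ≤ B) (h3 : ∀ x ∈ S, ‖(x : ℚ_[p])‖ ≤ C) : S.Finite := by
  -- With `p ^ k > C`, the number `p ^ k * m * x` is integral at `p` as well, hence an integer, of
  -- absolute value at most `A`.
  obtain ⟨k, hk⟩ := pow_unbounded_of_one_lt C (one_lt_cast_prime (p := p))
  have hp : (p : ℚ) ≠ 0 := by exact_mod_cast (Fact.out : p.Prime).ne_zero
  have hm' : (m : ℚ) ≠ 0 := by exact_mod_cast hm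
  set A : ℝ := (p : ℝ) ^ k * m * B
  refine (((Set.finite_Icc (-⌈A⌉) ⌈A⌉).image
    fun w : ℤ => ((p : ℚ) ^ k * m)⁻¹ * w)).subset fun x hx => ?_
  obtain ⟨n, z, hz⟩ := h1 x hx
  have h4 : (p : ℚ) ^ n * ((p : ℚ) ^ k * (m * x)) = (p ^ k * z : ℤ) := by
    push_cast
    rw [← hz]; ring
  obtain ⟨w, hw⟩ := exists_int_of_norm_le_one h4 (by
    push_cast
    rw [norm_mul, norm_mul, norm_pow, Padic.norm_p, inv_pow]
    have e1 : ‖(m : ℚ_[p])‖ ≤ 1 := by exact_mod_cast Padic.norm_int_le_one (p := p) m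
    have e2 := (h3 x hx).trans hk.le
    have : (0 : ℝ) < p ^ k := pow_pos cast_prime_pos k
    rw [inv_mul_le_one₀ this]
    calc _ ≤ 1 * ‖(x : ℚ_[p])‖ := by gcongr
      _ ≤ _ := by rw [one_mul]; exact e2)
  refine ⟨w, ?_, ?_⟩
  · have h5 : |(w : ℝ)| ≤ A := by
      have : (w : ℝ) = (p : ℝ) ^ k * m * x := by
        have := congrArg (Rat.cast : ℚ → ℝ) hw
        push_cast at this
        rw [← this]; ring
      rw [this, abs_mul, abs_of_nonneg (by positivity)]
      exact mul_le_mul_of_nonneg_left (h2 x hx) (by positivity)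
    have h6 := abs_le.1 h5
    have h7 := Int.le_ceil A
    constructor
    · have : (-⌈A⌉ : ℝ) ≤ w := by linarith [h6.1]
      exact_mod_cast this
    · have : (w : ℝ) ≤ ⌈A⌉ := by linarith [h6.2]
      exact_mod_cast this
  · change ((p : ℚ) ^ k * m)⁻¹ * w = x
    rw [← hw]
    field_simp

theorem exists_functional_bound (f : Matrix (Fin 2) (Fin 2) ℚ_[p] →ₗ[ℚ_[p]] ℚ_[p]) :
    ∃ C : ℝ, ∀ g, ‖f g‖ ≤ C * mnorm g := by
  refine ⟨∑ i, ∑ j, ‖f (Matrix.single i j 1)‖, fun g => ?_⟩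
  have h1 : f g = ∑ i, ∑ j, g i j * f (Matrix.single i j 1) := by
    conv_lhs => rw [Matrix.matrix_eq_sum_single g]
    simp only [map_sum]
    refine Finset.sum_congr rfl fun i _ => Finset.sum_congr rfl fun j _ => ?_
    rw [← smul_eq_mul, ← map_smul, Matrix.smul_single, smul_eq_mul, mul_one]
  rw [h1, Finset.sum_mul]
  refine (norm_sum_le _ _).trans (Finset.sum_le_sum fun i _ => ?_)
  rw [Finset.sum_mul]
  refine (norm_sum_le _ _).trans (Finset.sum_le_sum fun j _ => ?_)
  rw [norm_mul, mul_comm]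
  exact mul_le_mul_of_nonneg_left (norm_le_mnorm g i j) (norm_nonneg _)

theorem abs_le_of_mul_sq_le_one {c t : ℚ} (hc : 0 < c) (h : c * (t * t) ≤ 1) :
    |(t : ℝ)| ≤ 1 + (c⁻¹ : ℚ) := by
  have h1 : t * t ≤ c⁻¹ := by rwa [← one_div, le_div_iff₀ hc, mul_comm]
  have h2 : (t : ℝ) * t ≤ (c⁻¹ : ℚ) := by exact_mod_cast h1
  rw [abs_le]
  constructor <;> nlinarith [sq_nonneg ((t : ℝ) - 1), sq_nonneg ((t : ℝ) + 1)]

end Discreteness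

/-! ### The discrete representation of `Γ`. -/

section Representation

variable {p : ℕ} [Fact p.Prime] {a b : ℚ}
  (R : Subalgebra (ZInv p) ℍ[ℚ,a,b])
  (ι : ℍ[ℚ_[p],(a : ℚ_[p]),(b : ℚ_[p])] ≃ₐ[ℚ_[p]] Matrix (Fin 2) (Fin 2) ℚ_[p])

/-- The representation of `Γ` given by the splitting `ι` of `B` at `p`. -/
def gamRep : Gam R →* GL (Fin 2) ℚ_[p] :=
  (Units.map ((ι : ℍ[ℚ_[p],(a : ℚ_[p]),(b : ℚ_[p])] →* Matrix (Fin 2) (Fin 2) ℚ_[p]).comp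
    (toFieldHom ℚ_[p] a b))).comp (Gam R).subtype

variable {R ι}

theorem gamRep_val (γ : Gam R) :
    (gamRep R ι γ).1 = ι (toField ℚ_[p] ((γ : (ℍ[ℚ,a,b])ˣ) : ℍ[ℚ,a,b])) := rfl

theorem isOrbitMap_proj : IsOrbitMap (gamRep R ι) (proj R ι) where
  surjective := Quot.mk_surjective
  lift f hf := ⟨Quot.lift f (by
    rintro z w ⟨γ, hγ, h⟩
    rw [← hf ⟨γ, hγ⟩ z]
    exact congrArg f (Hp.ext h)), fun _ => rfl⟩

theorem torsionActsTrivially_gamRep (hΓ : TorsionFreeModSign R) :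
    TorsionActsTrivially (gamRep R ι) := by
  intro γ n hn h z
  apply Hp.ext
  have h1 : (γ : (ℍ[ℚ,a,b])ˣ) ^ n = 1 := congrArg Subtype.val h
  rw [Hp.smul_val, gamRep_val]
  rcases hΓ γ γ.2 n hn (Or.inl h1) with h2 | h2
  · rw [h2]
    have : ι (toField ℚ_[p] (((1 : (ℍ[ℚ,a,b])ˣ)) : ℍ[ℚ,a,b])) = 1 := by
      rw [Units.val_one, ← map_one ι]
      exact congrArg ι (map_one (toFieldHom ℚ_[p] a b))
    rw [this]
    simp [moebius]
  · rw [h2]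
    have : ι (toField ℚ_[p] (((-1 : (ℍ[ℚ,a,b])ˣ)) : ℍ[ℚ,a,b])) = -1 := by
      rw [Units.val_neg, Units.val_one, ← map_one ι, ← map_neg]
      refine congrArg ι ?_
      ext <;> simp [toField]
    rw [this]
    simp [moebius]

theorem finite_coordinate {P : Submodule (ZInv p) ℍ[ℚ,a,b]} (hP : P.FG) (hR : ∀ x ∈ R, x ∈ P)
    (f : ℍ[ℚ,a,b] →ₗ[ℚ] ℚ) (f' : ℍ[ℚ_[p],(a : ℚ_[p]),(b : ℚ_[p])] →ₗ[ℚ_[p]] ℚ_[p])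
    (hf : ∀ x, f' (toField ℚ_[p] x) = f x) {B : ℝ} (hB : ∀ x, nrd x = 1 → |((f x : ℚ) : ℝ)| ≤ B)
    (C : ℝ) :
    ((fun γ : Gam R => f ((γ : (ℍ[ℚ,a,b])ˣ) : ℍ[ℚ,a,b])) ''
      {γ | mnorm (gamRep R ι γ).1 ≤ C}).Finite := by
  obtain ⟨m, hm, h1⟩ := exists_denominator hP (Fact.out : p.Prime).ne_zero f
  obtain ⟨C', h2⟩ := exists_functional_bound (f'.comp ι.symm.toLinearMap)
  refine finite_of_bounded (p := p) (B := B) (C := |C'| * C) hm ?_ ?_ ?_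
  · rintro _ ⟨γ, -, rfl⟩
    exact h1 _ (hR _ γ.2.1)
  · rintro _ ⟨γ, -, rfl⟩
    exact hB _ γ.2.2.2
  · rintro _ ⟨γ, hγ, rfl⟩
    have h3 := h2 (gamRep R ι γ).1
    rw [gamRep_val] at h3
    simp only [LinearMap.comp_apply, AlgEquiv.toLinearMap_apply, AlgEquiv.symm_apply_apply, hf] at h3
    refine h3.trans ?_
    rw [← gamRep_val]
    exact (mul_le_mul_of_nonneg_right (le_abs_self C') (mnorm_nonneg _)).trans
      (mul_le_mul_of_nonneg_left hγ (abs_nonneg _))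

/-- Each of the four coordinates takes finitely many values: norm one in a definite algebra bounds
it at infinity, `mnorm` bounds it at `p`, and its other denominators are bounded on `R`. -/
theorem isDiscreteRep_gamRep (ha : a < 0) (hb : b < 0) {M : ℕ} (hR : IsEichlerOrder R M) :
    IsDiscreteRep (gamRep R ι) where
  det γ := by
    rw [gamRep_val, det_eq_nrd, nrd_toField, γ.2.2.2, Rat.cast_one]
  finite C := by
    obtain ⟨P, hP, hRP⟩ := hR.exists_fg
    have hab := mul_pos_of_neg_of_neg ha hb
    have hx : ∀ x : ℍ[ℚ,a,b], nrd x = 1 → 1 * (x.re * x.re) ≤ 1 ∧ -a * (x.imI * x.imI) ≤ 1 ∧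
        -b * (x.imJ * x.imJ) ≤ 1 ∧ a * b * (x.imK * x.imK) ≤ 1 := by
      intro x h
      rw [nrd_eq] at h
      have e0 := mul_self_nonneg x.re
      have e1 : 0 ≤ -a * (x.imI * x.imI) := mul_nonneg (by linarith) (mul_self_nonneg _)
      have e2 : 0 ≤ -b * (x.imJ * x.imJ) := mul_nonneg (by linarith) (mul_self_nonneg _)
      have e3 : 0 ≤ a * b * (x.imK * x.imK) := mul_nonneg hab.le (mul_self_nonneg _)
      refine ⟨?_, ?_, ?_, ?_⟩ <;> linarith
    have f0 := finite_coordinate (ι := ι) hP hRP (QuaternionAlgebra.reₗ a 0 b) (QuaternionAlgebra.reₗ _ _ _)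
      (fun _ => rfl) (fun x h => abs_le_of_mul_sq_le_one one_pos (hx x h).1) C
    have f1 := finite_coordinate (ι := ι) hP hRP (QuaternionAlgebra.imIₗ a 0 b) (QuaternionAlgebra.imIₗ _ _ _)
      (fun _ => rfl) (fun x h => abs_le_of_mul_sq_le_one (neg_pos.2 ha) (hx x h).2.1) C
    have f2 := finite_coordinate (ι := ι) hP hRP (QuaternionAlgebra.imJₗ a 0 b) (QuaternionAlgebra.imJₗ _ _ _)
      (fun _ => rfl) (fun x h => abs_le_of_mul_sq_le_one (neg_pos.2 hb) (hx x h).2.2.1) C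
    have f3 := finite_coordinate (ι := ι) hP hRP (QuaternionAlgebra.imKₗ a 0 b) (QuaternionAlgebra.imKₗ _ _ _)
      (fun _ => rfl) (fun x h => abs_le_of_mul_sq_le_one hab (hx x h).2.2.2) C
    refine Set.Finite.of_finite_image (f := fun γ : Gam R =>
      (((γ : (ℍ[ℚ,a,b])ˣ) : ℍ[ℚ,a,b]).re, ((γ : (ℍ[ℚ,a,b])ˣ) : ℍ[ℚ,a,b]).imI,
        ((γ : (ℍ[ℚ,a,b])ˣ) : ℍ[ℚ,a,b]).imJ, ((γ : (ℍ[ℚ,a,b])ˣ) : ℍ[ℚ,a,b]).imK)) ?_ ?_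
    · refine (f0.prod (f1.prod (f2.prod f3))).subset ?_
      rintro _ ⟨γ, hγ, rfl⟩
      exact ⟨⟨γ, hγ, rfl⟩, ⟨γ, hγ, rfl⟩, ⟨γ, hγ, rfl⟩, ⟨γ, hγ, rfl⟩⟩
    · intro γ _ γ' _ h
      simp only [Prod.mk.injEq] at h
      exact Subtype.ext (Units.ext (QuaternionAlgebra.ext h.1 h.2.1 h.2.2.1 h.2.2.2))

end Representation

/-! ### Heegner points as quadratic irrationalities. -/

section Heegner

open Polynomial

variable {p : ℕ} [Fact p.Prime] {a b : ℚ}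
  {ι : ℍ[ℚ_[p],(a : ℚ_[p]),(b : ℚ_[p])] ≃ₐ[ℚ_[p]] Matrix (Fin 2) (Fin 2) ℚ_[p]}

/-- The points of `ℋ_p` orthogonal to `v` are the roots of a quadratic polynomial over `ℚ_p` whose
discriminant is `-4 * qform a b v`. -/
theorem exists_quadratic (ι : ℍ[ℚ_[p],(a : ℚ_[p]),(b : ℚ_[p])] ≃ₐ[ℚ_[p]] Matrix (Fin 2) (Fin 2) ℚ_[p])
    (v : Fin 3 → ℚ) : ∃ α β κ : ℚ_[p], α ^ 2 + β * κ = -((qform a b v : ℚ) : ℚ_[p]) ∧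
      ∀ z : Hp p, z ∈ heegnerPoints ι v ↔ emb κ * z.1 ^ 2 - 2 * emb α * z.1 - emb β = 0 := by
  set M := ι (toField ℚ_[p] (pureQuat a b v)) with hM
  have ht : M.trace = 0 := trace_eq_zero ι _ (by simp [toField, pureQuat])
  have hd : M.det = ((qform a b v : ℚ) : ℚ_[p]) := by rw [hM, det_eq_nrd, nrd_toField]; rfl
  rw [Matrix.trace_fin_two] at ht
  have h11 : M 1 1 = -M 0 0 := by linear_combination ht
  refine ⟨M 0 0, M 0 1, M 1 0, ?_, fun z => ?_⟩
  · rw [← hd, Matrix.det_fin_two, h11]; ring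
  · have e : (M.map (algebraMap ℚ_[p] ℂ_[p]) + nilp z.1).det -
        (M.map (algebraMap ℚ_[p] ℂ_[p])).det - (nilp z.1).det =
        emb (M 1 0) * z.1 ^ 2 - 2 * emb (M 0 0) * z.1 - emb (M 0 1) := by
      simp only [Matrix.det_fin_two, Matrix.add_apply, Matrix.map_apply, nilp, h11, map_neg]
      simp
      ring
    rw [← e]
    rfl

/-- The splitting field of `X ^ 2 - d` in `ℂ_p`. -/
def sqrtField (d : ℚ_[p]) : IntermediateField ℚ_[p] ℂ_[p] :=
  IntermediateField.adjoin ℚ_[p] ((X ^ 2 - C d : ℚ_[p][X]).rootSet ℂ_[p])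

instance isSplittingField_sqrtField (d : ℚ_[p]) :
    (X ^ 2 - C d : ℚ_[p][X]).IsSplittingField ℚ_[p] (sqrtField d) :=
  IntermediateField.adjoin_rootSet_isSplittingField (IsAlgClosed.splits _)

instance finiteDimensional_sqrtField (d : ℚ_[p]) : FiniteDimensional ℚ_[p] (sqrtField d) :=
  Polynomial.IsSplittingField.finiteDimensional _ (X ^ 2 - C d : ℚ_[p][X])

theorem isGalois_sqrtField {d : ℚ_[p]} (hd : d ≠ 0) : IsGalois ℚ_[p] (sqrtField d) :=
  IsGalois.of_separable_splitting_field (p := (X ^ 2 - C d : ℚ_[p][X]))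
    (separable_X_pow_sub_C d (by norm_num) hd)

theorem mem_sqrtField {d : ℚ_[p]} {w : ℂ_[p]} (h : w ^ 2 = emb d) : w ∈ sqrtField d := by
  refine IntermediateField.subset_adjoin _ _ ((mem_rootSet_of_ne ?_).2 ?_)
  · exact X_pow_sub_C_ne_zero (by norm_num) d
  · simp only [map_sub, map_pow, aeval_X, aeval_C, sub_eq_zero]
    exact h

theorem quadratic_leadingCoeff_ne_zero {α β κ d : ℚ_[p]} (hd : d ≠ 0) (h : α ^ 2 + β * κ = d)
    {z : Hp p} (hz : emb κ * z.1 ^ 2 - 2 * emb α * z.1 - emb β = 0) : κ ≠ 0 := by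
  rintro rfl
  refine z.lin_ne_zero (u := -2 * α) (v := -β) ?_ ?_
  · left
    rintro h0
    have : α = 0 := by simpa using h0
    rw [this] at h
    exact hd (by rw [← h]; ring)
  · rw [map_mul, map_neg, map_neg, map_ofNat]
    rw [map_zero] at hz
    linear_combination hz

/-- Completing the square, `κ z - α` is a square root of `d`. -/
theorem quadratic_mem {α β κ d : ℚ_[p]} (hd : d ≠ 0) (h : α ^ 2 + β * κ = d)
    {z : Hp p} (hz : emb κ * z.1 ^ 2 - 2 * emb α * z.1 - emb β = 0) :
    z ∈ fieldPoints (sqrtField d) := by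
  have hκ : emb κ ≠ 0 := by simpa using quadratic_leadingCoeff_ne_zero hd h hz
  have h1 : emb κ * z.1 - emb α ∈ sqrtField d := by
    refine mem_sqrtField ?_
    rw [← h]
    simp only [map_add, map_mul, map_pow]
    linear_combination emb κ * hz
  have h2 : z.1 = (emb κ * z.1 - emb α + emb α) / emb κ := by field_simp; ring
  change z.1 ∈ sqrtField d
  rw [h2]
  exact div_mem (add_mem h1 (emb_mem _ _)) (emb_mem _ _)

theorem quadratic_galAct {K : IntermediateField ℚ_[p] ℂ_[p]} {α β κ : ℚ_[p]} {z : Hp p}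
    (hzK : z ∈ fieldPoints K)
    (hz : emb κ * z.1 ^ 2 - 2 * emb α * z.1 - emb β = 0) (σ : K ≃ₐ[ℚ_[p]] K) :
    emb κ * (galAct σ z).1 ^ 2 - 2 * emb α * (galAct σ z).1 - emb β = 0 := by
  have h1 : algebraMap ℚ_[p] K κ * ⟨z.1, hzK⟩ ^ 2 - 2 * algebraMap ℚ_[p] K α * ⟨z.1, hzK⟩ -
      algebraMap ℚ_[p] K β = 0 := Subtype.ext hz
  have h2 := congrArg (fun t : K => (σ t : ℂ_[p])) h1
  simp only [map_sub, map_mul, map_pow, AlgEquiv.commutes, map_zero, map_ofNat] at h2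
  rw [galAct_val σ hzK]
  exact h2

/-- The distances of a quadratic irrationality to the elements of `ℚ_p` have squares in the value
group of `ℚ_p`. -/
theorem quadratic_dist {α β κ d : ℚ_[p]} (hd : d ≠ 0) (h : α ^ 2 + β * κ = d)
    {z : Hp p} (hz : emb κ * z.1 ^ 2 - 2 * emb α * z.1 - emb β = 0) (c : ℚ_[p]) :
    ∃ k : ℤ, ‖z.1 - emb c‖ ^ 2 = (p : ℝ) ^ k := by
  have hκ := quadratic_leadingCoeff_ne_zero hd h hz
  have hzK := quadratic_mem hd h hz
  have := isGalois_sqrtField hd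
  -- Since `z ∉ ℚ_p`, some `σ` moves it, and `σ z` is the other root. The product of the distances
  -- of both roots from `c` lies in the value group of `ℚ_p`, and the two distances are equal.
  obtain ⟨σ, hσ⟩ : ∃ σ : sqrtField d ≃ₐ[ℚ_[p]] sqrtField d, (galAct σ z).1 ≠ z.1 := by
    by_contra! hcon
    obtain ⟨t, ht⟩ := IntermediateField.mem_bot.1 ((IsGalois.mem_bot_iff_fixed
      (⟨z.1, hzK⟩ : sqrtField d)).2 fun σ => Subtype.ext (by rw [← galAct_val σ hzK, hcon σ]))
    exact z.2 ⟨t, congrArg Subtype.val ht⟩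
  have hz' := quadratic_galAct hzK hz σ
  set w := galAct σ z
  have hs : emb κ * (w.1 + z.1) = 2 * emb α := by
    refine mul_left_cancel₀ (sub_ne_zero.2 hσ) ?_
    linear_combination hz' - hz
  have hprod : emb κ * ((z.1 - emb c) * (w.1 - emb c)) =
      emb (κ * c ^ 2 - 2 * α * c - β) := by
    simp only [map_sub, map_mul, map_pow, map_ofNat]
    linear_combination (z.1 - emb c) * hs - hz
  have hn : ‖w.1 - emb c‖ = ‖z.1 - emb c‖ := by
    have := nu_galAct σ z 1 (-c)
    simpa [nu, sub_eq_add_neg] using this.symm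
  have hq : κ * c ^ 2 - 2 * α * c - β ≠ 0 := by
    intro h0
    rw [h0, map_zero] at hprod
    have e : ∀ y : Hp p, y.1 - emb c ≠ 0 := fun y h => y.2 ⟨c, (sub_eq_zero.1 h).symm⟩
    exact mul_ne_zero (by simpa using hκ) (mul_ne_zero (e z) (e w)) hprod
  obtain ⟨m, hm⟩ := exists_norm_eq_zpow hκ
  obtain ⟨n, hn'⟩ := exists_norm_eq_zpow hq
  have hN := congrArg norm hprod
  rw [norm_mul, norm_mul, hn, norm_emb, norm_emb, hm, hn', ← sq] at hN
  have hp : (p : ℝ) ≠ 0 := cast_prime_pos.ne'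
  refine ⟨n - m, ?_⟩
  rw [zpow_sub₀ hp, ← hN]
  field_simp

theorem heegnerPoints_subset {v : Fin 3 → ℚ} {D : ℚ} (hv : qform a b v = D) (hD : D ≠ 0) {z : Hp p}
    (hz : z ∈ heegnerPoints ι v) : z ∈ fieldPoints (sqrtField (-(D : ℚ_[p]))) := by
  obtain ⟨α, β, κ, h, hH⟩ := exists_quadratic ι v
  rw [hv] at h
  exact quadratic_mem (by simpa using hD) h ((hH z).1 hz)

theorem dist_of_mem_heegnerPoints {v : Fin 3 → ℚ} {D : ℚ} (hv : qform a b v = D) (hD : D ≠ 0) {z : Hp p}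
    (hz : z ∈ heegnerPoints ι v) (c : ℚ_[p]) : ∃ k : ℤ, ‖z.1 - emb c‖ ^ 2 = (p : ℝ) ^ k := by
  obtain ⟨α, β, κ, h, hH⟩ := exists_quadratic ι v
  rw [hv] at h
  exact quadratic_dist (by simpa using hD) h ((hH z).1 hz) c

theorem galAct_mem_heegnerPoints {v : Fin 3 → ℚ} {D : ℚ} (hv : qform a b v = D) (hD : D ≠ 0) {z : Hp p}
    (hz : z ∈ heegnerPoints ι v)
    (σ : sqrtField (-(D : ℚ_[p])) ≃ₐ[ℚ_[p]] sqrtField (-(D : ℚ_[p]))) :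
    galAct σ z ∈ heegnerPoints ι v := by
  obtain ⟨α, β, κ, h, hH⟩ := exists_quadratic ι v
  exact (hH _).2 (quadratic_galAct (heegnerPoints_subset hv hD hz) ((hH z).1 hz) σ)

variable {R : Subalgebra (ZInv p) ℍ[ℚ,a,b]}

/-- The action of the automorphisms of `K` on `Γ \ ℋ_p` induced by `galAct`. -/
def galCurve (R : Subalgebra (ZInv p) ℍ[ℚ,a,b])
    (ι : ℍ[ℚ_[p],(a : ℚ_[p]),(b : ℚ_[p])] ≃ₐ[ℚ_[p]] Matrix (Fin 2) (Fin 2) ℚ_[p])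
    {K : IntermediateField ℚ_[p] ℂ_[p]} (σ : K ≃ₐ[ℚ_[p]] K) : ModCurve R ι ≃ ModCurve R ι :=
  have aux : ∀ σ : K ≃ₐ[ℚ_[p]] K, ∀ z w : Hp p, (∃ γ ∈ Gam R, act ι (γ : ℍ[ℚ,a,b]) z.1 = w.1) →
      ∃ γ ∈ Gam R, act ι (γ : ℍ[ℚ,a,b]) (galAct σ z).1 = (galAct σ w).1 := by
    rintro σ z w ⟨γ, hγ, h⟩
    refine ⟨γ, hγ, ?_⟩
    have h1 : gamRep R ι ⟨γ, hγ⟩ • z = w := Hp.ext h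
    rw [← h1, galAct_smul]
    rfl
  { toFun := Quot.map (galAct σ) (aux σ)
    invFun := Quot.map (galAct σ.symm) (aux σ.symm)
    left_inv := by rintro ⟨z⟩; exact congrArg (Quot.mk _) (galAct_symm σ z)
    right_inv := by rintro ⟨z⟩; exact congrArg (Quot.mk _) (galAct_symm σ.symm z) }

theorem galCurve_proj {K : IntermediateField ℚ_[p] ℂ_[p]} (σ : K ≃ₐ[ℚ_[p]] K) (z : Hp p) :
    galCurve R ι σ (proj R ι z) = proj R ι (galAct σ z) := rfl

/-- For every `v` the cycle of `v` is the zero set of a polynomial over `ℚ_p`, so `σ` maps its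
points over `c` bijectively to those over the image of `c`. -/
theorem heegnerDivisor_galCurve (Φ : VAdele p → ℤ) {D : ℚ} (hD : D ≠ 0)
    (σ : sqrtField (-(D : ℚ_[p])) ≃ₐ[ℚ_[p]] sqrtField (-(D : ℚ_[p]))) (c : ModCurve R ι) :
    heegnerDivisor R ι Φ D (galCurve R ι σ c) = heegnerDivisor R ι Φ D c := by
  refine finsum_congr fun o => ?_
  congr 2
  rw [← Set.ncard_image_of_injective {z ∈ heegnerPoints ι o.out.1 | proj R ι z = c}
    (galAct_injective σ)]
  congr 1
  ext z
  constructor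
  · rintro ⟨hz, hc⟩
    refine ⟨galAct σ.symm z, ⟨galAct_mem_heegnerPoints o.out.2 hD hz σ.symm, ?_⟩, galAct_symm σ.symm z⟩
    rw [← galCurve_proj, hc]
    exact (galCurve R ι σ).symm_apply_apply c
  · rintro ⟨w, ⟨hw, rfl⟩, rfl⟩
    exact ⟨galAct_mem_heegnerPoints o.out.2 hD hw σ, rfl⟩

theorem exists_heegnerPoint {Φ : VAdele p → ℤ} {D : ℚ} {c : ModCurve R ι}
    (h : heegnerDivisor R ι Φ D c ≠ 0) :
    ∃ v : Fin 3 → ℚ, qform a b v = D ∧ ∃ z ∈ heegnerPoints ι v, proj R ι z = c := by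
  by_contra! hcon
  refine h (finsum_eq_zero_of_forall_eq_zero fun o => ?_)
  have : {z ∈ heegnerPoints ι o.out.1 | proj R ι z = c} = ∅ := by
    ext z
    simp only [Set.mem_empty_iff_false, iff_false]
    exact fun hz => hcon _ o.out.2 z hz.1 hz.2
  rw [this]
  simp

end Heegner

/-! ### The coefficients of the generating series. -/

section Coefficients

variable {p : ℕ} [Fact p.Prime] {a b : ℚ}
  {ι : ℍ[ℚ_[p],(a : ℚ_[p]),(b : ℚ_[p])] ≃ₐ[ℚ_[p]] Matrix (Fin 2) (Fin 2) ℚ_[p]}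
  {R : Subalgebra (ZInv p) ℍ[ℚ,a,b]}

theorem IsLift.mapDomain_eq {𝒟 𝒟' : Divisor p} {Δ : ModCurve R ι → ℚ} (h : IsLift R ι 𝒟 Δ)
    (h' : IsLift R ι 𝒟' Δ) : 𝒟.mapDomain (proj R ι) = 𝒟'.mapDomain (proj R ι) := by
  ext c
  have := (h c).trans (h' c).symm
  exact_mod_cast this

theorem IsLift.exists_heegnerPoint {𝒟 : Divisor p} {Φ : VAdele p → ℤ} {D : ℚ}
    (h : IsLift R ι 𝒟 (heegnerDivisor R ι Φ D)) {c : ModCurve R ι}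
    (hc : c ∈ (𝒟.mapDomain (proj R ι)).support) :
    ∃ v : Fin 3 → ℚ, qform a b v = D ∧ ∃ z ∈ heegnerPoints ι v, proj R ι z = c := by
  refine PadicGKZ.exists_heegnerPoint (Φ := Φ) ?_
  rw [← h c]
  exact_mod_cast Finsupp.mem_support_iff.1 hc

theorem hasProd_jFactor (hρ : IsDiscreteRep (gamRep R ι)) {e : ℤ} {s : Hp p → Hp p}
    (hs : IsCellSection (gamRep R ι) e s) {𝒟 : Divisor p} (h : StrongDegZeroPar e 𝒟) {η : Hp p}
    (hη : IsAdmissible R ι η 𝒟) (γ : Gam R) :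
    HasProd (jFactor R ι η 𝒟 γ) (periodProd (gamRep R ι) s 𝒟 γ) :=
  hρ.hasProd_symbolFactor hs h
    (fun x hx γ hγ => hη γ γ.2 x hx (congrArg Subtype.val hγ)) γ

theorem exists_vertexSection (hρ : IsDiscreteRep (gamRep R ι))
    (ht : TorsionActsTrivially (gamRep R ι)) (e : ℤ) :
    ∃ s, IsCellSection (gamRep R ι) e s ∧ ∀ x, s x ∈ vertexPoints p := by
  obtain ⟨s, hs, h⟩ := hρ.exists_cellSection ht e (Pr := vertexPoints p)
    fun γ _ hz => smul_mem_vertexPoints _ hz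
  refine ⟨s, hs, fun x => ?_⟩
  obtain ⟨y, hy, hxy⟩ := exists_vertexPoint e x
  exact h x y hxy hy

theorem multipliable_jFactor (hρ : IsDiscreteRep (gamRep R ι))
    (ht : TorsionActsTrivially (gamRep R ι)) {e : ℤ} {𝒟 : Divisor p} (h : StrongDegZeroPar e 𝒟)
    {η : Hp p} (hη : IsAdmissible R ι η 𝒟) (γ : Gam R) : Multipliable (jFactor R ι η 𝒟 γ) := by
  obtain ⟨s, hs, -⟩ := exists_vertexSection hρ ht e
  exact (hasProd_jFactor hρ hs h hη γ).multipliable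

theorem autFactor_mul (hρ : IsDiscreteRep (gamRep R ι))
    (ht : TorsionActsTrivially (gamRep R ι)) {e : ℤ} {𝒟 : Divisor p} (h : StrongDegZeroPar e 𝒟)
    {η : Hp p} (hη : IsAdmissible R ι η 𝒟) (γ γ' : Gam R) :
    autFactor R ι η 𝒟 (γ * γ') = autFactor R ι η 𝒟 γ * autFactor R ι η 𝒟 γ' := by
  obtain ⟨s, hs, -⟩ := exists_vertexSection hρ ht e
  have key : ∀ γ, autFactor R ι η 𝒟 γ = _ := fun γ => (hasProd_jFactor hρ hs h hη γ).tprod_eq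
  rw [key, key, key, hρ.periodProd_mul]

/-- The automorphy factors of lifts of Heegner divisors have values in `ℚ_p`. -/
theorem autFactor_mem_range (hρ : IsDiscreteRep (gamRep R ι))
    (ht : TorsionActsTrivially (gamRep R ι)) {e : ℤ} {𝒟 : Divisor p} (h : StrongDegZeroPar e 𝒟)
    {η : Hp p} (hη : IsAdmissible R ι η 𝒟) {Φ : VAdele p → ℤ} {D : ℚ} (hD : D ≠ 0)
    (hlift : IsLift R ι 𝒟 (heegnerDivisor R ι Φ D)) (γ : Gam R) :
    ∃ t : ℚ_[p], emb t = autFactor R ι η 𝒟 γ := by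
  have := isGalois_sqrtField (p := p) (d := -(D : ℚ_[p])) (by simpa using hD)
  obtain ⟨s, hs, hsK⟩ := hρ.exists_cellSection ht e (Pr := fieldPoints (sqrtField (-(D : ℚ_[p]))))
    fun γ _ hz => smul_mem_fieldPoints _ hz
  have key : autFactor R ι η 𝒟 γ = _ := (hasProd_jFactor hρ hs h hη γ).tprod_eq
  rw [key]
  refine periodProd_mem_range (K := sqrtField (-(D : ℚ_[p]))) hρ isOrbitMap_proj hs
    (fun x hx => hsK x x (SameCell.refl e x) hx) h ?_ (galCurve R ι) (fun σ x => rfl) ?_ γ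
  · intro c hc
    obtain ⟨v, hv, z, hz, rfl⟩ := hlift.exists_heegnerPoint hc
    exact ⟨z, heegnerPoints_subset hv hD hz, rfl⟩
  · intro σ c
    have h1 := (hlift (galCurve R ι σ c)).trans
      ((heegnerDivisor_galCurve Φ hD σ c).trans (hlift c).symm)
    exact_mod_cast h1

theorem norm_autFactor_mul (hρ : IsDiscreteRep (gamRep R ι))
    (ht : TorsionActsTrivially (gamRep R ι)) {𝒟 𝒟' : Divisor p} (h : StrongDegZeroEven 𝒟)
    (h' : StrongDegZeroOdd 𝒟') {η η' : Hp p} (hη : IsAdmissible R ι η 𝒟)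
    (hη' : IsAdmissible R ι η' 𝒟') {Φ : VAdele p → ℤ} {D : ℚ} (hD : D ≠ 0)
    (hlift : IsLift R ι 𝒟 (heegnerDivisor R ι Φ D))
    (hlift' : IsLift R ι 𝒟' (heegnerDivisor R ι Φ D)) (γ : Gam R) :
    ‖autFactor R ι η 𝒟 γ * autFactor R ι η' 𝒟' γ‖ = 1 := by
  obtain ⟨s, hs, hsv⟩ := exists_vertexSection hρ ht 0
  obtain ⟨s', hs', hsv'⟩ := exists_vertexSection hρ ht 1
  have e : autFactor R ι η 𝒟 γ = _ :=
    (hasProd_jFactor hρ hs (strongDegZeroPar_zero h) hη γ).tprod_eq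
  have e' : autFactor R ι η' 𝒟' γ = _ :=
    (hasProd_jFactor hρ hs' (strongDegZeroPar_one h') hη' γ).tprod_eq
  rw [e, e']
  refine hρ.norm_periodProd_mul isOrbitMap_proj hs hs' hsv hsv' (hlift.mapDomain_eq hlift') ?_ γ
  intro c hc
  obtain ⟨v, hv, z, hz, rfl⟩ := hlift.exists_heegnerPoint hc
  exact ⟨z, rfl, dist_of_mem_heegnerPoints hv hD hz⟩

theorem ne_zero_of_mem_DS (ha : a < 0) (hb : b < 0) {D : ℤ} (h : D ∈ DS ι) : (D : ℚ) ≠ 0 := by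
  obtain ⟨v, hv, hD, -⟩ := h
  rw [← hD]
  exact qform_ne_zero ha hb hv

/-- A multiplicative function with values in the `ℚ_p`-rational points of the unit circle of `ℂ_p`
comes from a homomorphism to `ℤ_p^×`. -/
theorem exists_unitHom {G : Type*} [Group G] {f : G → ℂ_[p]} (hf : ∀ g h, f (g * h) = f g * f h)
    (h1 : ∀ g, ‖f g‖ = 1) (h2 : ∀ g, ∃ t : ℚ_[p], emb t = f g) :
    ∃ φ : G →* ℤ_[p]ˣ, ∀ g, emb (((φ g : ℤ_[p]ˣ) : ℤ_[p]) : ℚ_[p]) = f g := by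
  choose t ht using h2
  have hinj : Function.Injective (emb (p := p)) := (algebraMap ℚ_[p] ℂ_[p]).injective
  have hn : ∀ g, ‖t g‖ ≤ 1 := fun g => by rw [← norm_emb, ht, h1]
  have hmul : ∀ g h, t (g * h) = t g * t h := fun g h => hinj (by rw [map_mul, ht, ht, ht, hf])
  have hone : t 1 = 1 := by
    -- Multiplicativity only makes `t 1` idempotent; the norm condition excludes zero.
    have h3 : t 1 ≠ 0 := by
      intro h0
      have := h1 1
      rw [← ht, h0, map_zero, norm_zero] at this
      exact zero_ne_one this
    have := hmul 1 1
    rw [mul_one] at this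
    exact (mul_eq_left₀ h3).1 this.symm
  let ψ : G →* ℤ_[p] :=
    { toFun := fun g => ⟨t g, hn g⟩
      map_one' := Subtype.ext hone
      map_mul' := fun g h => Subtype.ext (hmul g h) }
  exact ⟨ψ.toHomUnits, fun g => ht g⟩

end Coefficients

end PadicGKZ

end

open PadicGKZ

theorem proposition6p5 (p : ℕ) [Fact p.Prime]
    -- `S` is the set of finite places in the given set of places, the other one being `∞`
    (S : Finset ℕ) (hS : ∀ ℓ ∈ S, ℓ.Prime) (hS_even : Even S.card) (hpS : p ∈ S)
    (Nplus N : ℕ) (hNplus : Squarefree Nplus) (hNplusS : ∀ ℓ ∈ S, ¬ ℓ ∣ Nplus)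
    (hN : N = Nplus * ∏ ℓ ∈ S, ℓ) (hN2 : ¬ 2 ∣ N)
    (a b : ℚ) (hB : RamifiedExactlyAtInfinityAnd (S.erase p) a b)
    (ι : ℍ[ℚ_[p],(a : ℚ_[p]),(b : ℚ_[p])] ≃ₐ[ℚ_[p]] Matrix (Fin 2) (Fin 2) ℚ_[p])
    (R : Subalgebra (ZInv p) ℍ[ℚ,a,b]) (hR : IsEichlerOrder R Nplus)
    (hΓ : TorsionFreeModSign R)
    (Φ : VAdele p → ℤ) (hΦ : IsConvenient R N ι Φ)
    (𝒟e 𝒟o : ℤ → Divisor p)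
    (h𝒟e : ∀ D ∈ DS ι, StrongDegZeroEven (𝒟e D) ∧ IsLift R ι (𝒟e D) (heegnerDivisor R ι Φ D))
    (h𝒟o : ∀ D ∈ DS ι, StrongDegZeroOdd (𝒟o D) ∧ IsLift R ι (𝒟o D) (heegnerDivisor R ι Φ D))
    (ηe ηo : ℤ → Hp p)
    (hηe : ∀ D ∈ DS ι, IsAdmissible R ι (ηe D) (𝒟e D))
    (hηo : ∀ D ∈ DS ι, IsAdmissible R ι (ηo D) (𝒟o D)) :
    (∀ D ∈ DS ι, ∀ γ : Gam R,
      Multipliable (jFactor R ι (ηe D) (𝒟e D) γ) ∧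
      Multipliable (jFactor R ι (ηo D) (𝒟o D) γ) ∧
      ‖autFactor R ι (ηe D) (𝒟e D) γ * autFactor R ι (ηo D) (𝒟o D) γ‖ = 1) ∧
    ∃ G : ℕ → (Gam R →* ℤ_[p]ˣ), ∀ (n : ℕ) (γ : Gam R),
      algebraMap ℚ_[p] ℂ_[p] (((G n γ : ℤ_[p]ˣ) : ℤ_[p]) : ℚ_[p]) =
        GPlus R ι ηe ηo 𝒟e 𝒟o n γ := by
  obtain ⟨ha, hb⟩ := hB.neg
  have hρ : IsDiscreteRep (gamRep R ι) := isDiscreteRep_gamRep ha hb hR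
  have ht : TorsionActsTrivially (gamRep R ι) := torsionActsTrivially_gamRep hΓ
  have hnorm : ∀ D ∈ DS ι, ∀ γ : Gam R,
      ‖autFactor R ι (ηe D) (𝒟e D) γ * autFactor R ι (ηo D) (𝒟o D) γ‖ = 1 := fun D hD =>
    norm_autFactor_mul hρ ht (h𝒟e D hD).1 (h𝒟o D hD).1 (hηe D hD) (hηo D hD)
      (ne_zero_of_mem_DS ha hb hD) (h𝒟e D hD).2 (h𝒟o D hD).2
  refine ⟨fun D hD γ => ⟨multipliable_jFactor hρ ht (strongDegZeroPar_zero (h𝒟e D hD).1) (hηe D hD) γ,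
    multipliable_jFactor hρ ht (strongDegZeroPar_one (h𝒟o D hD).1) (hηo D hD) γ, hnorm D hD γ⟩, ?_⟩
  have hG : ∀ n : ℕ, ∃ φ : Gam R →* ℤ_[p]ˣ, ∀ γ,
      algebraMap ℚ_[p] ℂ_[p] (((φ γ : ℤ_[p]ˣ) : ℤ_[p]) : ℚ_[p]) =
        GPlus R ι ηe ηo 𝒟e 𝒟o n γ := by
    intro n
    by_cases hD : (n : ℤ) ∈ DS ι
    · have h0 := ne_zero_of_mem_DS ha hb hD
      obtain ⟨he, hle⟩ := h𝒟e n hD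
      obtain ⟨ho, hlo⟩ := h𝒟o n hD
      have he := strongDegZeroPar_zero he
      have ho := strongDegZeroPar_one ho
      obtain ⟨φ, hφ⟩ := exists_unitHom (f := fun γ => autFactor R ι (ηe n) (𝒟e n) γ *
        autFactor R ι (ηo n) (𝒟o n) γ)
        (fun γ γ' => by
          rw [autFactor_mul hρ ht he (hηe n hD), autFactor_mul hρ ht ho (hηo n hD)]
          ring)
        (hnorm n hD)
        -- Each of the two automorphy factors is in `ℚ_p` by itself; the absolute value one is only
        -- available for their product.
        (fun γ => by
          obtain ⟨t, h⟩ := autFactor_mem_range hρ ht he (hηe n hD) h0 hle γ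
          obtain ⟨t', h'⟩ := autFactor_mem_range hρ ht ho (hηo n hD) h0 hlo γ
          exact ⟨t * t', by rw [map_mul, h, h']⟩)
      refine ⟨φ, fun γ => (hφ γ).trans ?_⟩
      rw [GPlus, if_pos hD]
    · refine ⟨1, fun γ => ?_⟩
      rw [GPlus, if_neg hD]
      simp
  choose G hG using hG
  exact ⟨G, hG⟩
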